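/- Let $\Delta$ be the root system of a semisimple, simply connected algebraic group $G$, i.e. a (finite, reduced, crystallographic) root system spanning a real vector space $V=\mathbb{R}\otimes_{\mathbb Z}\mathbf X$ ($\mathbf X$ the weight lattice), with a fixed base, positive roots $\Delta^+$, and $\rho$ half the sum of the positive roots. Let $W=W_{\mathrm f}\ltimes\mathbb Z\Delta$ be the affine Weyl group acting on $V$, $A_{\mathrm{fund}}=\{x: 0<\langle x,\alpha^\vee\rangle<1\ \forall\alpha\in\Delta^+\}$ the fundamental alcove, $S$ the reflections in the walls of $A_{\mathrm{fund}}$, $S_{\mathrm f}\subset S$ the reflections in the simple roots, $\mathscr C^+$ the open dominant chamber, $\mathscr A$ the set of alcoves; $w\mapsto w(A_{\mathrm{fund}})$ is a bijection $W\to\mathscr A$, and $x(A_{\mathrm{fund}})\cdot w:=xw(A_{\mathrm{fund}})$. Let $\mathscr A^+$, resp. $\mathscr A^+_\rho$, be the set of alcoves contained in $\mathscr C^+$, resp. $\rho+\mathscr C^+$; then $\mathscr A^+_\rho\subset\mathscr A^+$. Let $\mathcal H$ be the Hecke algebra of $(W,S)$ over $\mathbb Z[v^{\pm1}]$, with standard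 basis $(H_w)_{w \in W}$, normalized by $(H_s+v)(H_s-v^{-1})=0$ for $s\in S$. Let $\underline H_w$ be the Kazhdan–Lusztig basis: the unique element of $H_w+\sum_{y}v\mathbb Z[v]H_y$ fixed by the ring involution $v\mapsto v^{-1}$, $H_y\mapsto (H_{y^{-1}})^{-1}$. Let $\mathcal M^{\mathrm{asph}}=\mathsf{sgn}\otimes_{\mathcal H_{\mathrm f}}\mathcal H$, where $\mathcal H_{\mathrm f}$ is generated by the $H_s$, $s\in S_{\mathrm f}$, acting on $\mathsf{sgn}=\mathbb{Z}[v^{\pm1}]$ by $-v$; for $A=w(A_{\mathrm{fund}})\in\mathscr A^+$ put $\underline N_A=1\otimes\underline H_w$. Let $\overline\rho$ be the unique point of $\overline{A_{\mathrm{fund}}}\cap W\rho$, let $W_{\overline\rho}$ be its isotropy group in $W$, with longest element $w_{\overline\rho}$, and let $\mathcal M^{\mathrm{sph}}_{\overline\rho}=\mathsf{triv}_{\overline\rho}\otimes_{\mathcal H_{\overline\rho}}\mathcal H$, where $\mathcal H_{\overline\rho}$ is generated by the $H_s$, $s\in S\cap W_{\overline\rho}$, acting on $\mathsf{triv}_{\overline\rho}=\mathbb{Z}[v^{\pm1}]$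 by $v^{-1}$. The rule $1\otimes h\mapsto\underline H_{w_{\overline\rho}}h$ defines an injective morphism of right $\mathcal H$-modules $\zeta:\mathcal M^{\mathrm{sph}}_{\overline\rho}\to\mathcal H$, and for $A\in\mathscr A^+_\rho$, with $w\in W$ such that $(\rho+A_{\mathrm{fund}})\cdot w=A$, the element $\underline H_{w_{\overline\rho}w}$ lies in the image of $\zeta$; let $\underline M^\rho_A$ be its preimage. Then the rule $1\otimes h\mapsto\underline N_{\rho+A_{\mathrm{fund}}}\cdot h$ is a well-defined morphism of right $\mathcal H$-modules $\varphi_\rho:\mathcal M^{\mathrm{sph}}_{\overline\rho}\to\mathcal M^{\mathrm{asph}}$, and for every alcove $A\in\mathscr A^+_\rho$ $$\varphi_\rho(\underline M^\rho_A)=\underline N_A .$$ In particular $\varphi_\rho$ maps the Kazhdan–Lusztig basis of the twisted spherical module onto the part $(\underline N_A)_{A\in\mathscr A^+_\rho}$ of the Kazhdan–Lusztig basis of the antispherical module. -/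

import Mathlib

open scoped LaurentPolynomial RightActions Pointwise

noncomputable section

namespace AlcoveKL

/-! ## Hecke algebras, induced modules, Kazhdan–Lusztig elements -/

section Hecke

variable {G : Type*} [Group G]

/-- Length of `g` with respect to a generating set `S` of involutions: the least length of a word in
`S` with product `g`. -/
def length (S : Set G) (g : G) : ℕ :=
  sInf {n | ∃ l : List G, (∀ s ∈ l, s ∈ S) ∧ l.prod = g ∧ l.length = n}

/-- The variable `v` of the ring `ℤ[v, v⁻¹]` (Mathlib's `ℤ[T;T⁻¹]`). -/
def v : ℤ[T;T⁻¹] := LaurentPolynomial.T 1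

/-- The inverse of `v`. -/
def vinv : ℤ[T;T⁻¹] := LaurentPolynomial.T (-1)

/-- The defining relations of the Hecke algebra of `(G, S)`, in Soergel's normalization:
`H_1 = 1`, `(H_s + v) (H_s - v⁻¹) = 0` for `s ∈ S`, and `H_x H_y = H_{xy}` if lengths add. -/
inductive HeckeRel (S : Set G) : FreeAlgebra ℤ[T;T⁻¹] G → FreeAlgebra ℤ[T;T⁻¹] G → Prop
  | one : HeckeRel S (FreeAlgebra.ι _ 1) 1
  | quad (s : G) (hs : s ∈ S) :
      HeckeRel S ((FreeAlgebra.ι _ s + algebraMap _ _ v) * (FreeAlgebra.ι _ s - algebraMap _ _ vinv))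
        0
  | mul (x y : G) (h : length S (x * y) = length S x + length S y) :
      HeckeRel S (FreeAlgebra.ι _ x * FreeAlgebra.ι _ y) (FreeAlgebra.ι _ (x * y))

/-- The Hecke algebra of the Coxeter system `(G, S)`, over `ℤ[v, v⁻¹]`. -/
def Hecke (S : Set G) : Type _ := RingQuot (HeckeRel S)

instance (S : Set G) : Ring (Hecke S) := inferInstanceAs (Ring (RingQuot (HeckeRel S)))

instance (S : Set G) : Algebra ℤ[T;T⁻¹] (Hecke S) :=
  inferInstanceAs (Algebra ℤ[T;T⁻¹] (RingQuot (HeckeRel S)))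

/-- The standard basis element `H_w`. -/
def H (S : Set G) (w : G) : Hecke S :=
  RingQuot.mkAlgHom ℤ[T;T⁻¹] (HeckeRel S) (FreeAlgebra.ι _ w)

/-- `d` is the Kazhdan–Lusztig involution: the ring endomorphism with `v ↦ v⁻¹` and
`H_w ↦ (H_{w⁻¹})⁻¹`. (There is at most one such `d`, since the `H_w` generate.) -/
def IsBar (S : Set G) (d : Hecke S →+* Hecke S) : Prop :=
  (∀ a : ℤ[T;T⁻¹],
    d (algebraMap _ (Hecke S) a) = algebraMap _ (Hecke S) (LaurentPolynomial.invert a)) ∧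
  ∀ w : G, d (H S w) * H S w⁻¹ = 1 ∧ H S w⁻¹ * d (H S w) = 1

/-- `h` is the Kazhdan–Lusztig element of `w`: it is fixed by the Kazhdan–Lusztig involution and
belongs to `H_w + ∑_y v ℤ[v] H_y`. -/
def IsKLElement (S : Set G) (w : G) (h : Hecke S) : Prop :=
  (∃ d : Hecke S →+* Hecke S, IsBar S d ∧ d h = h) ∧
  h - H S w ∈ Submodule.span ℤ
    {x : Hecke S | ∃ (n : ℕ) (y : G), x = (v ^ (n + 1)) • H S y}

/-- The Kazhdan–Lusztig basis element `\underline{H}_w` of the Hecke algebra. -/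
def KL (S : Set G) (w : G) : Hecke S := Classical.epsilon (IsKLElement S w)

/-- For a character `H_s ↦ c` (`s ∈ J`) of the subalgebra `𝓗_J` of `𝓗` generated by the `H_s` with
`s ∈ J`, the submodule (for the right action) of `𝓗` generated by the elements `H_s - c`. -/
def inducedRel (S J : Set G) (c : ℤ[T;T⁻¹]) : Submodule (Hecke S)ᵐᵒᵖ (Hecke S) :=
  Submodule.span (Hecke S)ᵐᵒᵖ {x | ∃ s ∈ J, x = H S s - algebraMap _ (Hecke S) c}

/-- The right `𝓗`-module `χ ⊗_{𝓗_J} 𝓗`, where `χ` is `ℤ[v, v⁻¹]` with `H_s` acting by `c` for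
`s ∈ J`. As `χ` is free of rank one over `ℤ[v, v⁻¹]`, this tensor product is the quotient of `𝓗`
by the elements `b h - χ(b) h` with `b ∈ 𝓗_J`, `h ∈ 𝓗`, and it is enough to let `b` run through
the generators `H_s`. -/
abbrev Induced (S J : Set G) (c : ℤ[T;T⁻¹]) : Type _ := Hecke S ⧸ inducedRel S J c

/-- The element `1 ⊗ h` of `χ ⊗_{𝓗_J} 𝓗`. -/
def oneTmul (S J : Set G) (c : ℤ[T;T⁻¹]) (h : Hecke S) : Induced S J c :=
  Submodule.Quotient.mk h

end Hecke

/-! ## The affine Weyl group and its alcoves -/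

section Alcoves

variable {ι V N : Type*} [AddCommGroup V] [Module ℝ V] [AddCommGroup N] [Module ℝ N]
  (P : RootPairing ι ℝ V N)

/-- The affine Weyl group `W = W_f ⋉ ℤΔ` acting on `V`: the group of affine transformations
generated by the reflections `s_α` and the translations `t_α`, for all roots `α`. -/
def affineWeyl : Subgroup (V ≃ᵃ[ℝ] V) :=
  Subgroup.closure
    (Set.range (fun i => (P.reflection i).toAffineEquiv) ∪
      Set.range (fun i => AffineEquiv.constVAdd ℝ V (P.root i)))

/-- The action of `W` on points of `V`. -/
def act (w : affineWeyl P) (x : V) : V := (w : V ≃ᵃ[ℝ] V) x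

/-- The left action of `W` on subsets of `V`. -/
def actSet (w : affineWeyl P) (A : Set V) : Set V := act P w '' A

/-- The reflection hyperplane `⟨x, α_i^∨⟩ = k`. -/
def hyperplane (i : ι) (k : ℤ) : Set V := {x | P.coroot' i x = k}

variable {P} (b : P.Base)

/-- The fundamental alcove. -/
def fundAlcove : Set V := {x | ∀ i, b.IsPos i → 0 < P.coroot' i x ∧ P.coroot' i x < 1}

/-- The closure of the fundamental alcove. -/
def fundAlcoveClosure : Set V := {x | ∀ i, b.IsPos i → 0 ≤ P.coroot' i x ∧ P.coroot' i x ≤ 1}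

/-- The open dominant Weyl chamber. -/
def chamber : Set V := {x | ∀ i, b.IsPos i → 0 < P.coroot' i x}

/-- The set of alcoves: the nonempty sets `{x | n_α < ⟨x, α^∨⟩ < n_α + 1 for all α > 0}` with
integers `n_α`. These are the connected components of the complement of all hyperplanes. -/
def alcoves : Set (Set V) :=
  {A | A.Nonempty ∧ ∃ n : ι → ℤ,
    A = {x | ∀ i, b.IsPos i → (n i : ℝ) < P.coroot' i x ∧ P.coroot' i x < n i + 1}}

/-- `𝒜^+_μ`: the alcoves contained in `μ + 𝒞^+`. -/
def alcovesAt (μ : V) : Set (Set V) := {A ∈ alcoves b | A ⊆ μ +ᵥ chamber b}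

/-- A reflection hyperplane is a wall of the fundamental alcove if some point of it lies in the
closure of the fundamental alcove and on no other reflection hyperplane. -/
def IsWall (i : ι) (k : ℤ) : Prop :=
  ∃ x ∈ fundAlcoveClosure b, x ∈ hyperplane P i k ∧
    ∀ j m, x ∈ hyperplane P j m → hyperplane P j m = hyperplane P i k

/-- The set `S` of simple reflections of `W`: the reflections in the walls of the fundamental
alcove. -/
def simpleRefl : Set (affineWeyl P) :=
  {s | ∃ i k, IsWall b i k ∧ ∀ x, act P s x = x - (P.coroot' i x - k) • P.root i}

/-- The set `S_f` of simple reflections of `W_f`: the reflections in the simple roots. -/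
def simpleReflFin : Set (affineWeyl P) :=
  {s | ∃ i ∈ b.support, ∀ x, act P s x = P.reflection i x}

/-- Half the sum of the positive roots. -/
def rho : V := (1 / 2 : ℝ) • ∑ᶠ (i : ι) (_ : b.IsPos i), P.root i

/-- `μ` belongs to the closure of the fundamental alcove and to the `W`-orbit of `x`. -/
def IsFundRep (x μ : V) : Prop := μ ∈ fundAlcoveClosure b ∧ ∃ w : affineWeyl P, act P w x = μ

/-- `\overline{ρ}`: the unique point of the `W`-orbit of `ρ` in the closure of the fundamental
alcove. -/
def rhoBar : V := Classical.epsilon (IsFundRep b (rho b))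

/-- The isotropy group `W_{\overline{ρ}}` of `\overline{ρ}` in `W`. -/
def isotropy : Set (affineWeyl P) := {w | act P w (rhoBar b) = rhoBar b}

/-- `w` is an element of maximal length of `W_{\overline{ρ}}`. -/
def IsLongest (w : affineWeyl P) : Prop :=
  w ∈ isotropy b ∧ ∀ y ∈ isotropy b, length (simpleRefl b) y ≤ length (simpleRefl b) w

/-- The longest element `w_{\overline{ρ}}` of `W_{\overline{ρ}}`. -/
def longest : affineWeyl P := Classical.epsilon (IsLongest b)

/-- The element `w` of `W` with `w(A_fund) = A`. -/
def alcoveElt (A : Set V) : affineWeyl P :=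
  Classical.epsilon fun w => actSet P w (fundAlcove b) = A

/-- The alcove `ρ + A_fund`. -/
def rhoAlcove : Set V := rho b +ᵥ fundAlcove b

/-- The element `w` of `W` with `(ρ + A_fund) · w = A`, where the right action of `W` on alcoves is
`x(A_fund) · w = xw(A_fund)`. -/
def rhoElt (A : Set V) : affineWeyl P := (alcoveElt b (rhoAlcove b))⁻¹ * alcoveElt b A

/-- The Hecke algebra `𝓗` of the affine Weyl group. -/
abbrev AffHecke : Type _ := Hecke (simpleRefl b)

/-- The antispherical module: `H_s` acts by `-v` for `s ∈ S_f`. -/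
abbrev Asph : Type _ := Induced (simpleRefl b) (simpleReflFin b) (-v)

/-- The twisted spherical module: `H_s` acts by `v⁻¹` for `s ∈ S ∩ W_{\overline{ρ}}`. -/
abbrev Sph : Type _ := Induced (simpleRefl b) (simpleRefl b ∩ isotropy b) vinv

/-- The element `1 ⊗ h` of the antispherical module. -/
def asphMk (h : AffHecke b) : Asph b := oneTmul (simpleRefl b) (simpleReflFin b) (-v) h

/-- The element `1 ⊗ h` of the twisted spherical module. -/
def sphMk (h : AffHecke b) : Sph b := oneTmul (simpleRefl b) (simpleRefl b ∩ isotropy b) vinv h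

/-- The Kazhdan–Lusztig element `\underline{N}_A = 1 ⊗ \underline{H}_w`, where `w(A_fund) = A`. -/
def asphKL (A : Set V) : Asph b := asphMk b (KL (simpleRefl b) (alcoveElt b A))

/-- The Kazhdan–Lusztig element `\underline{M}^ρ_A`, where `(ρ + A_fund) · w = A`: the preimage of
`\underline{H}_{w_{\overline{ρ}} w}` under `ζ : 1 ⊗ h ↦ \underline{H}_{w_{\overline{ρ}}} h`. -/
def sphKL (A : Set V) : Sph b :=
  Classical.epsilon fun m => ∃ h : AffHecke b, m = sphMk b h ∧
    KL (simpleRefl b) (longest b) * h = KL (simpleRefl b) (longest b * rhoElt b A)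

end Alcoves

end AlcoveKL

end

noncomputable section

namespace AlcoveKL

/-! ### Hecke algebras of abstract Coxeter systems -/

section HeckeTheory

variable {G : Type*} [Group G]

/-! Let `x` and `u` be the elements of W that map A_fund to ρ + A_fund and to ρ - A_fund. Both
alcoves have ρ in their closure and lie opposite each other there, so x = u w₀ with w₀ the longest
element of W_ρbar, and ℓ(ut) = ℓ(u) + ℓ(t) for all t in W_ρbar. Put C = ∑ v^(ℓ(w₀) - ℓ(t)) H_t over
t in W_ρbar. It is the Kazhdan–Lusztig element of w₀ (`KL_longest`), and H_s with s in S ∩ W_ρbar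
multiplies it by v⁻¹ on either side. Everything rests on two properties of 1 ⊗ H_u C in the
antispherical module.

Self-duality. The involution fixes C and changes H_u by a combination of H_y with ℓ(y) < ℓ(u), so it
is enough that 1 ⊗ H_y C = 0 for these y (`oneTmul_H_mul_parabolicSum_eq_zero`). Removing left
descents in S_f and right descents in W_ρbar, one may assume that y(A_fund) is dominant and y is
minimal in y W_ρbar. The point y(ρbar) is integral and dominant. If it is strictly dominant it is at
least ρ on all positive coroots, and then ℓ(y) ≥ ℓ(u). So it lies on the wall of a simple reflection
s, and sy = yt with t in S ∩ W_ρbar. Hence -v and v⁻¹ multiply 1 ⊗ H_y C to the same vector, which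
forces it to vanish.

Leading term. For z minimal in W_ρbar z, expand 1 ⊗ H_u C H_z = ∑ v^(ℓ(w₀) - ℓ(t)) (1 ⊗ H_{ut} H_z).
The term t = w₀ is 1 ⊗ H_{xz}. The others lie in v times the ℤ[v]-lattice spanned by all 1 ⊗ H_w:
expanding H_{ut} H_z amounts to folding a gallery, each fold costs at most one factor v⁻¹
(`pow_smul_oneTmul_mem_lat`), and the number of costly folds is smaller than ℓ(w₀) - ℓ(t)
(`ncard_foldSet_lt`).

The rest is formal (`IsSteinbergElement`). A self-dual element of the antispherical module is
determined modulo v times the lattice. With z = 1 this gives 1 ⊗ H_u C = 1 ⊗ KL(x), so φ is well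
defined and commutes with the involutions. Since φ maps 1 ⊗ H_z to 1 ⊗ H_{xz} modulo v, it maps
self-dual elements with a given leading term to Kazhdan–Lusztig elements. The Coxeter properties of
W come from geometry: the length is the number of separating hyperplanes (`length_eq_ncard_sep`). -/

lemma v_mul_vinv : v * vinv = 1 := by
  rw [v, vinv, ← LaurentPolynomial.T_add, add_neg_cancel, LaurentPolynomial.T_zero]

lemma vinv_mul_v : vinv * v = 1 := by
  rw [mul_comm, v_mul_vinv]

/-- The combinatorial properties of the length function of a Coxeter system on which the
theory of the Hecke algebra rests. -/
structure IsCoxeterLike (S : Set G) : Prop where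
  mul_self : ∀ s ∈ S, s * s = 1
  length_inv : ∀ w, length S w⁻¹ = length S w
  length_mul : ∀ s ∈ S, ∀ w,
    length S (s * w) = length S w + 1 ∨ length S w = length S (s * w) + 1
  -- In terms of alcoves: the wall of s separates w from wt only if it is their common wall, and
  -- then sw = wt.
  exchange : ∀ s ∈ S, ∀ t ∈ S, ∀ w, length S (s * w) = length S w + 1 →
    length S (w * t) = length S (s * w * t) + 1 → s * w = w * t
  exists_descent : ∀ w, w ≠ 1 → ∃ s ∈ S, length S w = length S (s * w) + 1

lemma length_one (S : Set G) : length S 1 = 0 :=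
  Nat.sInf_eq_zero.2 (Or.inl ⟨[], by simp⟩)

namespace IsCoxeterLike

variable {S : Set G} (hS : IsCoxeterLike S)
include hS

lemma inv_eq {s : G} (hs : s ∈ S) : s⁻¹ = s :=
  inv_eq_of_mul_eq_one_left (hS.mul_self s hs)

lemma mul_cancel {s : G} (hs : s ∈ S) (w : G) : s * (s * w) = w := by
  rw [← mul_assoc, hS.mul_self s hs, one_mul]

lemma mul_cancel_right {s : G} (hs : s ∈ S) (w : G) : w * s * s = w := by
  rw [mul_assoc, hS.mul_self s hs, mul_one]

lemma length_mul_right {s : G} (hs : s ∈ S) (w : G) :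
    length S (w * s) = length S w + 1 ∨ length S w = length S (w * s) + 1 := by
  rw [← hS.length_inv (w * s), ← hS.length_inv w, mul_inv_rev, hS.inv_eq hs]
  exact hS.length_mul s hs _

lemma length_simple {s : G} (hs : s ∈ S) : length S s = 1 := by
  have := hS.length_mul s hs 1
  rw [mul_one, length_one] at this
  omega

lemma induction_left {p : G → Prop} (h1 : p 1)
    (hmul : ∀ s ∈ S, ∀ w, length S (s * w) = length S w + 1 → p w → p (s * w)) (w : G) : p w := by
  induction hn : length S w using Nat.strong_induction_on generalizing w with
  | _ n ih =>
    by_cases hw : w = 1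
    · exact hw ▸ h1
    obtain ⟨s, hs, h⟩ := hS.exists_descent w hw
    have := hmul s hs (s * w) (by rw [hS.mul_cancel hs]; exact h) (ih _ (by omega) _ rfl)
    rwa [hS.mul_cancel hs] at this

lemma induction_right {p : G → Prop} (h1 : p 1)
    (hmul : ∀ s ∈ S, ∀ w, length S (w * s) = length S w + 1 → p w → p (w * s)) (w : G) : p w := by
  rw [← inv_inv w]
  refine hS.induction_left (p := fun w => p w⁻¹) (by simpa using h1) (fun s hs w hl hw => ?_) w⁻¹
  have := hmul s hs w⁻¹ (by
    rw [← hS.length_inv, mul_inv_rev, hS.inv_eq hs, inv_inv, hS.length_inv, hl]) hw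
  rwa [mul_inv_rev, hS.inv_eq hs]

lemma length_mul_le (x y : G) : length S (x * y) ≤ length S x + length S y := by
  induction x using hS.induction_left with
  | h1 => simp
  | hmul s hs w hl ih =>
    have := hS.length_mul s hs (w * y)
    rw [← mul_assoc] at this
    omega

end IsCoxeterLike

/-! ### The regular representation -/

/-- Left multiplication by `H_s` on the free module on `G`. -/
def regLeft (S : Set G) (s : G) : (G →₀ ℤ[T;T⁻¹]) →ₗ[ℤ[T;T⁻¹]] (G →₀ ℤ[T;T⁻¹]) :=
  Finsupp.linearCombination _ fun w => Finsupp.single (s * w) 1 +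
    if length S (s * w) < length S w then Finsupp.single w (vinv - v) else 0

/-- Right multiplication by `H_s` on the free module on `G`. -/
def regRight (S : Set G) (s : G) : (G →₀ ℤ[T;T⁻¹]) →ₗ[ℤ[T;T⁻¹]] (G →₀ ℤ[T;T⁻¹]) :=
  Finsupp.linearCombination _ fun w => Finsupp.single (w * s) 1 +
    if length S (w * s) < length S w then Finsupp.single w (vinv - v) else 0

lemma regLeft_single (S : Set G) (s w : G) (a : ℤ[T;T⁻¹]) :
    regLeft S s (Finsupp.single w a) = Finsupp.single (s * w) a +
      if length S (s * w) < length S w then Finsupp.single w (a * (vinv - v)) else 0 := by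
  rw [regLeft, Finsupp.linearCombination_single, smul_add, Finsupp.smul_single, smul_eq_mul, mul_one]
  split_ifs
  · rw [Finsupp.smul_single, smul_eq_mul]
  · rw [smul_zero]

lemma regRight_single (S : Set G) (s w : G) (a : ℤ[T;T⁻¹]) :
    regRight S s (Finsupp.single w a) = Finsupp.single (w * s) a +
      if length S (w * s) < length S w then Finsupp.single w (a * (vinv - v)) else 0 := by
  rw [regRight, Finsupp.linearCombination_single, smul_add, Finsupp.smul_single, smul_eq_mul, mul_one]
  split_ifs
  · rw [Finsupp.smul_single, smul_eq_mul]
  · rw [smul_zero]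

variable {S : Set G} (hS : IsCoxeterLike S)
include hS

/-- If s w ≠ w t, the exchange condition shows that multiplying by s does not change whether t is a
right descent, and conversely, so both orders produce the same terms. If s w = w t, the two
expressions agree directly. -/
lemma regLeft_comm_regRight {s t : G} (hs : s ∈ S) (ht : t ∈ S) :
    regLeft S s ∘ₗ regRight S t = regRight S t ∘ₗ regLeft S s := by
  ext1 w
  ext1
  have h1 := hS.length_mul s hs w
  have h2 := hS.length_mul_right ht w
  have h3 := hS.length_mul s hs (w * t)
  have h4 := hS.length_mul_right ht (s * w)
  rw [← mul_assoc] at h3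
  simp only [LinearMap.comp_apply, Finsupp.lsingle_apply, regLeft_single, regRight_single,
    map_add, apply_ite (regLeft S s), apply_ite (regRight S t), map_zero, ← mul_assoc]
  by_cases he : s * w = w * t
  · have h6 : s * w * t = w := by rw [he, hS.mul_cancel_right ht]
    rw [h6, he]
  · have e1 : ¬ (length S (s * w) = length S w + 1 ∧ length S (w * t) = length S (s * w * t) + 1) :=
      fun h => he (hS.exchange s hs t ht w h.1 h.2)
    have e2 : ¬ (length S (s * w * t) = length S (w * t) + 1 ∧
        length S w = length S (s * w) + 1) := fun h => by
      refine he ?_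
      have := hS.exchange s hs t ht (w * t) (by rw [← mul_assoc]; exact h.1) (by
        rw [hS.mul_cancel_right ht, ← mul_assoc, hS.mul_cancel_right ht]; exact h.2)
      rw [hS.mul_cancel_right ht, ← mul_assoc] at this
      rw [← hS.mul_cancel_right ht (s * w), this]
    have e3 : (length S (s * w * t) < length S (w * t)) ↔ length S (s * w) < length S w := by omega
    have e4 : (length S (s * w * t) < length S (s * w)) ↔ length S (w * t) < length S w := by omega
    simp only [e3, e4]
    split_ifs <;> abel

omit hS in
/-- The operators on the free module on `G` that commute with right multiplications. -/
def IsLeftOp (S : Set G) (T : (G →₀ ℤ[T;T⁻¹]) →ₗ[ℤ[T;T⁻¹]] (G →₀ ℤ[T;T⁻¹])) : Prop :=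
  ∀ t ∈ S, T ∘ₗ regRight S t = regRight S t ∘ₗ T

/-- Right multiplications along a reduced word carry the vector at 1 to the vector at any w. So
relations between operators commuting with them need to be checked at a single vector only. -/
lemma IsLeftOp.ext {T T' : (G →₀ ℤ[T;T⁻¹]) →ₗ[ℤ[T;T⁻¹]] (G →₀ ℤ[T;T⁻¹])}
    (hT : IsLeftOp S T) (hT' : IsLeftOp S T')
    (h : T (Finsupp.single 1 1) = T' (Finsupp.single 1 1)) : T = T' := by
  ext1 w
  ext1
  simp only [LinearMap.comp_apply, Finsupp.lsingle_apply]
  induction w using hS.induction_right with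
  | h1 => exact h
  | hmul t ht w hl ih =>
    have : Finsupp.single (w * t) (1 : ℤ[T;T⁻¹]) = regRight S t (Finsupp.single w 1) := by
      rw [regRight_single, if_neg (by omega), add_zero]
    rw [this, ← LinearMap.comp_apply, hT t ht, ← LinearMap.comp_apply, hT' t ht]
    simp [ih]

lemma exists_isLeftOp (w : G) :
    ∃ T : (G →₀ ℤ[T;T⁻¹]) →ₗ[ℤ[T;T⁻¹]] (G →₀ ℤ[T;T⁻¹]),
      IsLeftOp S T ∧ T (Finsupp.single 1 1) = Finsupp.single w 1 := by
  induction w using hS.induction_left with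
  | h1 => exact ⟨LinearMap.id, fun t _ => rfl, rfl⟩
  | hmul s hs w hl ih =>
    obtain ⟨T, hT, h1⟩ := ih
    refine ⟨regLeft S s ∘ₗ T, fun t ht => ?_, ?_⟩
    · rw [LinearMap.comp_assoc, hT t ht, ← LinearMap.comp_assoc, regLeft_comm_regRight hS hs ht,
        LinearMap.comp_assoc]
    · rw [LinearMap.comp_apply, h1, regLeft_single, if_neg (by omega), add_zero]

/-- The operator of left multiplication by `H_w` on the free module on `G`. -/
def leftOp (w : G) : Module.End ℤ[T;T⁻¹] (G →₀ ℤ[T;T⁻¹]) := (exists_isLeftOp hS w).choose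

lemma isLeftOp_leftOp (w : G) : IsLeftOp S (leftOp hS w) := (exists_isLeftOp hS w).choose_spec.1

lemma leftOp_single_one (w : G) : leftOp hS w (Finsupp.single 1 1) = Finsupp.single w 1 :=
  (exists_isLeftOp hS w).choose_spec.2

lemma leftOp_single {x y : G} (h : length S (x * y) = length S x + length S y) :
    leftOp hS x (Finsupp.single y 1) = Finsupp.single (x * y) 1 := by
  induction y using hS.induction_right with
  | h1 => rw [leftOp_single_one, mul_one]
  | hmul t ht y hl ih =>
    have h1 := hS.length_mul_le x y
    have h2 := hS.length_mul_right ht (x * y)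
    rw [← mul_assoc] at h
    have : Finsupp.single (y * t) (1 : ℤ[T;T⁻¹]) = regRight S t (Finsupp.single y 1) := by
      rw [regRight_single, if_neg (by omega), add_zero]
    rw [this, ← LinearMap.comp_apply, isLeftOp_leftOp hS x t ht, LinearMap.comp_apply,
      ih (by omega), regRight_single, if_neg (by omega), add_zero, mul_assoc]

/-- The left regular representation of the Hecke algebra. -/
def regRep : Hecke S →ₐ[ℤ[T;T⁻¹]] Module.End ℤ[T;T⁻¹] (G →₀ ℤ[T;T⁻¹]) :=
  RingQuot.liftAlgHom ℤ[T;T⁻¹] ⟨FreeAlgebra.lift _ (leftOp hS), by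
    intro x y hxy
    induction hxy with
    | one =>
      rw [FreeAlgebra.lift_ι_apply, map_one]
      refine IsLeftOp.ext hS (isLeftOp_leftOp hS 1) (fun _ _ => rfl) ?_
      rw [leftOp_single_one]; rfl
    | quad s hs =>
      simp only [map_mul, map_add, map_sub, FreeAlgebra.lift_ι_apply, AlgHom.commutes, map_zero]
      have hl : leftOp hS s = regLeft S s := by
        refine IsLeftOp.ext hS (isLeftOp_leftOp hS s)
          (fun t ht => regLeft_comm_regRight hS hs ht) ?_
        rw [leftOp_single_one, regLeft_single, mul_one, if_neg (by simp [length_one]), add_zero]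
      have hA (a : ℤ[T;T⁻¹]) (x : G →₀ ℤ[T;T⁻¹]) :
          (algebraMap ℤ[T;T⁻¹] (Module.End ℤ[T;T⁻¹] (G →₀ ℤ[T;T⁻¹])) a) x = a • x := rfl
      refine IsLeftOp.ext hS (fun t ht => ?_) (fun _ _ => by simp) ?_
      · have h := isLeftOp_leftOp hS s t ht
        refine LinearMap.ext fun x => ?_
        have h' (x) := LinearMap.congr_fun h x
        simp only [LinearMap.comp_apply] at h'
        simp [Module.End.mul_apply, h', hA]
      · simp only [Module.End.mul_apply, LinearMap.sub_apply, LinearMap.add_apply, hA,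
          leftOp_single_one, LinearMap.zero_apply, map_sub, map_smul]
        rw [hl, regLeft_single, hS.mul_self s hs, if_pos (by
          rw [length_one, hS.length_simple hs]; omega)]
        have : (vinv - v) = (vinv - v) • (1 : ℤ[T;T⁻¹]) := by simp
        rw [one_mul, this, ← Finsupp.smul_single, smul_add, smul_smul vinv v, vinv_mul_v, one_smul,
          sub_smul]
        abel
    | mul x y h =>
      rw [map_mul]
      simp only [FreeAlgebra.lift_ι_apply]
      refine IsLeftOp.ext hS (fun t ht => ?_) (isLeftOp_leftOp hS _) ?_
      · rw [Module.End.mul_eq_comp, LinearMap.comp_assoc, isLeftOp_leftOp hS y t ht,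
          ← LinearMap.comp_assoc, isLeftOp_leftOp hS x t ht, LinearMap.comp_assoc]
      · rw [Module.End.mul_apply, leftOp_single_one, leftOp_single_one, leftOp_single hS h]⟩

lemma regRep_H (w : G) : regRep hS (H S w) = leftOp hS w := by
  simp only [regRep, H]
  exact (RingQuot.liftAlgHom_mkAlgHom_apply _ _ _ _).trans (FreeAlgebra.lift_ι_apply _ _)

/-! ### The standard basis of the Hecke algebra -/

omit hS in
lemma H_one : H S 1 = 1 := by
  have := RingQuot.mkAlgHom_rel ℤ[T;T⁻¹] (HeckeRel.one (S := S))
  rw [map_one] at this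
  exact this

omit hS in
lemma H_mul {x y : G} (h : length S (x * y) = length S x + length S y) :
    H S x * H S y = H S (x * y) := by
  have := RingQuot.mkAlgHom_rel ℤ[T;T⁻¹] (HeckeRel.mul (S := S) x y h)
  rw [map_mul] at this
  exact this

omit hS in
lemma H_quad {s : G} (hs : s ∈ S) :
    (H S s + algebraMap _ _ v) * (H S s - algebraMap _ _ vinv) = 0 := by
  have := RingQuot.mkAlgHom_rel ℤ[T;T⁻¹] (HeckeRel.quad (S := S) s hs)
  rw [map_mul, map_zero, map_add, map_sub, AlgHom.commutes, AlgHom.commutes] at this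
  exact this

omit hS in
lemma H_sq {s : G} (hs : s ∈ S) : H S s * H S s = 1 + (vinv - v) • H S s := by
  have h := H_quad hs
  rw [add_mul, mul_sub, mul_sub, ← Algebra.commutes, ← map_mul, v_mul_vinv, map_one,
    ← Algebra.smul_def, ← Algebra.smul_def] at h
  rw [sub_smul, ← sub_eq_zero, ← h]
  abel

lemma H_simple_mul_of_lt {s : G} (hs : s ∈ S) {w : G} (h : length S w < length S (s * w)) :
    H S s * H S w = H S (s * w) := by
  have := hS.length_mul s hs w
  refine H_mul ?_
  rw [hS.length_simple hs]; omega

lemma H_simple_mul_of_gt {s : G} (hs : s ∈ S) {w : G} (h : length S (s * w) < length S w) :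
    H S s * H S w = H S (s * w) + (vinv - v) • H S w := by
  have h1 := H_simple_mul_of_lt hS hs (w := s * w) (by rw [hS.mul_cancel hs]; exact h)
  rw [hS.mul_cancel hs] at h1
  rw [← h1, ← mul_assoc, H_sq hs, add_mul, one_mul, smul_mul_assoc]

lemma H_mul_simple_of_lt {s : G} (hs : s ∈ S) {w : G} (h : length S w < length S (w * s)) :
    H S w * H S s = H S (w * s) := by
  have := hS.length_mul_right hs w
  refine H_mul ?_
  rw [hS.length_simple hs]; omega

lemma H_mul_simple_of_gt {s : G} (hs : s ∈ S) {w : G} (h : length S (w * s) < length S w) :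
    H S w * H S s = H S (w * s) + (vinv - v) • H S w := by
  have h1 := H_mul_simple_of_lt hS hs (w := w * s) (by rw [hS.mul_cancel_right hs]; exact h)
  rw [hS.mul_cancel_right hs] at h1
  nth_rw 1 [← h1]
  rw [mul_assoc, H_sq hs, mul_add, mul_one, mul_smul_comm, h1]

/-- Evaluating the regular representation at the vector of 1 sends H_w to the basis vector of w. -/
lemma linearIndependent_H : LinearIndependent ℤ[T;T⁻¹] (H S) := by
  let f : Hecke S →ₗ[ℤ[T;T⁻¹]] (G →₀ ℤ[T;T⁻¹]) :=
    (LinearMap.applyₗ (Finsupp.single 1 1)) ∘ₗ (regRep hS).toLinearMap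
  refine LinearIndependent.of_comp f ?_
  have : f ∘ H S = fun w => Finsupp.single w 1 := by
    funext w
    simp [f, regRep_H, leftOp_single_one]
  rw [this]
  exact Finsupp.linearIndependent_single_one _ _

/-- The span contains 1 and is stable under left multiplication by the simple H_s, hence by every
H_w along a reduced word, hence by the whole algebra. -/
lemma span_H : Submodule.span ℤ[T;T⁻¹] (Set.range (H S)) = ⊤ := by
  let M := Submodule.span ℤ[T;T⁻¹] (Set.range (H S))
  have hs (s : G) (hs : s ∈ S) (m : Hecke S) (hm : m ∈ M) : H S s * m ∈ M := by
    induction hm using Submodule.span_induction with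
    | mem x hx =>
      obtain ⟨w, rfl⟩ := hx
      rcases hS.length_mul s hs w with h | h
      · rw [H_simple_mul_of_lt hS hs (by omega)]
        exact Submodule.subset_span ⟨_, rfl⟩
      · rw [H_simple_mul_of_gt hS hs (by omega)]
        exact add_mem (Submodule.subset_span ⟨_, rfl⟩)
          (Submodule.smul_mem _ _ (Submodule.subset_span ⟨_, rfl⟩))
    | zero => simp
    | add x y _ _ hx hy => rw [mul_add]; exact add_mem hx hy
    | smul a x _ hx => rw [mul_smul_comm]; exact Submodule.smul_mem _ _ hx
  have hw (w : G) : ∀ m ∈ M, H S w * m ∈ M := by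
    induction w using hS.induction_left with
    | h1 => intro m hm; rwa [H_one, one_mul]
    | hmul s hs' w hl ih =>
      intro m hm
      rw [← H_simple_mul_of_lt hS hs' (by omega), mul_assoc]
      exact hs s hs' _ (ih m hm)
  rw [eq_top_iff]
  rintro h -
  let π : FreeAlgebra ℤ[T;T⁻¹] G →ₐ[ℤ[T;T⁻¹]] Hecke S := RingQuot.mkAlgHom ℤ[T;T⁻¹] (HeckeRel S)
  obtain ⟨x, rfl⟩ : ∃ x, π x = h := RingQuot.mkAlgHom_surjective ℤ[T;T⁻¹] (HeckeRel S) h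
  have key : ∀ m ∈ M, π x * m ∈ M := by
    induction x using FreeAlgebra.induction with
    | grade0 r =>
      intro m hm
      rw [AlgHom.commutes, ← Algebra.smul_def]
      exact M.smul_mem _ hm
    | grade1 w => exact hw w
    | mul a b ha hb =>
      intro m hm
      rw [map_mul, mul_assoc]
      exact ha _ (hb m hm)
    | add a b ha hb =>
      intro m hm
      rw [map_add, add_mul]
      exact add_mem (ha m hm) (hb m hm)
  have := key 1 (by rw [← H_one (S := S)]; exact Submodule.subset_span ⟨_, rfl⟩)
  rwa [mul_one] at this

lemma Hecke.induction {p : Hecke S → Prop} (hH : ∀ w, p (H S w))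
    (hadd : ∀ x y, p x → p y → p (x + y)) (hsmul : ∀ (a : ℤ[T;T⁻¹]) x, p x → p (a • x))
    (h : Hecke S) : p h := by
  have hm : h ∈ Submodule.span ℤ[T;T⁻¹] (Set.range (H S)) := by rw [span_H hS]; trivial
  induction hm using Submodule.span_induction with
  | mem x hx => obtain ⟨w, rfl⟩ := hx; exact hH w
  | zero => simpa using hsmul 0 _ (hH 1)
  | add x y _ _ hx hy => exact hadd x y hx hy
  | smul a x _ hx => exact hsmul a x hx

/-- The standard basis of the Hecke algebra. -/
def heckeBasis : Module.Basis G ℤ[T;T⁻¹] (Hecke S) :=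
  Module.Basis.mk (linearIndependent_H hS) (span_H hS).ge

lemma heckeBasis_apply (w : G) : heckeBasis hS w = H S w := by simp [heckeBasis]

end HeckeTheory

/-! ### Laurent polynomials and the bar involution -/

lemma invert_v : LaurentPolynomial.invert v = vinv := LaurentPolynomial.invert_T 1

lemma invert_vinv : LaurentPolynomial.invert vinv = v := by
  rw [vinv, LaurentPolynomial.invert_T, neg_neg, v]

lemma invert_invert (a : ℤ[T;T⁻¹]) :
    LaurentPolynomial.invert (LaurentPolynomial.invert a) = a :=
  LaurentPolynomial.ext fun n => by simp

/-- The Laurent polynomials in `v ℤ[v]`. -/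
def posPoly : Submodule ℤ ℤ[T;T⁻¹] := Submodule.span ℤ (Set.range fun n : ℕ => v ^ (n + 1))

lemma v_pow (n : ℕ) : v ^ n = LaurentPolynomial.T n := by
  rw [v, LaurentPolynomial.T_pow, mul_one]

lemma coeff_of_mem_posPoly {q : ℤ[T;T⁻¹]} (hq : q ∈ posPoly) {n : ℤ} (hn : n ≤ 0) :
    q.coeff n = 0 := by
  induction hq using Submodule.span_induction with
  | mem x hx =>
    obtain ⟨m, rfl⟩ := hx
    simp only [v_pow, LaurentPolynomial.T_apply]
    exact if_neg (by omega)
  | zero => rfl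
  | add x y _ _ hx hy => simp [hx, hy]
  | smul a x _ hx => rw [AddMonoidAlgebra.coeff_smul, Finsupp.smul_apply, hx, smul_zero]

lemma eq_zero_of_mem_posPoly {q : ℤ[T;T⁻¹]} (hq : q ∈ posPoly)
    (h : LaurentPolynomial.invert q = q) : q = 0 := by
  refine LaurentPolynomial.ext fun n => ?_
  rcases le_total n 0 with hn | hn
  · exact coeff_of_mem_posPoly hq hn
  · rw [← h, LaurentPolynomial.invert_apply]
    exact coeff_of_mem_posPoly hq (by omega)

lemma exists_posPoly_decomposition (r : ℤ[T;T⁻¹]) :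
    ∃ q ∈ posPoly, ∃ q' ∈ posPoly, ∃ c : ℤ,
      r = q + LaurentPolynomial.C c + LaurentPolynomial.invert q' := by
  induction r using LaurentPolynomial.induction_on' with
  | add x y hx hy =>
    obtain ⟨q, hq, q', hq', c, rfl⟩ := hx
    obtain ⟨p, hp, p', hp', c', rfl⟩ := hy
    exact ⟨q + p, add_mem hq hp, q' + p', add_mem hq' hp', c + c', by
      simp only [map_add]; ring⟩
  | C_mul_T n a =>
    have hm (m : ℕ) : LaurentPolynomial.C a * LaurentPolynomial.T (m + 1 : ℕ) ∈ posPoly := by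
      rw [← LaurentPolynomial.smul_eq_C_mul, ← v_pow]
      exact Submodule.smul_mem _ _ (Submodule.subset_span ⟨m, rfl⟩)
    rcases lt_trichotomy n 0 with hn | rfl | hn
    · obtain ⟨m, rfl⟩ : ∃ m : ℕ, n = -(m + 1 : ℕ) := ⟨n.natAbs - 1, by omega⟩
      refine ⟨0, zero_mem _, _, hm m, 0, ?_⟩
      simp [LaurentPolynomial.invert_T]
    · exact ⟨0, zero_mem _, 0, zero_mem _, a, by simp⟩
    · obtain ⟨m, rfl⟩ : ∃ m : ℕ, n = (m + 1 : ℕ) := ⟨n.natAbs - 1, by omega⟩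
      exact ⟨_, hm m, 0, zero_mem _, 0, by simp⟩

/-- Antisymmetry makes the negative part minus the mirror image of the positive part, and the
constant coefficient equals its own negative. -/
lemma exists_sub_invert {r : ℤ[T;T⁻¹]} (hr : LaurentPolynomial.invert r = -r) :
    ∃ q ∈ posPoly, r = q - LaurentPolynomial.invert q := by
  obtain ⟨q, hq, q', hq', c, h⟩ := exists_posPoly_decomposition r
  have hc (n : ℤ) := congrArg (fun x => x.coeff n) hr
  refine ⟨q, hq, LaurentPolynomial.ext fun n => ?_⟩
  have h1 := hc n
  have h2 := hc (-n)
  simp only [h, LaurentPolynomial.invert_apply, map_add, invert_invert,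
    LaurentPolynomial.invert_C, AddMonoidAlgebra.coeff_add, AddMonoidAlgebra.coeff_neg,
    AddMonoidAlgebra.coeff_sub, Finsupp.add_apply, Finsupp.neg_apply, Finsupp.sub_apply,
    LaurentPolynomial.C_apply, neg_neg] at h1 h2 ⊢
  rcases lt_trichotomy n 0 with hn | rfl | hn
  · have e1 := coeff_of_mem_posPoly hq hn.le
    have e2 := coeff_of_mem_posPoly hq' hn.le
    rw [if_neg (by omega)] at h1 h2 ⊢
    omega
  · have e1 := coeff_of_mem_posPoly hq le_rfl
    have e2 := coeff_of_mem_posPoly hq' le_rfl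
    simp only [neg_zero, if_true] at h1 h2 ⊢
    omega
  · have e1 := coeff_of_mem_posPoly hq (n := -n) (by omega)
    have e2 := coeff_of_mem_posPoly hq' (n := -n) (by omega)
    rw [if_neg (by omega)] at h1 h2 ⊢
    omega

/-! ### Kazhdan–Lusztig elements in modules with a bar involution -/

section BarModule

variable {I M : Type*} [AddCommGroup M] [Module ℤ[T;T⁻¹] M]

/-- The lattice `∑ v^n ℤ[v] e_i`. -/
def lat (e : I → M) (n : ℕ) : Submodule ℤ M :=
  Submodule.span ℤ {x | ∃ m i, n ≤ m ∧ x = v ^ m • e i}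

lemma smul_mem_lat (e : I → M) {m n : ℕ} (h : n ≤ m) (i : I) : v ^ m • e i ∈ lat e n :=
  Submodule.subset_span ⟨m, i, h, rfl⟩

lemma mem_lat_zero (e : I → M) (i : I) : e i ∈ lat e 0 := by
  simpa using smul_mem_lat e (le_refl 0) i

lemma lat_antitone (e : I → M) {m n : ℕ} (h : n ≤ m) : lat e m ≤ lat e n :=
  Submodule.span_mono fun _ ⟨k, i, hk, hx⟩ => ⟨k, i, h.trans hk, hx⟩

lemma pow_smul_mem_lat {e : I → M} {n : ℕ} (k : ℕ) {x : M} (hx : x ∈ lat e n) :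
    v ^ k • x ∈ lat e (n + k) := by
  induction hx using Submodule.span_induction with
  | mem x hx =>
    obtain ⟨m, i, h, rfl⟩ := hx
    rw [smul_smul, ← pow_add]
    exact smul_mem_lat e (by omega) i
  | zero => simp
  | add x y _ _ hx hy => rw [smul_add]; exact add_mem hx hy
  | smul a x _ hx => rw [smul_comm]; exact Submodule.smul_mem _ _ hx

lemma posPoly_smul_mem_lat (e : I → M) {q : ℤ[T;T⁻¹]} (hq : q ∈ posPoly) (i : I) :
    q • e i ∈ lat e 1 := by
  induction hq using Submodule.span_induction with
  | mem x hx =>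
    obtain ⟨m, rfl⟩ := hx
    exact smul_mem_lat e (by omega) i
  | zero => simp
  | add x y _ _ hx hy => rw [add_smul]; exact add_mem hx hy
  | smul a x _ hx => rw [smul_assoc]; exact Submodule.smul_mem _ _ hx

lemma map_mem_lat {I' M' : Type*} [AddCommGroup M'] [Module ℤ[T;T⁻¹] M'] {e : I → M}
    {e' : I' → M'} (f : M →ₗ[ℤ[T;T⁻¹]] M') {k : ℕ} (hf : ∀ i, f (e i) ∈ lat e' k) {n : ℕ} {x : M}
    (hx : x ∈ lat e n) : f x ∈ lat e' (k + n) := by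
  induction hx using Submodule.span_induction with
  | mem x hx =>
    obtain ⟨m, i, h, rfl⟩ := hx
    rw [map_smul]
    exact lat_antitone e' (by omega) (pow_smul_mem_lat m (hf i))
  | zero => simp
  | add x y _ _ hx hy => rw [map_add]; exact add_mem hx hy
  | smul a x _ hx => rw [map_zsmul]; exact Submodule.smul_mem _ _ hx

lemma lat_le_lat {I' : Type*} {e : I → M} {e' : I' → M} (h : ∀ i, e i ∈ lat e' 0) (n : ℕ) :
    lat e n ≤ lat e' n := fun x hx => by
  have := map_mem_lat LinearMap.id h hx
  rwa [zero_add] at this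

/-- A module with basis `b`, degree function `ℓ` on the basis and a semilinear involution that
is unitriangular for the degree. -/
structure IsBarModule (b : Module.Basis I ℤ[T;T⁻¹] M) (ℓ : I → ℕ) (d : M →+ M) : Prop where
  map_smul : ∀ (a : ℤ[T;T⁻¹]) x, d (a • x) = LaurentPolynomial.invert a • d x
  invol : ∀ x, d (d x) = x
  triangular : ∀ i, d (b i) - b i ∈ Submodule.span ℤ[T;T⁻¹] (b '' {j | ℓ j < ℓ i})

namespace IsBarModule

variable {b : Module.Basis I ℤ[T;T⁻¹] M} {ℓ : I → ℕ} {d : M →+ M} (hd : IsBarModule b ℓ d)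
include hd

lemma repr_apply_basis [DecidableEq I] {i j : I} (h : ℓ j ≤ ℓ i) :
    b.repr (d (b j)) i = if j = i then 1 else 0 := by
  have h1 := b.mem_span_image.1 (hd.triangular j)
  have h2 : b.repr (d (b j) - b j) i = 0 := by
    by_contra hne
    have := h1 (Finsupp.mem_support_iff.2 hne)
    simp only [Set.mem_ofPred_eq] at this
    omega
  rw [map_sub, Finsupp.sub_apply, sub_eq_zero] at h2
  rw [h2, b.repr_self, Finsupp.single_apply]

lemma repr_apply {x : M} {i : I} (hx : ∀ j, ℓ i < ℓ j → b.repr x j = 0) :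
    b.repr (d x) i = LaurentPolynomial.invert (b.repr x i) := by
  classical
  conv_lhs => rw [← b.linearCombination_repr x, Finsupp.linearCombination_apply, Finsupp.sum]
  rw [map_sum, map_sum, Finsupp.finsetSum_apply]
  have h : ∀ j ∈ (b.repr x).support, b.repr (d (b.repr x j • b j)) i =
      if j = i then LaurentPolynomial.invert (b.repr x j) else 0 := by
    intro j hj
    have hji : ℓ j ≤ ℓ i := by
      by_contra hlt
      exact Finsupp.mem_support_iff.1 hj (hx j (by omega))
    rw [hd.map_smul, _root_.map_smul, Finsupp.smul_apply, hd.repr_apply_basis hji, smul_eq_mul]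
    split_ifs <;> simp
  rw [Finset.sum_congr rfl h, Finset.sum_ite_eq']
  split_ifs with hi
  · rfl
  · rw [Finsupp.notMem_support_iff.1 hi, map_zero]

/-- At an index of maximal degree in the support, triangularity lets the involution act on the
coefficient by v ↦ v⁻¹ alone. A symmetric coefficient in vℤ[v] is zero. -/
lemma eq_zero {x : M} (hx : x ∈ lat b 1) (h : d x = x) : x = 0 := by
  have hP (i : I) : b.repr x i ∈ posPoly := by
    clear h
    induction hx using Submodule.span_induction with
    | mem x hx =>
      classical
      obtain ⟨m, j, hm, rfl⟩ := hx
      rw [_root_.map_smul, b.repr_self, Finsupp.smul_apply, Finsupp.single_apply]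
      split_ifs
      · obtain ⟨k, rfl⟩ := Nat.exists_eq_add_of_le' hm
        rw [smul_eq_mul, mul_one]
        exact Submodule.subset_span ⟨k, rfl⟩
      · simp
    | zero => simp
    | add x y _ _ hx hy => rw [map_add, Finsupp.add_apply]; exact add_mem hx hy
    | smul a x _ hx => rw [map_zsmul, Finsupp.smul_apply]; exact Submodule.smul_mem _ _ hx
  by_contra hne
  obtain ⟨i, hi, hmax⟩ := (b.repr x).support.exists_max_image ℓ
    (Finsupp.support_nonempty_iff.2 (by simpa using hne))
  refine Finsupp.mem_support_iff.1 hi (eq_zero_of_mem_posPoly (hP i) ?_)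
  rw [← hd.repr_apply fun j hj => ?_, h]
  by_contra hj'
  exact absurd (hmax j (Finsupp.mem_support_iff.2 hj')) (by omega)

/-- The anti-invariant element is removed degree by degree from the top: its top coefficients are
antisymmetric, hence of the form q minus the conjugate of q with q in vℤ[v], and subtracting the
corresponding z - d z lowers the degree bound. -/
lemma exists_sub_eq (n : ℕ) (y : M) (hy : ∀ i, n ≤ ℓ i → b.repr y i = 0) (hdy : d y = -y) :
    ∃ z ∈ lat b 1, z - d z = y := by
  classical
  induction n generalizing y with
  | zero =>
    refine ⟨0, zero_mem _, ?_⟩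
    have : b.repr y = 0 := Finsupp.ext fun i => hy i (Nat.zero_le _)
    rw [LinearEquiv.map_eq_zero_iff] at this
    simp [this]
  | succ n ih =>
    have h (i : I) (hi : ℓ i = n) : ∃ q ∈ posPoly, b.repr y i = q - LaurentPolynomial.invert q := by
      refine exists_sub_invert ?_
      rw [← hd.repr_apply fun j hj => hy j (by omega), hdy, map_neg, Finsupp.neg_apply]
    choose! q hq hqy using h
    let z₀ : M := ∑ i ∈ (b.repr y).support with ℓ i = n, q i • b i
    have hz₀ : z₀ ∈ lat b 1 := Submodule.sum_mem _ fun i hi =>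
      posPoly_smul_mem_lat _ (hq i (Finset.mem_filter.1 hi).2) i
    have hr (i : I) : b.repr z₀ i =
        if i ∈ (b.repr y).support.filter fun i => ℓ i = n then q i else 0 := by
      simp only [z₀, map_sum, _root_.map_smul, b.repr_self, Finsupp.finsetSum_apply,
        Finsupp.smul_apply, Finsupp.single_apply, smul_eq_mul, mul_ite, mul_one, mul_zero]
      rw [Finset.sum_ite_eq']
    have hr0 (i : I) (hi : n < ℓ i) : b.repr z₀ i = 0 := by
      rw [hr, if_neg]
      simp only [Finset.mem_filter]
      omega
    have hlow : ∀ i, n ≤ ℓ i → b.repr (y - (z₀ - d z₀)) i = 0 := by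
      intro i hi
      have h1 : b.repr (d z₀) i = LaurentPolynomial.invert (b.repr z₀ i) :=
        hd.repr_apply fun j hj => hr0 j (by omega)
      rw [map_sub, map_sub, Finsupp.sub_apply, Finsupp.sub_apply, h1]
      rcases hi.lt_or_eq with hi | hi
      · rw [hy i hi, hr0 i hi]; simp
      · rw [hr]
        split_ifs with hm
        · rw [hqy i hi.symm, sub_self]
        · simp only [Finset.mem_filter, hi, and_true, Finsupp.mem_support_iff, not_not] at hm
          simp [hm]
    obtain ⟨z, hz, hzy⟩ := ih (y - (z₀ - d z₀)) hlow (by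
      rw [map_sub, map_sub, hd.invol, hdy]
      abel)
    refine ⟨z + z₀, add_mem hz hz₀, ?_⟩
    rw [map_add, add_sub_add_comm, hzy]
    exact sub_add_cancel _ _

/-- The element d(b_i) - b_i is anti-invariant. Once it is written as z - d z, the sum b_i + z is
invariant. -/
lemma exists_kl (i : I) : ∃ x, d x = x ∧ x - b i ∈ lat b 1 := by
  have h1 := b.mem_span_image.1 (hd.triangular i)
  obtain ⟨z, hz, h⟩ := hd.exists_sub_eq (ℓ i) (d (b i) - b i) (fun j hj => by
    by_contra hne
    have := h1 (Finsupp.mem_support_iff.2 hne)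
    simp only [Set.mem_ofPred_eq] at this
    omega) (by rw [map_sub, hd.invol]; abel)
  refine ⟨b i + z, ?_, by simpa using hz⟩
  rw [map_add, ← sub_eq_zero]
  rw [← sub_eq_zero] at h
  rw [← neg_eq_zero, ← h]
  abel

lemma eq_of_sub_mem {x y : M} (hx : d x = x) (hy : d y = y) (h : x - y ∈ lat b 1) : x = y :=
  sub_eq_zero.1 (hd.eq_zero h (by rw [map_sub, hx, hy]))

end IsBarModule

end BarModule

/-! ### The bar involution of the Hecke algebra -/

section HeckeBar

variable {G : Type*} [Group G] {S : Set G} (hS : IsCoxeterLike S)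

/-- The Hecke algebra, with `v` acting as multiplication by `v⁻¹`. -/
def HeckeTwist (S : Set G) : Type _ := Hecke S

instance : Ring (HeckeTwist S) := inferInstanceAs (Ring (Hecke S))

/-- A ring endomorphism of the Hecke algebra with v ↦ v⁻¹ is an algebra homomorphism into this
twist, so the involution can be obtained from the universal property of the presentation. -/
instance : Algebra ℤ[T;T⁻¹] (HeckeTwist S) :=
  ((algebraMap ℤ[T;T⁻¹] (Hecke S)).comp
    (LaurentPolynomial.invert (R := ℤ) : ℤ[T;T⁻¹] →+* ℤ[T;T⁻¹])).toAlgebra'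
    fun c x => Algebra.commutes (A := Hecke S) (LaurentPolynomial.invert c) x

/-- The inverse of `H_s`. -/
def simpleInv (S : Set G) (s : G) : Hecke S := H S s + (v - vinv) • 1

lemma H_mul_simpleInv {s : G} (hs : s ∈ S) : H S s * simpleInv S s = 1 := by
  rw [simpleInv, mul_add, H_sq hs, mul_smul_comm, mul_one, add_assoc, ← add_smul]
  simp

lemma simpleInv_mul_H {s : G} (hs : s ∈ S) : simpleInv S s * H S s = 1 := by
  rw [simpleInv, add_mul, H_sq hs, smul_mul_assoc, one_mul, add_assoc, ← add_smul]
  simp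

include hS

lemma isUnit_H (w : G) : IsUnit (H S w) := by
  induction w using hS.induction_left with
  | h1 => rw [H_one]; exact isUnit_one
  | hmul s hs w hl ih =>
    rw [← H_simple_mul_of_lt hS hs (by omega)]
    exact IsUnit.mul ⟨⟨_, _, H_mul_simpleInv hs, simpleInv_mul_H hs⟩, rfl⟩ ih

/-- The element `(H_{w⁻¹})⁻¹`. -/
def barH (w : G) : Hecke S := ↑(isUnit_H hS w⁻¹).unit⁻¹

lemma barH_mul (w : G) : barH hS w * H S w⁻¹ = 1 := (isUnit_H hS w⁻¹).val_inv_mul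

lemma mul_barH (w : G) : H S w⁻¹ * barH hS w = 1 := (isUnit_H hS w⁻¹).mul_val_inv

lemma barH_eq {w : G} {x : Hecke S} (h : x * H S w⁻¹ = 1) : barH hS w = x := by
  rw [← one_mul (barH hS w), ← h, mul_assoc, mul_barH, mul_one]

lemma barH_simple {s : G} (hs : s ∈ S) : barH hS s = simpleInv S s :=
  barH_eq hS (by rw [hS.inv_eq hs, simpleInv_mul_H hs])

/-- The element `(H_{w⁻¹})⁻¹` of the twisted Hecke algebra. -/
def barHTwist (w : G) : HeckeTwist S := barH hS w

/-- The Kazhdan–Lusztig involution. -/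
def bar : Hecke S →+* Hecke S :=
  (RingQuot.liftAlgHom (B := HeckeTwist S) ℤ[T;T⁻¹] ⟨FreeAlgebra.lift _ (barHTwist hS), by
    intro x y hxy
    induction hxy with
    | one =>
      rw [FreeAlgebra.lift_ι_apply, map_one]
      exact barH_eq hS (x := (1 : Hecke S)) (by rw [inv_one, H_one, mul_one])
    | quad s hs =>
      simp only [map_mul, map_add, map_sub, FreeAlgebra.lift_ι_apply, AlgHom.commutes, map_zero]
      change (barH hS s + algebraMap _ (Hecke S) (LaurentPolynomial.invert v)) *
        (barH hS s - algebraMap _ (Hecke S) (LaurentPolynomial.invert vinv)) = 0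
      rw [barH_simple hS hs, invert_v, invert_vinv, simpleInv, ← Algebra.algebraMap_eq_smul_one,
        map_sub]
      have h := H_quad hs
      have hc (a : ℤ[T;T⁻¹]) := Algebra.commutes a (H S s)
      rw [add_mul, mul_sub, mul_sub, hc v] at h
      rw [show H S s + (algebraMap ℤ[T;T⁻¹] (Hecke S) v - algebraMap ℤ[T;T⁻¹] (Hecke S) vinv) +
          algebraMap ℤ[T;T⁻¹] (Hecke S) vinv = H S s + algebraMap ℤ[T;T⁻¹] (Hecke S) v by abel,
        show H S s + (algebraMap ℤ[T;T⁻¹] (Hecke S) v - algebraMap ℤ[T;T⁻¹] (Hecke S) vinv) -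
          algebraMap ℤ[T;T⁻¹] (Hecke S) v = H S s - algebraMap ℤ[T;T⁻¹] (Hecke S) vinv by abel]
      exact H_quad hs
    | mul x y h =>
      rw [map_mul]
      simp only [FreeAlgebra.lift_ι_apply]
      change barH hS x * barH hS y = barH hS (x * y)
      symm
      refine barH_eq hS ?_
      rw [mul_inv_rev, ← H_mul (by
        rw [← mul_inv_rev, hS.length_inv, hS.length_inv, hS.length_inv, h, add_comm]),
        mul_assoc, ← mul_assoc (barH hS y), barH_mul, one_mul, barH_mul]⟩).toRingHom

lemma bar_H (w : G) : bar hS (H S w) = barH hS w :=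
  (RingQuot.liftAlgHom_mkAlgHom_apply (B := HeckeTwist S) _ _ _ _).trans
    (FreeAlgebra.lift_ι_apply _ _)

lemma bar_algebraMap (a : ℤ[T;T⁻¹]) : bar hS (algebraMap _ (Hecke S) a) =
    algebraMap _ (Hecke S) (LaurentPolynomial.invert a) :=
  (RingQuot.liftAlgHom (B := HeckeTwist S) ℤ[T;T⁻¹] _).commutes a

lemma bar_smul (a : ℤ[T;T⁻¹]) (x : Hecke S) :
    bar hS (a • x) = LaurentPolynomial.invert a • bar hS x := by
  rw [Algebra.smul_def, map_mul, bar_algebraMap, ← Algebra.smul_def]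

lemma isBar_bar : IsBar S (bar hS) :=
  ⟨bar_algebraMap hS, fun w => by rw [bar_H]; exact ⟨barH_mul hS w, mul_barH hS w⟩⟩

lemma IsBar.eq_bar {d : Hecke S →+* Hecke S} (hd : IsBar S d) (x : Hecke S) : d x = bar hS x := by
  induction x using Hecke.induction hS with
  | hH w => rw [bar_H, barH_eq hS (hd.2 w).1]
  | hadd x y hx hy => rw [map_add, map_add, hx, hy]
  | hsmul a x hx => rw [bar_smul, Algebra.smul_def, map_mul, hd.1, hx, ← Algebra.smul_def]

lemma bar_bar (x : Hecke S) : bar hS (bar hS x) = x := by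
  induction x using Hecke.induction hS with
  | hH w =>
    have h1 := congrArg (bar hS) (mul_barH hS w)
    rw [map_mul, bar_H, map_one] at h1
    have h2 : H S w * barH hS w⁻¹ = 1 := by simpa using mul_barH hS w⁻¹
    rw [bar_H, ← one_mul (bar hS (barH hS w)), ← h2, mul_assoc, h1, mul_one]
  | hadd x y hx hy => rw [map_add, map_add, hx, hy]
  | hsmul a x hx => rw [bar_smul, bar_smul, invert_invert, hx]

lemma H_simple_mul_mem_span {s : G} (hs : s ∈ S) {n : ℕ} {x : Hecke S}
    (hx : x ∈ Submodule.span ℤ[T;T⁻¹] (H S '' {y | length S y < n})) :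
    H S s * x ∈ Submodule.span ℤ[T;T⁻¹] (H S '' {y | length S y < n + 1}) := by
  induction hx using Submodule.span_induction with
  | mem x hx =>
    obtain ⟨w, hw, rfl⟩ := hx
    have hw' : length S w < n := hw
    rcases hS.length_mul s hs w with h | h
    · rw [H_simple_mul_of_lt hS hs (by omega)]
      exact Submodule.subset_span ⟨_, by simp only [Set.mem_ofPred_eq]; omega, rfl⟩
    · rw [H_simple_mul_of_gt hS hs (by omega)]
      exact add_mem (Submodule.subset_span ⟨_, by simp only [Set.mem_ofPred_eq]; omega, rfl⟩)
        (Submodule.smul_mem _ _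
          (Submodule.subset_span ⟨_, by simp only [Set.mem_ofPred_eq]; omega, rfl⟩))
  | zero => simp
  | add x y _ _ hx hy => rw [mul_add]; exact add_mem hx hy
  | smul a x _ hx => rw [mul_smul_comm]; exact Submodule.smul_mem _ _ hx

lemma bar_H_sub_mem (w : G) : bar hS (H S w) - H S w ∈
    Submodule.span ℤ[T;T⁻¹] (H S '' {y | length S y < length S w}) := by
  induction w using hS.induction_left with
  | h1 => rw [H_one, map_one, sub_self]; exact zero_mem _
  | hmul s hs w hl ih =>
    have h1 := H_simple_mul_mem_span hS hs ih
    have h2 : bar hS (H S w) ∈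
        Submodule.span ℤ[T;T⁻¹] (H S '' {y | length S y < length S (s * w)}) := by
      have := add_mem (Submodule.span_mono (Set.image_mono fun y (hy : length S y < length S w) =>
        show length S y < length S (s * w) by omega) ih)
        (Submodule.subset_span ⟨w, show length S w < length S (s * w) by omega, rfl⟩)
      rwa [sub_add_cancel] at this
    rw [← hl, mul_sub, H_simple_mul_of_lt hS hs (by omega)] at h1
    rw [← H_simple_mul_of_lt hS hs (w := w) (by omega), map_mul, bar_H, barH_simple hS hs,
      simpleInv, add_mul, smul_mul_assoc, one_mul, H_simple_mul_of_lt hS hs (by omega),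
      add_sub_right_comm]
    exact add_mem h1 (Submodule.smul_mem _ _ h2)

lemma isBarModule_hecke :
    IsBarModule (heckeBasis hS) (length S) (bar hS : Hecke S →+ Hecke S) where
  map_smul := bar_smul hS
  invol := bar_bar hS
  triangular w := by
    have : ⇑(heckeBasis hS) = H S := funext (heckeBasis_apply hS)
    rw [this]
    exact bar_H_sub_mem hS w

lemma isKLElement_iff {w : G} {h : Hecke S} :
    IsKLElement S w h ↔ bar hS h = h ∧ h - H S w ∈ lat (H S) 1 := by
  refine and_congr ⟨fun ⟨d, hd, h⟩ => by rw [← hd.eq_bar hS, h], fun h => ⟨_, isBar_bar hS, h⟩⟩ ?_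
  rw [lat]
  suffices {x : Hecke S | ∃ (n : ℕ) (y : G), x = (v ^ (n + 1)) • H S y} =
    {x | ∃ m i, 1 ≤ m ∧ x = v ^ m • H S i} by rw [this]
  ext x
  constructor
  · rintro ⟨n, y, h⟩
    exact ⟨n + 1, y, by omega, h⟩
  · rintro ⟨m, y, hm, h⟩
    obtain ⟨k, rfl⟩ := Nat.exists_eq_add_of_le' hm
    exact ⟨k, y, h⟩

lemma existsUnique_isKLElement (w : G) : ∃! h : Hecke S, IsKLElement S w h := by
  have hM := isBarModule_hecke hS
  have hb : ⇑(heckeBasis hS) = H S := funext (heckeBasis_apply hS)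
  simp only [isKLElement_iff hS]
  obtain ⟨x, hx, hx'⟩ := hM.exists_kl w
  rw [hb] at hx'
  refine ⟨x, ⟨hx, hx'⟩, fun y hy => hM.eq_of_sub_mem hy.1 hx ?_⟩
  rw [hb, ← sub_sub_sub_cancel_right y x (H S w)]
  exact sub_mem hy.2 hx'

lemma isKLElement_KL (w : G) : IsKLElement S w (KL S w) :=
  Classical.epsilon_spec (existsUnique_isKLElement hS w).exists

lemma bar_KL (w : G) : bar hS (KL S w) = KL S w :=
  ((isKLElement_iff hS).1 (isKLElement_KL hS w)).1

lemma KL_sub_mem (w : G) : KL S w - H S w ∈ lat (H S) 1 :=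
  ((isKLElement_iff hS).1 (isKLElement_KL hS w)).2

lemma KL_eq {w : G} {x : Hecke S} (h1 : bar hS x = x) (h2 : x - H S w ∈ lat (H S) 1) :
    KL S w = x :=
  (existsUnique_isKLElement hS w).unique (isKLElement_KL hS w) ((isKLElement_iff hS).2 ⟨h1, h2⟩)

end HeckeBar

/-! ### Modules induced from characters of parabolic subalgebras -/

section InducedTheory

variable {G : Type*} [Group G] {S J : Set G} {c : ℤ[T;T⁻¹]}

lemma oneTmul_add (x y : Hecke S) :
    oneTmul S J c (x + y) = oneTmul S J c x + oneTmul S J c y := rfl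

lemma oneTmul_smul (a : ℤ[T;T⁻¹]) (x : Hecke S) :
    oneTmul S J c (a • x) = a • oneTmul S J c x := rfl

lemma oneTmul_mul (x h : Hecke S) : oneTmul S J c (x * h) = oneTmul S J c x <• h := rfl

/-- The map `h ↦ 1 ⊗ h`, as a `ℤ[v, v⁻¹]`-linear map. -/
def oneTmulₗ (S J : Set G) (c : ℤ[T;T⁻¹]) : Hecke S →ₗ[ℤ[T;T⁻¹]] Induced S J c where
  toFun := oneTmul S J c
  map_add' := oneTmul_add
  map_smul' := oneTmul_smul

lemma oneTmulₗ_apply (h : Hecke S) : oneTmulₗ S J c h = oneTmul S J c h := rfl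

lemma oneTmul_surjective : Function.Surjective (oneTmul S J c) :=
  Submodule.Quotient.mk_surjective _

lemma oneTmul_H_mul {s : G} (hs : s ∈ J) (h : Hecke S) :
    oneTmul S J c (H S s * h) = c • oneTmul S J c h := by
  rw [← oneTmul_smul, ← sub_eq_zero]
  refine (Submodule.Quotient.mk_eq_zero (inducedRel S J c) (x := H S s * h - c • h)).2 ?_
  rw [Algebra.smul_def, ← sub_mul]
  exact Submodule.smul_mem _ (MulOpposite.op h) (Submodule.subset_span ⟨s, hs, rfl⟩)

/-- The value at `H_s` of a character of the Hecke algebra of rank one that is compatible with the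
Kazhdan–Lusztig involution. -/
structure IsCharValue (c : ℤ[T;T⁻¹]) : Prop where
  -- Together the two conditions say that conjugation inverts c and that c is a root of the
  -- quadratic relation.
  sub_invert : c - LaurentPolynomial.invert c = vinv - v
  mul_invert : c * LaurentPolynomial.invert c = 1

lemma isCharValue_vinv : IsCharValue vinv :=
  ⟨by rw [invert_vinv], by rw [invert_vinv, vinv_mul_v]⟩

lemma isCharValue_neg_v : IsCharValue (-v) :=
  ⟨by rw [map_neg, invert_v]; ring, by rw [map_neg, invert_v, neg_mul_neg, v_mul_vinv]⟩

/-- The cosets of the parabolic subgroup generated by `J`. -/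
abbrev ParabolicCoset (J : Set G) : Type _ := Quotient (QuotientGroup.rightRel (Subgroup.closure J))

lemma parabolicCoset_eq {x y : G} :
    (Quotient.mk _ x : ParabolicCoset J) = Quotient.mk _ y ↔ y * x⁻¹ ∈ Subgroup.closure J :=
  Quotient.eq.trans QuotientGroup.rightRel_apply

lemma parabolicCoset_mul {t : G} (ht : t ∈ Subgroup.closure J) (y : G) :
    (Quotient.mk _ (t * y) : ParabolicCoset J) = Quotient.mk _ y := by
  rw [eq_comm, parabolicCoset_eq, mul_inv_cancel_right]
  exact ht

lemma exists_minimal_rep (S : Set G) (q : ParabolicCoset J) :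
    ∃ w, Quotient.mk _ w = q ∧ ∀ w', Quotient.mk _ w' = q → length S w ≤ length S w' := by
  obtain ⟨w, hw, h⟩ := WellFounded.has_min (measure (length S)).wf
    {w | Quotient.mk _ w = q} (Quotient.exists_rep q)
  exact ⟨w, hw, fun w' hw' => not_lt.1 (h w' hw')⟩

/-- An element of minimal length in a coset of the parabolic subgroup generated by `J`. -/
def minRep (S : Set G) (q : ParabolicCoset J) : G := (exists_minimal_rep S q).choose

lemma mk_minRep (q : ParabolicCoset J) : Quotient.mk _ (minRep S q) = q :=
  (exists_minimal_rep S q).choose_spec.1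

lemma length_minRep_le (w : G) :
    length S (minRep S (Quotient.mk _ w : ParabolicCoset J)) ≤ length S w :=
  (exists_minimal_rep S _).choose_spec.2 w rfl

variable (hS : IsCoxeterLike S) (hJ : J ⊆ S) (hc : IsCharValue c)
include hS

/-- The linear form with values in the free module on the cosets that detects the elements
`1 ⊗ H_w`. -/
def cosetMap (J : Set G) (c : ℤ[T;T⁻¹]) : Hecke S →ₗ[ℤ[T;T⁻¹]] (ParabolicCoset J →₀ ℤ[T;T⁻¹]) :=
  (heckeBasis hS).constr ℤ[T;T⁻¹] fun w => Finsupp.single (Quotient.mk _ w) (c ^ length S w)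

lemma cosetMap_H (w : G) :
    cosetMap hS J c (H S w) = Finsupp.single (Quotient.mk _ w) (c ^ length S w) := by
  rw [← heckeBasis_apply hS, cosetMap, Module.Basis.constr_basis]

include hJ hc

/-- When s shortens w, the two terms of H_s H_w combine because the conjugate of c plus v⁻¹ - v
equals c. -/
lemma cosetMap_H_mul {s : G} (hs : s ∈ J) (h : Hecke S) :
    cosetMap hS J c (H S s * h) = c • cosetMap hS J c h := by
  induction h using Hecke.induction hS with
  | hH w =>
    have hq : (Quotient.mk _ (s * w) : ParabolicCoset J) = Quotient.mk _ w :=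
      parabolicCoset_mul (Subgroup.subset_closure hs) w
    rcases hS.length_mul s (hJ hs) w with h | h
    · rw [H_simple_mul_of_lt hS (hJ hs) (by omega), cosetMap_H, cosetMap_H, hq, h, pow_succ',
        Finsupp.smul_single, smul_eq_mul]
    · rw [H_simple_mul_of_gt hS (hJ hs) (by omega), map_add, map_smul, cosetMap_H, cosetMap_H, hq,
        Finsupp.smul_single, Finsupp.smul_single, ← Finsupp.single_add]
      congr 1
      rw [h, smul_eq_mul, smul_eq_mul, ← hc.sub_invert]
      linear_combination (-c ^ length S (s * w)) * hc.mul_invert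
  | hadd x y hx hy => rw [mul_add, map_add, map_add, hx, hy, smul_add]
  | hsmul a x hx => rw [mul_smul_comm, map_smul, map_smul, hx, smul_comm]

lemma cosetMap_eq_zero {x : Hecke S} (hx : x ∈ inducedRel S J c) : cosetMap hS J c x = 0 := by
  suffices ∀ h : Hecke S, cosetMap hS J c (x * h) = 0 by simpa using this 1
  induction hx using Submodule.span_induction with
  | mem x hx =>
    obtain ⟨s, hs, rfl⟩ := hx
    intro h
    rw [sub_mul, ← Algebra.smul_def, map_sub, map_smul, cosetMap_H_mul hS hJ hc hs, sub_self]
  | zero => simp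
  | add x y _ _ hx hy => intro h; rw [add_mul, map_add, hx, hy, add_zero]
  | smul a x _ hx =>
    intro h
    have := hx (a.unop * h)
    rwa [← mul_assoc] at this

/-- The linear map on the induced module defined by `cosetMap`. -/
def cosetMapInduced : Induced S J c →ₗ[ℤ[T;T⁻¹]] (ParabolicCoset J →₀ ℤ[T;T⁻¹]) where
  toFun := Quotient.lift (cosetMap hS J c) fun x y hxy => by
    rw [← sub_eq_zero, ← map_sub]
    exact cosetMap_eq_zero hS hJ hc ((Submodule.quotientRel_def _).1 hxy)
  map_add' x y := by
    obtain ⟨x, rfl⟩ := oneTmul_surjective x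
    obtain ⟨y, rfl⟩ := oneTmul_surjective y
    exact map_add (cosetMap hS J c) x y
  map_smul' a x := by
    obtain ⟨x, rfl⟩ := oneTmul_surjective x
    exact map_smul (cosetMap hS J c) a x

lemma cosetMapInduced_oneTmul (h : Hecke S) :
    cosetMapInduced hS hJ hc (oneTmul S J c h) = cosetMap hS J c h := rfl

-- The multiple of 1 ⊗ H_w normalized by the inverse of c^ℓ(w) is constant on cosets. Hence the
-- basis of the induced module is obtained without knowing that lengths add over minimal
-- representatives.
omit hJ in
lemma oneTmul_H_eq_of_mem {s : G} (hs : s ∈ J) (hsS : s ∈ S) (w : G) :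
    LaurentPolynomial.invert c ^ length S (s * w) • oneTmul S J c (H S (s * w)) =
      LaurentPolynomial.invert c ^ length S w • oneTmul S J c (H S w) := by
  have key {w : G} (h : length S (s * w) = length S w + 1) :
      LaurentPolynomial.invert c ^ length S (s * w) • oneTmul S J c (H S (s * w)) =
      LaurentPolynomial.invert c ^ length S w • oneTmul S J c (H S w) := by
    rw [← H_simple_mul_of_lt hS hsS (by omega), oneTmul_H_mul hs, h, smul_smul]
    congr 1
    linear_combination (LaurentPolynomial.invert c ^ length S w) * hc.mul_invert
  rcases hS.length_mul s hsS w with h | h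
  · exact key h
  · have := key (w := s * w) (by rw [hS.mul_cancel hsS]; exact h)
    rw [hS.mul_cancel hsS] at this
    exact this.symm

lemma oneTmul_H_eq_of_closure {t : G} (ht : t ∈ Subgroup.closure J) (w : G) :
    LaurentPolynomial.invert c ^ length S (t * w) • oneTmul S J c (H S (t * w)) =
      LaurentPolynomial.invert c ^ length S w • oneTmul S J c (H S w) := by
  induction ht using Subgroup.closure_induction generalizing w with
  | mem s hs => exact oneTmul_H_eq_of_mem hS hc hs (hJ hs) w
  | one => rw [one_mul]
  | mul x y _ _ hx hy => rw [mul_assoc, hx, hy]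
  | inv x _ hx => rw [← hx (x⁻¹ * w), mul_inv_cancel_left]

lemma oneTmul_H_eq (w : G) : oneTmul S J c (H S w) =
    c ^ (length S w - length S (minRep S (Quotient.mk _ w : ParabolicCoset J))) •
      oneTmul S J c (H S (minRep S (Quotient.mk _ w : ParabolicCoset J))) := by
  set m := minRep S (Quotient.mk _ w : ParabolicCoset J) with hm
  have h1 : w * m⁻¹ ∈ Subgroup.closure J := parabolicCoset_eq.1 (mk_minRep _)
  have h2 := oneTmul_H_eq_of_closure hS hJ hc h1 m
  rw [inv_mul_cancel_right] at h2
  have h3 := congrArg (fun x => c ^ length S w • x) h2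
  simp only [smul_smul, ← mul_pow, hc.mul_invert, one_pow, one_smul] at h3
  rw [h3]
  have h4 : length S m ≤ length S w := length_minRep_le w
  obtain ⟨k, hk⟩ := Nat.exists_eq_add_of_le' h4
  rw [hk, Nat.add_sub_cancel, pow_add, mul_assoc, ← mul_pow, hc.mul_invert, one_pow, mul_one]

/-- The basis of the induced module formed by the elements `1 ⊗ H_w` with `w` of minimal length in
its coset. -/
def inducedBasis : Module.Basis (ParabolicCoset J) ℤ[T;T⁻¹] (Induced S J c) :=
  Module.Basis.mk (v := fun q => oneTmul S J c (H S (minRep S q)))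
    (by
      -- The images are unit multiples of distinct basis vectors.
      refine LinearIndependent.of_comp (cosetMapInduced hS hJ hc) ?_
      let u : ℤ[T;T⁻¹]ˣ := ⟨c, LaurentPolynomial.invert c, hc.mul_invert,
        by rw [mul_comm, hc.mul_invert]⟩
      have h := (Finsupp.linearIndependent_single_one ℤ[T;T⁻¹] (ParabolicCoset J)).units_smul
        fun q => u ^ length S (minRep S q)
      convert h using 1
      funext q
      rw [Function.comp_apply, cosetMapInduced_oneTmul, cosetMap_H, mk_minRep, Pi.smul_apply',
        Units.smul_def, Finsupp.smul_single, smul_eq_mul, mul_one]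
      rfl)
    (by
      rintro x -
      obtain ⟨h, rfl⟩ := oneTmul_surjective x
      induction h using Hecke.induction hS with
      | hH w =>
        rw [oneTmul_H_eq hS hJ hc]
        exact Submodule.smul_mem _ _ (Submodule.subset_span ⟨_, rfl⟩)
      | hadd x y hx hy => rw [oneTmul_add]; exact add_mem hx hy
      | hsmul a x hx => rw [oneTmul_smul]; exact Submodule.smul_mem _ _ hx)

lemma coe_inducedBasis :
    ⇑(inducedBasis hS hJ hc) = fun q => oneTmul S J c (H S (minRep S q)) :=
  Module.Basis.coe_mk _ _

/-- The Kazhdan–Lusztig involution, as a semilinear map for the right action. -/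
def barₛₗ : Hecke S →ₛₗ[RingHom.op (bar hS)] Hecke S where
  toFun := bar hS
  map_add' := map_add _
  map_smul' a x := map_mul (bar hS) x a.unop

/-- The involution of the induced module `1 ⊗ h ↦ 1 ⊗ \overline{h}`. -/
def barInduced : Induced S J c →+ Induced S J c :=
  (Submodule.mapQ (inducedRel S J c) (inducedRel S J c) (barₛₗ hS) (by
    refine Submodule.span_le.2 ?_
    rintro _ ⟨s, hs, rfl⟩
    change bar hS (H S s - algebraMap _ (Hecke S) c) ∈ inducedRel S J c
    refine Submodule.subset_span ⟨s, hs, ?_⟩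
    rw [map_sub, bar_H, barH_simple hS (hJ hs), bar_algebraMap, simpleInv,
      ← Algebra.algebraMap_eq_smul_one, ← neg_sub vinv v, ← hc.sub_invert, neg_sub, map_sub]
    abel)).toAddMonoidHom

lemma barInduced_oneTmul (h : Hecke S) :
    barInduced hS hJ hc (oneTmul S J c h) = oneTmul S J c (bar hS h) := rfl

lemma isBarModule_induced : IsBarModule (inducedBasis hS hJ hc) (fun q => length S (minRep S q))
    (barInduced hS hJ hc) where
  map_smul a x := by
    obtain ⟨h, rfl⟩ := oneTmul_surjective x
    rw [← oneTmul_smul, barInduced_oneTmul, bar_smul, oneTmul_smul, barInduced_oneTmul]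
  invol x := by
    obtain ⟨h, rfl⟩ := oneTmul_surjective x
    rw [barInduced_oneTmul, barInduced_oneTmul, bar_bar]
  triangular q := by
    have h := Submodule.mem_map_of_mem (f := oneTmulₗ S J c) (bar_H_sub_mem hS (minRep S q))
    rw [Submodule.map_span] at h
    simp only [coe_inducedBasis]
    rw [barInduced_oneTmul]
    refine (Submodule.span_le.2 ?_) h
    rintro _ ⟨_, ⟨y, hy, rfl⟩, rfl⟩
    rw [oneTmulₗ_apply, oneTmul_H_eq hS hJ hc]
    exact Submodule.smul_mem _ _
      (Submodule.subset_span ⟨_, (length_minRep_le y).trans_lt hy, rfl⟩)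

end InducedTheory

/-! ### The lattice and self-dual elements of the antispherical module -/

section Antispherical

variable {G : Type*} [Group G] {S J : Set G} (hS : IsCoxeterLike S) (hJ : J ⊆ S)
include hS hJ

/-- For the value -v, passing to the minimal representative costs a sign and a nonnegative power of
v. For v⁻¹ the power would be negative; this is why the lattice of the spherical module below is
spanned by minimal representatives only. -/
lemma oneTmul_H_mem_lat (w : G) : oneTmul S J (-v) (H S w) ∈
    lat (inducedBasis hS hJ isCharValue_neg_v) 0 := by
  rw [oneTmul_H_eq hS hJ isCharValue_neg_v, neg_pow, mul_smul]
  have h := smul_mem_lat (inducedBasis hS hJ isCharValue_neg_v) (Nat.zero_le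
    (length S w - length S (minRep S (Quotient.mk _ w : ParabolicCoset J)))) (Quotient.mk _ w)
  rw [coe_inducedBasis] at h ⊢
  rcases neg_one_pow_eq_or ℤ[T;T⁻¹]
    (length S w - length S (minRep S (Quotient.mk _ w : ParabolicCoset J))) with h1 | h1 <;> rw [h1]
  · rwa [one_smul]
  · rw [neg_one_smul]
    exact neg_mem h

/-- Uniqueness of self-dual elements of the antispherical module with given leading term. -/
lemma oneTmul_eq_of_sub_mem {x y : Hecke S}
    (hx : oneTmul S J (-v) (bar hS x) = oneTmul S J (-v) x)
    (hy : oneTmul S J (-v) (bar hS y) = oneTmul S J (-v) y)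
    (h : oneTmul S J (-v) x - oneTmul S J (-v) y ∈ lat (fun w => oneTmul S J (-v) (H S w)) 1) :
    oneTmul S J (-v) x = oneTmul S J (-v) y := by
  refine (isBarModule_induced hS hJ isCharValue_neg_v).eq_of_sub_mem ?_ ?_ ?_
  · rw [barInduced_oneTmul, hx]
  · rw [barInduced_oneTmul, hy]
  · exact lat_le_lat (oneTmul_H_mem_lat hS hJ) 1 h

end Antispherical

/-! ### Finite parabolic subgroups -/

section Parabolic

variable {G : Type*} [Group G] {S : Set G} {K : Subgroup G} {w₀ : G}

/-- `w` is the element of minimal length of its coset for the parabolic subgroup `K`, in the strong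
sense that lengths add. -/
def IsMinCoset (S : Set G) (K : Subgroup G) (w : G) : Prop :=
  ∀ t ∈ K, length S (t * w) = length S t + length S w

/-- `K` is a finite parabolic subgroup of the Coxeter system `(G, S)` with longest element `w₀`. -/
structure IsFiniteParabolic (S : Set G) (K : Subgroup G) (w₀ : G) : Prop where
  finite : (K : Set G).Finite
  longest_mem : w₀ ∈ K
  length_lt : ∀ t ∈ K, t ≠ w₀ → length S t < length S w₀
  exists_descent : ∀ t ∈ K, t ≠ 1 → ∃ s ∈ S ∩ K, length S t = length S (s * t) + 1
  exists_isMinCoset : ∀ y, ∃ t ∈ K, IsMinCoset S K (t * y)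

/-- The element `∑ v^{ℓ(w₀) - ℓ(t)} H_t`, where `t` runs through `K`. -/
def parabolicSum (S : Set G) (K : Subgroup G) (w₀ : G) : Hecke S :=
  ∑ᶠ t ∈ (K : Set G), v ^ (length S w₀ - length S t) • H S t

/-- The Poincaré polynomial of `K`, normalized. -/
def poincare (S : Set G) (K : Subgroup G) (w₀ : G) : ℤ[T;T⁻¹] :=
  ∑ᶠ t ∈ (K : Set G), v ^ (length S w₀ - length S t) * vinv ^ length S t

variable (hS : IsCoxeterLike S) (hK : IsFiniteParabolic S K w₀)

namespace IsFiniteParabolic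

include hK

lemma length_le {t : G} (ht : t ∈ K) : length S t ≤ length S w₀ := by
  by_cases h : t = w₀
  · rw [h]
  · exact (hK.length_lt t ht h).le

lemma parabolicSum_eq : parabolicSum S K w₀ =
    ∑ t ∈ hK.finite.toFinset, v ^ (length S w₀ - length S t) • H S t := by
  rw [parabolicSum, ← finsum_mem_coe_finset, Set.Finite.coe_toFinset]

lemma poincare_eq : poincare S K w₀ =
    ∑ t ∈ hK.finite.toFinset, v ^ (length S w₀ - length S t) * vinv ^ length S t := by
  rw [poincare, ← finsum_mem_coe_finset, Set.Finite.coe_toFinset]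

lemma mem_toFinset {t : G} : t ∈ hK.finite.toFinset ↔ t ∈ K := by simp

/-- At v = 1 the value is the order of `K`. -/
lemma poincare_ne_zero : poincare S K w₀ ≠ 0 := by
  intro h
  have h1 := congrArg (LaurentPolynomial.eval₂ (RingHom.id ℤ) 1) h
  rw [map_zero, hK.poincare_eq, map_sum] at h1
  simp only [map_mul, map_pow, v, vinv, LaurentPolynomial.eval₂_T, one_zpow, Units.val_one,
    one_pow, mul_one, Finset.sum_const, nsmul_eq_mul] at h1
  have h2 : hK.finite.toFinset.card = 0 := by exact_mod_cast h1
  rw [Finset.card_eq_zero] at h2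
  exact Finset.notMem_empty 1 (h2 ▸ hK.mem_toFinset.2 K.one_mem)

include hS

lemma induction_left {p : G → Prop} (h1 : p 1)
    (hmul : ∀ s ∈ S ∩ K, ∀ t ∈ K, length S (s * t) = length S t + 1 → p t → p (s * t))
    {t : G} (ht : t ∈ K) : p t := by
  induction hn : length S t using Nat.strong_induction_on generalizing t with
  | _ n ih =>
    by_cases h : t = 1
    · exact h ▸ h1
    obtain ⟨s, hs, hl⟩ := hK.exists_descent t ht h
    have hst := K.mul_mem hs.2 ht
    have := hmul s hs (s * t) hst (by rw [hS.mul_cancel hs.1]; exact hl) (ih _ (by omega) hst rfl)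
    rwa [hS.mul_cancel hs.1] at this

lemma closure_eq : Subgroup.closure (S ∩ K) = K := by
  refine le_antisymm ((Subgroup.closure_le K).2 Set.inter_subset_right) fun t ht => ?_
  exact hK.induction_left hS (p := fun t => t ∈ Subgroup.closure (S ∩ (K : Set G))) (one_mem _)
    (fun s hs t _ _ h => mul_mem (Subgroup.subset_closure hs) h) ht

-- Here σ stands for left or right multiplication by a simple reflection of `K`. It groups the sum
-- into pairs v^(k+1) H_t + v^k H_{σ t} with ℓ(σ t) = ℓ(t) + 1, and each pair is an eigenvector with
-- eigenvalue v⁻¹.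
omit hS in
lemma map_parabolicSum (f : Hecke S →ₗ[ℤ[T;T⁻¹]] Hecke S) (σ : G → G) (hσ : ∀ t, σ (σ t) = t)
    (hσK : ∀ t ∈ K, σ t ∈ K)
    (hl : ∀ t, length S (σ t) = length S t + 1 ∨ length S t = length S (σ t) + 1)
    (hlt : ∀ t, length S t < length S (σ t) → f (H S t) = H S (σ t))
    (hgt : ∀ t, length S (σ t) < length S t → f (H S t) = H S (σ t) + (vinv - v) • H S t) :
    f (parabolicSum S K w₀) = vinv • parabolicSum S K w₀ := by
  classical
  set F := hK.finite.toFinset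
  have hF {t} : t ∈ F ↔ t ∈ K := hK.mem_toFinset
  let g : G → Hecke S := fun t => v ^ (length S w₀ - length S t) • H S t
  have hpair : ∀ t ∈ F, length S (σ t) = length S t + 1 →
      f (g t + g (σ t)) = vinv • (g t + g (σ t)) := by
    intro t ht hl
    have hle := hK.length_le (hσK t (hF.1 ht))
    obtain ⟨k, hk⟩ := Nat.exists_eq_add_of_le hle
    have e1 : length S w₀ - length S t = k + 1 := by omega
    have e2 : length S w₀ - length S (σ t) = k := by omega
    have h1 := hlt t (by omega)
    have h2 := hgt (σ t) (by rw [hσ]; omega)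
    rw [hσ] at h2
    simp only [g, e1, e2]
    rw [map_add, map_smul, map_smul, h1, h2, smul_add, smul_add, smul_smul, smul_smul, smul_smul]
    have a1 : vinv * v ^ (k + 1) = v ^ k := by
      rw [pow_succ', ← mul_assoc, vinv_mul_v, one_mul]
    have a2 : v ^ k * (vinv - v) = vinv * v ^ k - v ^ (k + 1) := by ring
    rw [a1, a2, sub_smul]
    abel
  have hsplit : parabolicSum S K w₀ =
      ∑ t ∈ F with length S (σ t) = length S t + 1, (g t + g (σ t)) := by
    rw [hK.parabolicSum_eq, Finset.sum_add_distrib,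
      ← Finset.sum_filter_add_sum_filter_not F fun t => length S (σ t) = length S t + 1]
    congr 1
    refine Finset.sum_nbij' σ σ ?_ ?_ (fun t _ => hσ t) (fun t _ => hσ t) ?_
    · intro t ht
      rw [Finset.mem_filter] at ht ⊢
      have := hl t
      refine ⟨hF.2 (hσK t (hF.1 ht.1)), ?_⟩
      rw [hσ]; omega
    · intro t ht
      rw [Finset.mem_filter] at ht ⊢
      refine ⟨hF.2 (hσK t (hF.1 ht.1)), ?_⟩
      rw [hσ]; omega
    · intro t _
      rw [hσ]
  rw [hsplit, map_sum, Finset.smul_sum]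
  refine Finset.sum_congr rfl fun t ht => ?_
  rw [Finset.mem_filter] at ht
  exact hpair t ht.1 ht.2

/-! ### The Kazhdan–Lusztig element of the longest element of a finite parabolic subgroup -/

lemma parabolicSum_mul_simple {s : G} (hs : s ∈ S ∩ K) :
    parabolicSum S K w₀ * H S s = vinv • parabolicSum S K w₀ :=
  hK.map_parabolicSum (LinearMap.mulRight _ (H S s)) (· * s) (hS.mul_cancel_right hs.1)
    (fun _ ht => K.mul_mem ht hs.2) (hS.length_mul_right hs.1)
    (fun _ => H_mul_simple_of_lt hS hs.1) fun _ => H_mul_simple_of_gt hS hs.1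

lemma simple_mul_parabolicSum {s : G} (hs : s ∈ S ∩ K) :
    H S s * parabolicSum S K w₀ = vinv • parabolicSum S K w₀ :=
  hK.map_parabolicSum (LinearMap.mulLeft _ (H S s)) (s * ·) (hS.mul_cancel hs.1)
    (fun _ ht => K.mul_mem hs.2 ht) (hS.length_mul s hs.1)
    (fun _ => H_simple_mul_of_lt hS hs.1) fun _ => H_simple_mul_of_gt hS hs.1

lemma mul_H_of_mul_simple {x : Hecke S} (hx : ∀ s ∈ S ∩ K, H S s * x = vinv • x) {t : G}
    (ht : t ∈ K) : H S t * x = vinv ^ length S t • x := by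
  refine hK.induction_left hS (p := fun t => H S t * x = vinv ^ length S t • x) ?_ ?_ ht
  · rw [H_one, one_mul, length_one, pow_zero, one_smul]
  · intro s hs t _ hl ih
    rw [← H_simple_mul_of_lt hS hs.1 (by omega), mul_assoc, ih, mul_smul_comm, hx s hs, smul_smul,
      hl, pow_succ]

lemma mul_H_of_simple_mul {x : Hecke S} (hx : ∀ s ∈ S ∩ K, x * H S s = vinv • x) {t : G}
    (ht : t ∈ K) : x * H S t = vinv ^ length S t • x := by
  rw [← inv_inv t]
  refine hK.induction_left hS (p := fun t => x * H S t⁻¹ = vinv ^ length S t⁻¹ • x) ?_ ?_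
    (K.inv_mem ht)
  · rw [inv_one, H_one, mul_one, length_one, pow_zero, one_smul]
  · intro s hs t _ hl ih
    rw [hS.length_inv] at ih ⊢
    rw [mul_inv_rev, hS.inv_eq hs.1, ← H_mul_simple_of_lt hS hs.1, ← mul_assoc, ih,
      smul_mul_assoc, hx s hs, smul_smul, hl, pow_succ]
    rw [← hS.length_inv (t⁻¹ * s), mul_inv_rev, hS.inv_eq hs.1, inv_inv, hS.length_inv]
    omega

lemma oneTmul_mul_of_mem {t : G} (ht : t ∈ K) (h : Hecke S) :
    oneTmul S (S ∩ K) vinv (H S t * h) = vinv ^ length S t • oneTmul S (S ∩ K) vinv h := by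
  refine hK.induction_left hS (p := fun t => oneTmul S (S ∩ K) vinv (H S t * h) =
    vinv ^ length S t • oneTmul S (S ∩ K) vinv h) ?_ ?_ ht
  · rw [H_one, one_mul, length_one, pow_zero, one_smul]
  · intro s hs t _ hl ih
    rw [← H_simple_mul_of_lt hS hs.1 (by omega), mul_assoc, oneTmul_H_mul hs, ih, smul_smul,
      hl, pow_succ']

lemma oneTmul_parabolicSum_mul (h : Hecke S) :
    oneTmul S (S ∩ K) vinv (parabolicSum S K w₀ * h) =
      poincare S K w₀ • oneTmul S (S ∩ K) vinv h := by
  rw [hK.parabolicSum_eq, hK.poincare_eq, Finset.sum_mul, Finset.sum_smul, ← oneTmulₗ_apply,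
    map_sum]
  refine Finset.sum_congr rfl fun t ht => ?_
  rw [smul_mul_assoc, map_smul, oneTmulₗ_apply, hK.oneTmul_mul_of_mem hS (hK.mem_toFinset.1 ht),
    smul_smul]

lemma bar_parabolicSum_mul {s : G} (hs : s ∈ S ∩ K) :
    bar hS (parabolicSum S K w₀) * H S s = vinv • bar hS (parabolicSum S K w₀) := by
  have h1 : parabolicSum S K w₀ * simpleInv S s = v • parabolicSum S K w₀ := by
    have h := congrArg (fun x => v • (x * simpleInv S s)) (hK.parabolicSum_mul_simple hS hs)
    simp only [mul_assoc, H_mul_simpleInv hs.1, mul_one, smul_mul_assoc, smul_smul, v_mul_vinv,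
      one_smul] at h
    exact h.symm
  have h2 := congrArg (bar hS) h1
  rwa [map_mul, bar_smul, invert_v, ← barH_simple hS hs.1, ← bar_H hS, bar_bar] at h2

lemma simple_mul_bar_parabolicSum {s : G} (hs : s ∈ S ∩ K) :
    H S s * bar hS (parabolicSum S K w₀) = vinv • bar hS (parabolicSum S K w₀) := by
  have h1 : simpleInv S s * parabolicSum S K w₀ = v • parabolicSum S K w₀ := by
    have h := congrArg (fun x => v • (simpleInv S s * x)) (hK.simple_mul_parabolicSum hS hs)
    simp only [← mul_assoc, simpleInv_mul_H hs.1, one_mul, mul_smul_comm, smul_smul, v_mul_vinv,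
      one_smul] at h
    exact h.symm
  have h2 := congrArg (bar hS) h1
  rwa [map_mul, bar_smul, invert_v, ← barH_simple hS hs.1, ← bar_H hS, bar_bar] at h2

lemma bar_mul_self : bar hS (parabolicSum S K w₀) * parabolicSum S K w₀ =
    poincare S K w₀ • bar hS (parabolicSum S K w₀) := by
  nth_rw 2 [hK.parabolicSum_eq]
  rw [hK.poincare_eq, Finset.mul_sum, Finset.sum_smul]
  refine Finset.sum_congr rfl fun t ht => ?_
  rw [mul_smul_comm, hK.mul_H_of_simple_mul hS (fun _ => hK.bar_parabolicSum_mul hS)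
    (hK.mem_toFinset.1 ht), smul_smul]

lemma self_mul_bar : parabolicSum S K w₀ * bar hS (parabolicSum S K w₀) =
    poincare S K w₀ • bar hS (parabolicSum S K w₀) := by
  nth_rw 1 [hK.parabolicSum_eq]
  rw [hK.poincare_eq, Finset.sum_mul, Finset.sum_smul]
  refine Finset.sum_congr rfl fun t ht => ?_
  rw [smul_mul_assoc, hK.mul_H_of_mul_simple hS (fun _ => hK.simple_mul_bar_parabolicSum hS)
    (hK.mem_toFinset.1 ht), smul_smul]

-- The product is a sum of terms v^(ℓ(w₀) - ℓ(t)) H_{tw}, and the exponent is zero only for t = w₀.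
omit hS in
lemma parabolicSum_mul_H {w : G} (hw : IsMinCoset S K w) :
    parabolicSum S K w₀ * H S w - H S (w₀ * w) ∈ lat (H S) 1 := by
  have h : ∀ {x : Hecke S}, x ∈ lat (fun t : K => H S (t : G)) 1 → x * H S w ∈ lat (H S) 1 := by
    intro x hx
    have := map_mem_lat (e' := H S) (LinearMap.mulRight _ (H S w)) (k := 0) (fun t => by
      rw [LinearMap.mulRight_apply, H_mul (hw t t.2)]
      exact mem_lat_zero _ _) hx
    simpa using this
  rw [← H_mul (hw w₀ hK.longest_mem), ← sub_mul]
  refine h ?_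
  classical
  rw [hK.parabolicSum_eq, ← Finset.add_sum_erase _ _ (hK.mem_toFinset.2 hK.longest_mem),
    Nat.sub_self, pow_zero, one_smul, add_sub_cancel_left]
  refine Submodule.sum_mem _ fun t ht => ?_
  rw [Finset.mem_erase, hK.mem_toFinset] at ht
  exact smul_mem_lat (fun t : K => H S (t : G)) (Nat.sub_pos_of_lt (hK.length_lt t ht.2 ht.1))
    ⟨t, ht.2⟩

omit hS in
lemma sub_mem_lat : parabolicSum S K w₀ - H S w₀ ∈ lat (H S) 1 := by
  have := hK.parabolicSum_mul_H (w := 1) fun t _ => by rw [mul_one, length_one, add_zero]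
  rwa [H_one, mul_one, mul_one] at this

lemma repr_parabolicSum [DecidableEq G] (w : G) :
    (heckeBasis hS).repr (parabolicSum S K w₀) w =
      if w ∈ hK.finite.toFinset then v ^ (length S w₀ - length S w) else 0 := by
  rw [hK.parabolicSum_eq, map_sum, Finsupp.finsetSum_apply]
  simp only [map_smul, ← heckeBasis_apply hS, Module.Basis.repr_self, Finsupp.smul_apply,
    Finsupp.single_apply, smul_eq_mul, mul_ite, mul_one, mul_zero]
  rw [Finset.sum_ite_eq']

/-- Write C for the sum, C' for its conjugate and π for the Poincaré polynomial. Both C' C and C C'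
equal π C'. Conjugating the first identity gives C C' = π' C, with π' the conjugate of π, so π C' =
π' C. By triangularity both C and C' have coefficient 1 at w₀, so π = π', and π can be cancelled. -/
lemma bar_parabolicSum : bar hS (parabolicSum S K w₀) = parabolicSum S K w₀ := by
  classical
  have h1 := hK.self_mul_bar hS
  have h2 := congrArg (bar hS) (hK.bar_mul_self hS)
  rw [map_mul, bar_smul, bar_bar, h1] at h2
  have hw : (heckeBasis hS).repr (bar hS (parabolicSum S K w₀)) w₀ = 1 := by
    have := (isBarModule_hecke hS).repr_apply (x := parabolicSum S K w₀) (i := w₀) (fun j hj => by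
      rw [hK.repr_parabolicSum hS, if_neg]
      intro hj'
      exact absurd (hK.length_le (hK.mem_toFinset.1 hj')) (by omega))
    rw [hK.repr_parabolicSum hS, if_pos (hK.mem_toFinset.2 hK.longest_mem), Nat.sub_self,
      pow_zero, map_one] at this
    exact this
  have h3 := congrArg (fun x => (heckeBasis hS).repr x w₀) h2
  simp only [map_smul, Finsupp.smul_apply, hw, hK.repr_parabolicSum hS,
    if_pos (hK.mem_toFinset.2 hK.longest_mem), Nat.sub_self, pow_zero, smul_eq_mul, mul_one] at h3
  rw [← h3] at h2
  have := (heckeBasis hS).isTorsionFree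
  exact smul_right_injective _ hK.poincare_ne_zero h2

lemma KL_longest : KL S w₀ = parabolicSum S K w₀ :=
  KL_eq hS (hK.bar_parabolicSum hS) hK.sub_mem_lat

/-! ### The spherical module -/

/-- Multiplying by the parabolic sum inside 1 ⊗ h multiplies by the nonzero Poincaré polynomial, and
the spherical module is torsion-free. This yields the injectivity of ζ without computing in bases.
-/
lemma oneTmul_eq_of_parabolicSum_mul_eq {x y : Hecke S}
    (h : parabolicSum S K w₀ * x = parabolicSum S K w₀ * y) :
    oneTmul S (S ∩ K) vinv x = oneTmul S (S ∩ K) vinv y := by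
  have := (inducedBasis hS (Set.inter_subset_left (t := (K : Set G)))
    isCharValue_vinv).isTorsionFree
  refine smul_right_injective _ hK.poincare_ne_zero ?_
  simp only
  rw [← hK.oneTmul_parabolicSum_mul hS, h, hK.oneTmul_parabolicSum_mul hS]

/-- The map `1 ⊗ h ↦ (∑_t v^{ℓ(w₀) - ℓ(t)} H_t) h` on the spherical module. -/
def zeta : Induced S (S ∩ K) vinv →ₗ[(Hecke S)ᵐᵒᵖ] Hecke S :=
  Submodule.liftQ _
    { toFun := fun h => parabolicSum S K w₀ * h
      map_add' := mul_add _
      map_smul' := fun a h => (mul_assoc (parabolicSum S K w₀) h a.unop).symm } <| by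
    refine Submodule.span_le.2 ?_
    rintro _ ⟨s, hs, rfl⟩
    change parabolicSum S K w₀ * (H S s - algebraMap _ (Hecke S) vinv) = 0
    rw [mul_sub, hK.parabolicSum_mul_simple hS hs, ← Algebra.commutes, ← Algebra.smul_def,
      sub_self]

lemma zeta_oneTmul (h : Hecke S) :
    hK.zeta hS (oneTmul S (S ∩ K) vinv h) = parabolicSum S K w₀ * h := rfl

lemma zeta_injective : Function.Injective (hK.zeta hS) := by
  intro x y hxy
  obtain ⟨x, rfl⟩ := oneTmul_surjective x
  obtain ⟨y, rfl⟩ := oneTmul_surjective y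
  exact hK.oneTmul_eq_of_parabolicSum_mul_eq hS hxy

lemma parabolicSum_mul_eq {x y : Hecke S}
    (h : oneTmul S (S ∩ K) vinv x = oneTmul S (S ∩ K) vinv y) :
    parabolicSum S K w₀ * x = parabolicSum S K w₀ * y := by
  rw [← hK.zeta_oneTmul hS, h, hK.zeta_oneTmul hS]

lemma minRep_eq {w : G} (hw : IsMinCoset S K w) :
    minRep S (Quotient.mk _ w : ParabolicCoset (S ∩ (K : Set G))) = w := by
  have h1 := parabolicCoset_eq.1 (mk_minRep (S := S)
    (Quotient.mk _ w : ParabolicCoset (S ∩ (K : Set G))))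
  have h2 := length_minRep_le (S := S) (J := S ∩ (K : Set G)) w
  set m := minRep S (Quotient.mk _ w : ParabolicCoset (S ∩ (K : Set G)))
  rw [hK.closure_eq hS] at h1
  have h3 := hw _ (K.inv_mem h1)
  rw [mul_inv_rev, inv_inv, inv_mul_cancel_right] at h3
  by_contra hne
  obtain ⟨s, _, hs⟩ := hS.exists_descent (m * w⁻¹) (by
    rwa [Ne, mul_inv_eq_one])
  omega

lemma isMinCoset_minRep (q : ParabolicCoset (S ∩ (K : Set G))) :
    IsMinCoset S K (minRep S q) := by
  obtain ⟨t, ht, h⟩ := hK.exists_isMinCoset (minRep S q)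
  have h1 := hK.minRep_eq hS h
  rw [parabolicCoset_mul (by rwa [hK.closure_eq hS]), mk_minRep] at h1
  rwa [← h1] at h

/-- The Kazhdan–Lusztig elements of the spherical module. -/
lemma exists_sph_kl {w : G} (hw : IsMinCoset S K w) :
    ∃ h : Hecke S, oneTmul S (S ∩ K) vinv (bar hS h) = oneTmul S (S ∩ K) vinv h ∧
      oneTmul S (S ∩ K) vinv h - oneTmul S (S ∩ K) vinv (H S w) ∈
        lat (fun z : {z // IsMinCoset S K z} => oneTmul S (S ∩ K) vinv (H S z)) 1 := by
  have hJ : S ∩ K ⊆ S := Set.inter_subset_left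
  obtain ⟨m, hm, hm'⟩ := (isBarModule_induced hS hJ isCharValue_vinv).exists_kl (Quotient.mk _ w)
  obtain ⟨h, rfl⟩ := oneTmul_surjective m
  rw [barInduced_oneTmul] at hm
  refine ⟨h, hm, ?_⟩
  rw [coe_inducedBasis] at hm'
  simp only [hK.minRep_eq hS hw] at hm'
  exact lat_le_lat (fun q => mem_lat_zero (fun z : {z // IsMinCoset S K z} =>
    oneTmul S (S ∩ K) vinv (H S z)) ⟨_, hK.isMinCoset_minRep hS q⟩) 1 hm'

/-- The parabolic sum is self-dual, so ζ commutes with the involutions, and it maps 1 ⊗ H_z to H_{w₀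
z} modulo v. Hence it carries self-dual elements with leading term 1 ⊗ H_w to Kazhdan–Lusztig
elements. -/
lemma exists_KL_eq_parabolicSum_mul {w : G} (hw : IsMinCoset S K w) :
    ∃ h : Hecke S, oneTmul S (S ∩ K) vinv (bar hS h) = oneTmul S (S ∩ K) vinv h ∧
      oneTmul S (S ∩ K) vinv h - oneTmul S (S ∩ K) vinv (H S w) ∈
        lat (fun z : {z // IsMinCoset S K z} => oneTmul S (S ∩ K) vinv (H S z)) 1 ∧
      KL S (w₀ * w) = parabolicSum S K w₀ * h := by
  obtain ⟨h, h1, h2⟩ := hK.exists_sph_kl hS hw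
  refine ⟨h, h1, h2, KL_eq hS ?_ ?_⟩
  · rw [map_mul, hK.bar_parabolicSum hS]
    exact hK.parabolicSum_mul_eq hS h1
  · have h3 := map_mem_lat (e' := H S)
      ((hK.zeta hS).restrictScalars ℤ[T;T⁻¹]) (k := 0) (fun z => by
        have := add_mem (lat_antitone _ zero_le_one (hK.parabolicSum_mul_H z.2))
          (mem_lat_zero (H S) (w₀ * z))
        rwa [sub_add_cancel] at this) h2
    rw [zero_add, ← oneTmulₗ_apply, ← oneTmulₗ_apply, map_sub] at h3
    have h4 := add_mem h3 (hK.parabolicSum_mul_H hw)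
    rwa [LinearMap.restrictScalars_apply, LinearMap.restrictScalars_apply, oneTmulₗ_apply,
      oneTmulₗ_apply, zeta_oneTmul, zeta_oneTmul, sub_add_sub_cancel] at h4

end IsFiniteParabolic

end Parabolic

/-! ### From the spherical to the antispherical module -/

section SphericalToAntispherical

variable {G : Type*} [Group G] {S J : Set G} {K : Subgroup G} {w₀ u : G}

/-- The hypotheses on `u` under which `1 ⊗ \underline{H}_{u w₀} = 1 ⊗ H_u \underline{H}_{w₀}`
generates a copy of a quotient of the spherical module of `K` in the antispherical module of `J`,
compatibly with Kazhdan–Lusztig elements. -/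
structure IsSteinbergElement (S J : Set G) (K : Subgroup G) (w₀ u : G) : Prop where
  eq_zero : ∀ y, length S y < length S u →
    oneTmul S J (-v) (H S y * parabolicSum S K w₀) = 0
  sub_mem : ∀ z, IsMinCoset S K z →
    oneTmul S J (-v) (H S u * parabolicSum S K w₀ * H S z) - oneTmul S J (-v) (H S (u * w₀ * z)) ∈
      lat (fun w => oneTmul S J (-v) (H S w)) 1

variable (hS : IsCoxeterLike S) (hJ : J ⊆ S) (hK : IsFiniteParabolic S K w₀)
  (hu : IsSteinbergElement S J K w₀ u)

lemma oneTmul_sub_mem_lat {x y : Hecke S} (h : x - y ∈ lat (H S) 1) :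
    oneTmul S J (-v) x - oneTmul S J (-v) y ∈ lat (fun w => oneTmul S J (-v) (H S w)) 1 := by
  have := map_mem_lat (e' := fun w => oneTmul S J (-v) (H S w)) (oneTmulₗ S J (-v)) (k := 0)
    (fun w => mem_lat_zero _ w) h
  rwa [zero_add, map_sub] at this

namespace IsSteinbergElement

include hS hJ hK hu

-- The involution changes H_u by a combination of shorter H_y, and `eq_zero` kills their
-- contribution.
omit hJ in
lemma oneTmul_bar :
    oneTmul S J (-v) (bar hS (H S u * parabolicSum S K w₀)) =
      oneTmul S J (-v) (H S u * parabolicSum S K w₀) := by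
  rw [map_mul, hK.bar_parabolicSum hS, ← sub_eq_zero]
  change oneTmulₗ S J (-v) _ - oneTmulₗ S J (-v) _ = 0
  rw [← map_sub, ← sub_mul]
  have h := bar_H_sub_mem hS u
  generalize bar hS (H S u) - H S u = x at h ⊢
  induction h using Submodule.span_induction with
  | mem x hx =>
    obtain ⟨y, hy, rfl⟩ := hx
    exact hu.eq_zero y hy
  | zero => rw [zero_mul, map_zero]
  | add x y _ _ hx hy => rw [add_mul, map_add, hx, hy, add_zero]
  | smul a x _ hx => rw [smul_mul_assoc, map_smul, hx, smul_zero]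

lemma oneTmul_KL : oneTmul S J (-v) (KL S (u * w₀)) =
    oneTmul S J (-v) (H S u * parabolicSum S K w₀) := by
  refine oneTmul_eq_of_sub_mem hS hJ (by rw [bar_KL]) (hu.oneTmul_bar hS hK) ?_
  have h1 := oneTmul_sub_mem_lat (J := J) (KL_sub_mem hS (u * w₀))
  have h2 := hu.sub_mem 1 fun t _ => by rw [mul_one, length_one, add_zero]
  rw [H_one, mul_one, mul_one] at h2
  have := _root_.sub_mem h1 h2
  rwa [sub_sub_sub_cancel_right] at this

/-- The morphism `1 ⊗ h ↦ (1 ⊗ \underline{H}_{u w₀}) h`. -/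
def phi : Induced S (S ∩ K) vinv →ₗ[(Hecke S)ᵐᵒᵖ] Induced S J (-v) :=
  Submodule.liftQ _
    { toFun := fun h => oneTmul S J (-v) (KL S (u * w₀) * h)
      map_add' := fun x y => by rw [mul_add]; rfl
      map_smul' := fun a h => by
        change oneTmul S J (-v) (KL S (u * w₀) * (h * a.unop)) = _
        rw [← mul_assoc]; rfl } <| by
    refine Submodule.span_le.2 ?_
    rintro _ ⟨s, hs, rfl⟩
    change oneTmul S J (-v) (KL S (u * w₀) * (H S s - algebraMap _ (Hecke S) vinv)) = 0
    rw [oneTmul_mul, hu.oneTmul_KL hS hJ hK, ← oneTmul_mul, mul_assoc, mul_sub,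
      hK.parabolicSum_mul_simple hS hs, ← Algebra.commutes, ← Algebra.smul_def, sub_self, mul_zero]
    rfl

lemma phi_oneTmul (h : Hecke S) : hu.phi hS hJ hK (oneTmul S (S ∩ K) vinv h) =
    oneTmul S J (-v) (KL S (u * w₀)) <• h := rfl

lemma phi_oneTmul' (h : Hecke S) : hu.phi hS hJ hK (oneTmul S (S ∩ K) vinv h) =
    oneTmul S J (-v) (H S u * parabolicSum S K w₀ * h) := by
  rw [phi_oneTmul, hu.oneTmul_KL hS hJ hK]
  exact (oneTmul_mul _ _).symm

/-- The generator has a self-dual image, so φ commutes with the involutions; by `sub_mem` it maps 1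
⊗ H_z to 1 ⊗ H_{u w₀ z} modulo v. Uniqueness of self-dual elements with given leading term
concludes. -/
lemma phi_eq_KL {w : G} (hw : IsMinCoset S K w) {h : Hecke S}
    (h1 : oneTmul S (S ∩ K) vinv (bar hS h) = oneTmul S (S ∩ K) vinv h)
    (h2 : oneTmul S (S ∩ K) vinv h - oneTmul S (S ∩ K) vinv (H S w) ∈
        lat (fun z : {z // IsMinCoset S K z} => oneTmul S (S ∩ K) vinv (H S z)) 1) :
    hu.phi hS hJ hK (oneTmul S (S ∩ K) vinv h) = oneTmul S J (-v) (KL S (u * w₀ * w)) := by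
  rw [hu.phi_oneTmul' hS hJ hK]
  refine oneTmul_eq_of_sub_mem hS hJ ?_ (by rw [bar_KL]) ?_
  · rw [map_mul, oneTmul_mul, hu.oneTmul_bar hS hK, ← oneTmul_mul,
      ← hu.phi_oneTmul' hS hJ hK, h1, hu.phi_oneTmul' hS hJ hK]
  · have h3 := map_mem_lat (e' := fun w => oneTmul S J (-v) (H S w))
      ((hu.phi hS hJ hK).restrictScalars ℤ[T;T⁻¹]) (k := 0) (fun z => by
        have := add_mem (lat_antitone _ zero_le_one (hu.sub_mem z z.2))
          (mem_lat_zero (fun w => oneTmul S J (-v) (H S w)) (u * w₀ * z))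
        rwa [sub_add_cancel, ← hu.phi_oneTmul' hS hJ hK] at this) h2
    rw [zero_add, ← oneTmulₗ_apply, ← oneTmulₗ_apply, map_sub] at h3
    have h4 := add_mem h3 (hu.sub_mem w hw)
    rw [LinearMap.restrictScalars_apply, LinearMap.restrictScalars_apply, oneTmulₗ_apply,
      oneTmulₗ_apply, hu.phi_oneTmul' hS hJ hK, hu.phi_oneTmul' hS hJ hK,
      sub_add_sub_cancel] at h4
    have h5 := _root_.sub_mem h4 (oneTmul_sub_mem_lat (J := J) (KL_sub_mem hS (u * w₀ * w)))
    rwa [sub_sub_sub_cancel_right] at h5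

end IsSteinbergElement

end SphericalToAntispherical

/-! ### Affine roots -/

section AffineRoots

variable {ι V N : Type*} [AddCommGroup V] [Module ℝ V] [AddCommGroup N] [Module ℝ N]
  (P : RootPairing ι ℝ V N)

/-- The affine function `x ↦ ⟨x, α_i^∨⟩ - k`. -/
def aff (i : ι) (k : ℤ) (x : V) : ℝ := P.coroot' i x - k

/-- The set of all affine functions `x ↦ ⟨x, α_i^∨⟩ - k`. -/
def affRoots : Set (V → ℝ) := {f | ∃ i k, f = aff P i k}

variable {P}

lemma aff_mem (i : ι) (k : ℤ) : aff P i k ∈ affRoots P := ⟨i, k, rfl⟩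

lemma coroot'_neg (i : ι) (x : V) : P.coroot' (P.reflectionPerm i i) x = -P.coroot' i x := by
  rw [← P.coroot'_reflection, P.reflection_apply, map_sub, map_smul, P.root_coroot'_eq_pairing,
    P.pairing_same, smul_eq_mul]
  ring

lemma coroot'_root_self (i : ι) : P.coroot' i (P.root i) = 2 := by
  rw [P.root_coroot'_eq_pairing, P.pairing_same]

lemma aff_neg (i : ι) (k : ℤ) : aff P (P.reflectionPerm i i) (-k) = -aff P i k := by
  funext x
  simp only [aff, coroot'_neg, Pi.neg_apply]
  push_cast
  ring

lemma neg_mem_affRoots {f : V → ℝ} (hf : f ∈ affRoots P) : -f ∈ affRoots P := by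
  obtain ⟨i, k, rfl⟩ := hf
  exact ⟨_, _, (aff_neg i k).symm⟩

lemma aff_lineMap {f : V → ℝ} (hf : f ∈ affRoots P) (x y : V) (t : ℝ) :
    f (AffineMap.lineMap x y t) = (1 - t) * f x + t * f y := by
  obtain ⟨i, k, rfl⟩ := hf
  simp only [aff, AffineMap.lineMap_apply_module, map_add, map_smul, smul_eq_mul]
  ring

lemma aff_injective {i j : ι} {k m : ℤ} (h : aff P i k = aff P j m) : i = j ∧ k = m := by
  have h1 (x : V) : P.coroot' i x - k = P.coroot' j x - m := congrFun h x
  have hk : k = m := by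
    have := h1 0
    simp only [map_zero] at this
    exact_mod_cast (by linarith : (k : ℝ) = m)
  refine ⟨P.coroot.injective ?_, hk⟩
  have h2 : P.toLinearMap.flip (P.coroot i) = P.toLinearMap.flip (P.coroot j) := by
    ext x
    have := h1 x
    rw [hk] at this
    exact sub_left_injective this
  exact P.toLinearMap.flip.toPerfPair.injective h2

lemma act_one (x : V) : act P 1 x = x := rfl

lemma act_mul (w w' : affineWeyl P) (x : V) : act P (w * w') x = act P w (act P w' x) := rfl

lemma act_inv_act (w : affineWeyl P) (x : V) : act P w⁻¹ (act P w x) = x := by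
  rw [← act_mul, inv_mul_cancel, act_one]

lemma act_act_inv (w : affineWeyl P) (x : V) : act P w (act P w⁻¹ x) = x := by
  rw [← act_mul, mul_inv_cancel, act_one]

lemma act_injective {w w' : affineWeyl P} (h : ∀ x, act P w x = act P w' x) : w = w' :=
  Subtype.ext (AffineEquiv.ext h)

/-- `w` maps the affine root `(i, k)` to the affine root `(j, m)`. -/
def MapsAff (w : V ≃ᵃ[ℝ] V) (i : ι) (k : ℤ) (j : ι) (m : ℤ) : Prop :=
  (∀ x, aff P j m (w x) = aff P i k x) ∧ ∀ x (t : ℝ), w (x + t • P.root i) = w x + t • P.root j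

/-- Crystallographicity keeps the levels integral under translation. Tracking the root directions
along with the affine functions is what later allows reflections to be conjugated. -/
lemma exists_mapsAff [P.IsCrystallographic] {w : V ≃ᵃ[ℝ] V} (hw : w ∈ affineWeyl P) :
    (∀ i k, ∃ j m, MapsAff (P := P) w i k j m) ∧ ∀ j m, ∃ i k, MapsAff (P := P) w i k j m := by
  have hr (l i : ι) (k : ℤ) : MapsAff (P := P) (P.reflection l).toAffineEquiv i k
      (P.reflectionPerm l i) k := by
    refine ⟨fun x => ?_, fun x t => ?_⟩
    · simp only [LinearEquiv.coe_toAffineEquiv, aff, P.coroot'_reflection, P.reflectionPerm_self]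
    · simp [LinearEquiv.coe_toAffineEquiv]
  have ht (l i : ι) (k z : ℤ) (hz : (z : ℝ) = P.pairing l i) : MapsAff (P := P)
      (AffineEquiv.constVAdd ℝ V (P.root l)) i k i (k + z) := by
    refine ⟨fun x => ?_, fun x t => ?_⟩
    · simp only [AffineEquiv.constVAdd_apply, vadd_eq_add, aff, map_add,
        P.root_coroot'_eq_pairing, ← hz]
      push_cast
      ring
    · simp only [AffineEquiv.constVAdd_apply, vadd_eq_add, add_assoc]
  induction hw using Subgroup.closure_induction with
  | mem w hw =>
    rcases hw with ⟨l, rfl⟩ | ⟨l, rfl⟩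
    · refine ⟨fun i k => ⟨_, _, hr l i k⟩, fun j m => ⟨P.reflectionPerm l j, m, ?_⟩⟩
      have := hr l (P.reflectionPerm l j) m
      rwa [P.reflectionPerm_self] at this
    · have hz (i : ι) : ∃ z : ℤ, (z : ℝ) = P.pairing l i := by
        obtain ⟨z, hz⟩ := P.exists_value (S := ℤ) l i
        exact ⟨z, by simpa using hz⟩
      refine ⟨fun i k => ?_, fun j m => ?_⟩
      · obtain ⟨z, hz⟩ := hz i
        exact ⟨_, _, ht l i k z hz⟩
      · obtain ⟨z, hz⟩ := hz j
        refine ⟨j, m - z, ?_⟩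
        have := ht l j (m - z) z hz
        rwa [sub_add_cancel] at this
  | one => exact ⟨fun i k => ⟨i, k, fun _ => rfl, fun _ _ => rfl⟩,
      fun i k => ⟨i, k, fun _ => rfl, fun _ _ => rfl⟩⟩
  | mul x y _ _ hx hy =>
    have key {i k j m l n} (h1 : MapsAff (P := P) y i k j m) (h2 : MapsAff (P := P) x j m l n) :
        MapsAff (P := P) (x * y) i k l n := by
      refine ⟨fun z => ?_, fun z t => ?_⟩
      · rw [AffineEquiv.coe_mul, Function.comp_apply, h2.1, h1.1]
      · simp only [AffineEquiv.coe_mul, Function.comp_apply, h1.2, h2.2]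
    refine ⟨fun i k => ?_, fun l n => ?_⟩
    · obtain ⟨j, m, h1⟩ := hy.1 i k
      obtain ⟨l, n, h2⟩ := hx.1 j m
      exact ⟨l, n, key h1 h2⟩
    · obtain ⟨j, m, h1⟩ := hx.2 l n
      obtain ⟨i, k, h2⟩ := hy.2 j m
      exact ⟨i, k, key h2 h1⟩
  | inv x _ hx =>
    have key {i k j m} (h : MapsAff (P := P) x i k j m) : MapsAff (P := P) x⁻¹ j m i k := by
      have hxx (z : V) : x (x⁻¹ z) = z := AffineEquiv.apply_symm_apply x z
      refine ⟨fun z => ?_, fun z t => ?_⟩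
      · rw [← h.1, hxx]
      · apply x.injective
        rw [hxx, h.2, hxx]
    refine ⟨fun i k => ?_, fun l n => ?_⟩
    · obtain ⟨j, m, h⟩ := hx.2 i k
      exact ⟨j, m, key h⟩
    · obtain ⟨j, m, h⟩ := hx.1 l n
      exact ⟨j, m, key h⟩

lemma comp_act_mem [P.IsCrystallographic] (w : affineWeyl P) {f : V → ℝ} (hf : f ∈ affRoots P) :
    (fun x => f (act P w x)) ∈ affRoots P := by
  obtain ⟨j, m, rfl⟩ := hf
  obtain ⟨i, k, h⟩ := (exists_mapsAff w.2).2 j m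
  exact ⟨i, k, funext h.1⟩

lemma exists_affRefl (i : ι) (k : ℤ) :
    ∃ r : affineWeyl P, ∀ x, act P r x = x - aff P i k x • P.root i := by
  let t : affineWeyl P := ⟨AffineEquiv.constVAdd ℝ V (P.root i),
    Subgroup.subset_closure (Or.inr ⟨i, rfl⟩)⟩
  let r : affineWeyl P := ⟨(P.reflection i).toAffineEquiv,
    Subgroup.subset_closure (Or.inl ⟨i, rfl⟩)⟩
  have ht (x : V) : act P t x = P.root i + x := rfl
  have ht' (x : V) : act P t⁻¹ x = -P.root i + x := by
    rw [eq_neg_add_iff_add_eq, ← ht, act_act_inv]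
  have hr (x : V) : act P r x = x - P.coroot' i x • P.root i := rfl
  induction k using Int.induction_on with
  | zero => exact ⟨r, fun x => by rw [hr, aff, Int.cast_zero, sub_zero]⟩
  | succ k ih =>
    obtain ⟨r, hr⟩ := ih
    refine ⟨t * r, fun x => ?_⟩
    rw [act_mul, ht, hr]
    simp only [aff]
    push_cast
    module
  | pred k ih =>
    obtain ⟨r, hr⟩ := ih
    refine ⟨t⁻¹ * r, fun x => ?_⟩
    rw [act_mul, ht', hr]
    simp only [aff]
    push_cast
    module

/-- The reflection in the hyperplane `⟨x, α_i^∨⟩ = k`. -/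
def affRefl (P : RootPairing ι ℝ V N) (i : ι) (k : ℤ) : affineWeyl P := (exists_affRefl i k).choose

lemma act_affRefl (i : ι) (k : ℤ) (x : V) :
    act P (affRefl P i k) x = x - aff P i k x • P.root i :=
  (exists_affRefl i k).choose_spec x

lemma eq_affRefl_iff {w : affineWeyl P} {i : ι} {k : ℤ} :
    w = affRefl P i k ↔ ∀ x, act P w x = x - (P.coroot' i x - k) • P.root i :=
  ⟨fun h x => by rw [h, act_affRefl]; rfl, fun h => act_injective fun x => by
    rw [h, act_affRefl]; rfl⟩

lemma aff_act_affRefl (i : ι) (k : ℤ) (x : V) :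
    aff P i k (act P (affRefl P i k) x) = -aff P i k x := by
  rw [act_affRefl]
  simp only [aff, map_sub, map_smul, coroot'_root_self, smul_eq_mul]
  ring

lemma act_affRefl_eq_self {i : ι} {k : ℤ} {x : V} (h : aff P i k x = 0) :
    act P (affRefl P i k) x = x := by
  rw [act_affRefl, h, zero_smul, sub_zero]

lemma affRefl_mul_self (i : ι) (k : ℤ) : affRefl P i k * affRefl P i k = 1 :=
  act_injective fun x => by
    rw [act_mul, act_affRefl i k (act P _ x), aff_act_affRefl, act_affRefl, act_one]
    module

lemma affRefl_neg (i : ι) (k : ℤ) : affRefl P (P.reflectionPerm i i) (-k) = affRefl P i k :=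
  act_injective fun x => by
    rw [act_affRefl, act_affRefl, aff_neg, Pi.neg_apply, P.root_reflectionPerm,
      P.reflection_apply_self]
    module

lemma affRefl_mul_of_comp_eq [P.IsCrystallographic] {w : affineWeyl P} {i j : ι} {k m : ℤ}
    (h : ∀ x, aff P i k (act P w x) = aff P j m x) : affRefl P i k * w = w * affRefl P j m := by
  obtain ⟨i', k', h1, h2⟩ := (exists_mapsAff w.2).1 j m
  have h3 : aff P i' k' = aff P i k := by
    funext x
    have e1 := h1 (act P w⁻¹ x)
    have e2 := h (act P w⁻¹ x)
    rw [act_act_inv] at e2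
    rw [e2, ← e1]
    congr 1
    exact (act_act_inv w x).symm
  obtain ⟨rfl, rfl⟩ := aff_injective h3
  refine act_injective fun x => ?_
  rw [act_mul, act_mul, act_affRefl, act_affRefl, h, sub_eq_add_neg, sub_eq_add_neg, ← neg_smul,
    ← neg_smul]
  exact (h2 x _).symm

/-! ### Separating hyperplanes -/

/-- A point that lies on no reflection hyperplane. -/
def IsRegular (P : RootPairing ι ℝ V N) (x : V) : Prop := ∀ f ∈ affRoots P, f x ≠ 0

/-- The affine roots that separate two points. -/
def sep (P : RootPairing ι ℝ V N) (x y : V) : Set (V → ℝ) := {f ∈ affRoots P | 0 < f x ∧ f y < 0}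

lemma sep_finite [Finite ι] (x y : V) : (sep P x y).Finite := by
  have h : (⋃ i : ι, (fun k : ℤ => aff P i k) '' Set.Icc ⌊P.coroot' i y⌋ ⌈P.coroot' i x⌉).Finite :=
    Set.finite_iUnion fun i => (Set.finite_Icc _ _).image _
  refine h.subset ?_
  rintro _ ⟨⟨i, k, rfl⟩, h1, h2⟩
  refine Set.mem_iUnion.2 ⟨i, k, ⟨?_, ?_⟩, rfl⟩
  · simp only [aff] at h1 h2
    exact Int.floor_le_iff.2 (by linarith)
  · simp only [aff] at h1 h2
    exact Int.le_ceil_iff.2 (by linarith)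

lemma IsRegular.act [P.IsCrystallographic] {x : V} (hx : IsRegular P x) (w : affineWeyl P) :
    IsRegular P (act P w x) :=
  fun _ hf => hx _ (comp_act_mem w hf)

lemma ncard_sep_act [P.IsCrystallographic] (w : affineWeyl P) (x y : V) :
    (sep P (act P w x) (act P w y)).ncard = (sep P x y).ncard := by
  have hinj : Function.Injective fun (f : V → ℝ) x => f (act P w x) := fun f g h => by
    funext x
    have := congrFun h (act P w⁻¹ x)
    simpa only [act_act_inv] using this
  rw [← Set.ncard_image_of_injective _ hinj]
  congr 1
  ext f
  constructor
  · rintro ⟨g, ⟨hg, h⟩, rfl⟩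
    exact ⟨comp_act_mem w hg, h⟩
  · rintro ⟨hf, h⟩
    refine ⟨fun x => f (act P w⁻¹ x), ⟨comp_act_mem _ hf, ?_⟩, ?_⟩
    · simpa only [act_inv_act] using h
    · simp only [act_inv_act]

lemma ncard_sep_comm (x y : V) : (sep P x y).ncard = (sep P y x).ncard := by
  rw [← Set.ncard_image_of_injective _ (neg_injective (G := V → ℝ))]
  congr 1
  ext f
  constructor
  · rintro ⟨g, ⟨hg, h1, h2⟩, rfl⟩
    exact ⟨neg_mem_affRoots hg, by simpa using h2, by simpa using h1⟩
  · rintro ⟨hf, h1, h2⟩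
    exact ⟨-f, ⟨neg_mem_affRoots hf, by simpa using h2, by simpa using h1⟩, neg_neg f⟩

/-- The hypothesis says that no hyperplane is crossed on the way from x to y and crossed back from y
to z. Applied to -f, it shows that an affine root positive at y and negative at z is already
positive at x. -/
lemma ncard_sep_add [Finite ι] {x y z : V} (hx : IsRegular P x) (hy : IsRegular P y)
    (h : ∀ f ∈ affRoots P, 0 < f x → f y < 0 → f z < 0) :
    (sep P x z).ncard = (sep P x y).ncard + (sep P y z).ncard := by
  rw [← Set.ncard_union_eq ?_ (sep_finite x y) (sep_finite y z)]
  · congr 1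
    ext f
    constructor
    · rintro ⟨hf, h1, h2⟩
      rcases lt_or_gt_of_ne (hy f hf) with h3 | h3
      · exact Or.inl ⟨hf, h1, h3⟩
      · exact Or.inr ⟨hf, h3, h2⟩
    · rintro (⟨hf, h1, h2⟩ | ⟨hf, h1, h2⟩)
      · exact ⟨hf, h1, h f hf h1 h2⟩
      · refine ⟨hf, ?_, h2⟩
        by_contra h3
        have h4 := lt_of_le_of_ne (not_lt.1 h3) (hx f hf)
        have := h (-f) (neg_mem_affRoots hf) (by simpa using h4) (by simpa using h1)
        simp only [Pi.neg_apply] at this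
        linarith
  · rw [Set.disjoint_left]
    rintro f ⟨_, _, h1⟩ ⟨_, h2, _⟩
    linarith

end AffineRoots

/-! ### Cells -/

section Cells

variable {ι V N : Type*} [AddCommGroup V] [Module ℝ V] [AddCommGroup N] [Module ℝ N]
  {P : RootPairing ι ℝ V N}

/-- The set of points that lie on the same side as `a` of all hyperplanes not containing `a`. -/
def cell (P : RootPairing ι ℝ V N) (a : V) : Set V := {x | ∀ f ∈ affRoots P, 0 < f a → 0 < f x}

/-- The closed cell of `a`. -/
def closedCell (P : RootPairing ι ℝ V N) (a : V) : Set V :=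
  {x | ∀ f ∈ affRoots P, 0 < f a → 0 ≤ f x}

lemma self_mem_cell (a : V) : a ∈ cell P a := fun _ _ h => h

lemma neg_of_mem_cell {a x : V} (hx : x ∈ cell P a) {f : V → ℝ} (hf : f ∈ affRoots P)
    (h : f a < 0) : f x < 0 := by
  have := hx (-f) (neg_mem_affRoots hf) (by simpa using h)
  simpa using this

lemma nonpos_of_mem_closedCell {a x : V} (hx : x ∈ closedCell P a) {f : V → ℝ}
    (hf : f ∈ affRoots P) (h : f a < 0) : f x ≤ 0 := by
  have := hx (-f) (neg_mem_affRoots hf) (by simpa using h)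
  simpa using this

lemma cell_eq_of_mem {a x : V} (ha : IsRegular P a) (hx : x ∈ cell P a) :
    cell P x = cell P a := by
  ext y
  refine ⟨fun hy f hf h => hy f hf (hx f hf h), fun hy f hf h => hy f hf ?_⟩
  by_contra h'
  have := neg_of_mem_cell hx hf (lt_of_le_of_ne (not_lt.1 h') (ha f hf))
  linarith

lemma mem_cell_of_sep_eq_empty {a x : V} (hx : IsRegular P x) (h : sep P a x = ∅) :
    x ∈ cell P a := by
  intro f hf hfa
  by_contra hfx
  have : f ∈ sep P a x := ⟨hf, hfa, lt_of_le_of_ne (not_lt.1 hfx) (hx f hf)⟩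
  rw [h] at this
  exact this

lemma sep_eq_empty_of_mem_cell {a x : V} (h : x ∈ cell P a) : sep P a x = ∅ := by
  refine Set.eq_empty_of_forall_notMem fun f hf => ?_
  have h1 := h f hf.1 hf.2.1
  have h2 := hf.2.2
  linarith

lemma actSet_cell [P.IsCrystallographic] (w : affineWeyl P) (a : V) :
    actSet P w (cell P a) = cell P (act P w a) := by
  ext x
  constructor
  · rintro ⟨y, hy, rfl⟩ f hf h
    exact hy _ (comp_act_mem w hf) h
  · intro hx
    refine ⟨act P w⁻¹ x, fun f hf h => ?_, act_act_inv w x⟩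
    exact hx _ (comp_act_mem w⁻¹ hf) (by simpa only [act_inv_act] using h)

lemma act_mem_closedCell [P.IsCrystallographic] (w : affineWeyl P) {a x : V}
    (hx : x ∈ closedCell P a) : act P w x ∈ closedCell P (act P w a) :=
  fun _ hf h => hx _ (comp_act_mem w hf) h

variable (b : P.Base)

lemma isPos_or_neg (i : ι) : b.IsPos i ∨ b.IsPos (P.reflectionPerm i i) :=
  RootPairing.Base.IsPos.or_neg b i

/-- An affine root is, up to sign, the affine root of a positive root. -/
lemma affRoots_cases {p : (V → ℝ) → Prop} (hpos : ∀ i k, b.IsPos i → p (aff P i k))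
    (hneg : ∀ i k, b.IsPos i → p (-aff P i k)) {f : V → ℝ} (hf : f ∈ affRoots P) : p f := by
  obtain ⟨i, k, rfl⟩ := hf
  rcases isPos_or_neg b i with h | h
  · exact hpos i k h
  · have := hneg _ (-k) h
    rwa [aff_neg, neg_neg] at this

/-- The set `{x | n_α < ⟨x, α^∨⟩ < n_α + 1 for all α > 0}`. -/
def box (n : ι → ℤ) : Set V :=
  {x | ∀ i, b.IsPos i → (n i : ℝ) < P.coroot' i x ∧ P.coroot' i x < n i + 1}

/-- The set `{x | n_α ≤ ⟨x, α^∨⟩ ≤ n_α + 1 for all α > 0}`. -/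
def closedBox (n : ι → ℤ) : Set V :=
  {x | ∀ i, b.IsPos i → (n i : ℝ) ≤ P.coroot' i x ∧ P.coroot' i x ≤ n i + 1}

lemma fundAlcove_eq_box : fundAlcove b = box b 0 := by
  simp only [fundAlcove, box, Pi.zero_apply, Int.cast_zero, zero_add]

lemma fundAlcoveClosure_eq_closedBox : fundAlcoveClosure b = closedBox b 0 := by
  simp only [fundAlcoveClosure, closedBox, Pi.zero_apply, Int.cast_zero, zero_add]

variable {b}

lemma mem_alcoves_iff {A : Set V} : A ∈ alcoves b ↔ A.Nonempty ∧ ∃ n, A = box b n := Iff.rfl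

lemma isRegular_of_mem_box {n : ι → ℤ} {a : V} (ha : a ∈ box b n) : IsRegular P a := by
  have key (i : ι) (k : ℤ) (hi : b.IsPos i) : aff P i k a ≠ 0 := by
    intro h
    rw [aff, sub_eq_zero] at h
    have h1 := (ha i hi).1
    have h2 := (ha i hi).2
    rw [h] at h1 h2
    have h3 : n i < k := by exact_mod_cast h1
    have h4 : k < n i + 1 := by exact_mod_cast h2
    omega
  intro f hf
  refine affRoots_cases b (p := fun f => f a ≠ 0) key (fun i k hi => ?_) hf
  simpa using key i k hi

lemma closedBox_subset_closedCell {n : ι → ℤ} {a : V} (ha : a ∈ box b n) :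
    closedBox b n ⊆ closedCell P a := by
  intro x hx f hf
  refine affRoots_cases b (p := fun f => 0 < f a → 0 ≤ f x) (fun i k hi h => ?_)
    (fun i k hi h => ?_) hf
  · have h1 := (ha i hi).2
    have h2 := (hx i hi).1
    simp only [aff] at h ⊢
    have h3 : (k : ℝ) < n i + 1 := by linarith
    have h4 : k < n i + 1 := by exact_mod_cast h3
    have h5 : (k : ℝ) ≤ n i := by exact_mod_cast (by omega : k ≤ n i)
    linarith
  · have h1 := (ha i hi).1
    have h2 := (hx i hi).2
    simp only [aff, Pi.neg_apply] at h ⊢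
    have h3 : (n i : ℝ) < k := by linarith
    have h4 : n i < k := by exact_mod_cast h3
    have h5 : (n i : ℝ) + 1 ≤ k := by exact_mod_cast (by omega : n i + 1 ≤ k)
    linarith

lemma box_eq_cell {n : ι → ℤ} {a : V} (ha : a ∈ box b n) : box b n = cell P a := by
  ext x
  constructor
  · intro hx f hf h
    have h1 := closedBox_subset_closedCell ha
      (fun i hi => ⟨(hx i hi).1.le, (hx i hi).2.le⟩) f hf h
    exact lt_of_le_of_ne h1 (isRegular_of_mem_box hx f hf).symm
  · intro hx i hi
    have h1 := hx _ (aff_mem i (n i)) (by rw [aff]; linarith [(ha i hi).1])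
    have h2 := neg_of_mem_cell hx (aff_mem i (n i + 1)) (by
      rw [aff]; push_cast; linarith [(ha i hi).2])
    simp only [aff] at h1 h2
    push_cast at h2
    exact ⟨by linarith, by linarith⟩

lemma closedBox_eq_closedCell {n : ι → ℤ} {a : V} (ha : a ∈ box b n) :
    closedBox b n = closedCell P a := by
  refine (closedBox_subset_closedCell ha).antisymm fun x hx i hi => ?_
  have h1 := hx _ (aff_mem i (n i)) (by rw [aff]; linarith [(ha i hi).1])
  have h2 := nonpos_of_mem_closedCell hx (aff_mem i (n i + 1)) (by
    rw [aff]; push_cast; linarith [(ha i hi).2])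
  simp only [aff] at h1 h2
  push_cast at h2
  exact ⟨by linarith, by linarith⟩

lemma cell_eq_box {a : V} (ha : IsRegular P a) :
    cell P a = box b fun i => ⌊P.coroot' i a⌋ := by
  refine (box_eq_cell fun i _ => ⟨lt_of_le_of_ne (Int.floor_le _) fun h => ?_,
    Int.lt_floor_add_one _⟩).symm
  refine ha _ (aff_mem i ⌊P.coroot' i a⌋) ?_
  rw [aff, h, sub_self]

lemma cell_mem_alcoves {a : V} (ha : IsRegular P a) : cell P a ∈ alcoves b :=
  ⟨⟨a, self_mem_cell a⟩, _, cell_eq_box ha⟩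

lemma fundAlcove_eq_cell {a : V} (ha : a ∈ fundAlcove b) : fundAlcove b = cell P a := by
  rw [fundAlcove_eq_box] at ha ⊢
  exact box_eq_cell ha

lemma fundAlcoveClosure_eq_closedCell {a : V} (ha : a ∈ fundAlcove b) :
    fundAlcoveClosure b = closedCell P a := by
  rw [fundAlcove_eq_box] at ha
  rw [fundAlcoveClosure_eq_closedBox, closedBox_eq_closedCell ha]

lemma isRegular_of_mem_fundAlcove {a : V} (ha : a ∈ fundAlcove b) : IsRegular P a := by
  rw [fundAlcove_eq_box] at ha
  exact isRegular_of_mem_box ha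

end Cells

/-! ### Walls -/

section Walls

variable {ι V N : Type*} [Finite ι] [AddCommGroup V] [Module ℝ V] [AddCommGroup N] [Module ℝ N]
  {P : RootPairing ι ℝ V N}

/-- The witness is the part of `P.root j` killed by `P.coroot' i`. The coroot of j takes on it the
value 2 minus half the Coxeter weight, and the weight 4 occurs only for proportional roots, which in
a reduced system are equal or opposite. -/
lemma exists_coroot'_eq_zero_ne_zero [P.IsCrystallographic] [P.IsReduced] {i j : ι} (hij : j ≠ i)
    (hij' : j ≠ P.reflectionPerm i i) : ∃ q, P.coroot' i q = 0 ∧ P.coroot' j q ≠ 0 := by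
  refine ⟨P.root j - (P.pairing j i / 2) • P.root i, ?_, ?_⟩
  · rw [map_sub, map_smul, coroot'_root_self, P.root_coroot'_eq_pairing, smul_eq_mul]
    ring
  · rw [map_sub, map_smul, coroot'_root_self, P.root_coroot'_eq_pairing, smul_eq_mul]
    have h1 : LinearIndependent ℝ ![P.root j, P.root i] := by
      refine RootPairing.IsReduced.linearIndependent P hij fun h => hij' (P.root.injective ?_)
      rw [P.root_reflectionPerm, P.reflection_apply_self, h]
    have h2 := P.linearIndependent_iff_coxeterWeight_ne_four.1 h1
    rw [RootPairing.coxeterWeight] at h2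
    intro h3
    exact h2 (by linarith)

omit [Finite ι] in
lemma aff_neg' (i : ι) (k : ℤ) : aff P (P.reflectionPerm i i) k = -aff P i (-k) := by
  rw [← aff_neg, neg_neg]

lemma eq_or_eq_neg_of_hyperplane_eq [P.IsCrystallographic] [P.IsReduced] {i j : ι} {k m : ℤ}
    {x : V} (hx : x ∈ hyperplane P i k) (h : hyperplane P j m = hyperplane P i k) :
    aff P j m = aff P i k ∨ aff P j m = -aff P i k := by
  have hx1 : P.coroot' i x = k := hx
  have hx2 : P.coroot' j x = m := by
    have := hx
    rw [← h] at this
    exact this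
  by_cases h1 : j = i
  · left
    subst h1
    have : (m : ℝ) = k := by rw [← hx2, hx1]
    rw [Int.cast_inj.1 this]
  by_cases h2 : j = P.reflectionPerm i i
  · right
    subst h2
    rw [coroot'_neg] at hx2
    have : ((-m : ℤ) : ℝ) = k := by push_cast; linarith
    rw [aff_neg', Int.cast_inj.1 this]
  · obtain ⟨q, hq1, hq2⟩ := exists_coroot'_eq_zero_ne_zero h1 h2
    have h3 : x + q ∈ hyperplane P i k := by
      change P.coroot' i (x + q) = k
      rw [map_add, hq1, hx1, add_zero]
    rw [← h] at h3
    have h4 : P.coroot' j (x + q) = m := h3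
    rw [map_add, hx2] at h4
    exact absurd (by linarith) hq2

/-- `f` is an affine root that defines a wall of the cell of `a`. -/
def IsWallRoot (P : RootPairing ι ℝ V N) (a : V) (f : V → ℝ) : Prop :=
  f ∈ affRoots P ∧ 0 < f a ∧ ∃ x ∈ closedCell P a, f x = 0 ∧
    ∀ g ∈ affRoots P, 0 < g a → g x = 0 → g = f

lemma isWall_iff [P.IsCrystallographic] [P.IsReduced] {b : P.Base} {a : V}
    (ha : a ∈ fundAlcove b) {i : ι} {k : ℤ} :
    IsWall b i k ↔ IsWallRoot P a (aff P i k) ∨ IsWallRoot P a (-aff P i k) := by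
  have hreg := isRegular_of_mem_fundAlcove ha
  rw [IsWall, fundAlcoveClosure_eq_closedCell ha]
  constructor
  · rintro ⟨x, hx, hxi, h⟩
    have h0 : aff P i k x = 0 := sub_eq_zero.2 hxi
    have key : ∀ g ∈ affRoots P, g x = 0 → g = aff P i k ∨ g = -aff P i k := by
      rintro _ ⟨j, m, rfl⟩ hg
      exact eq_or_eq_neg_of_hyperplane_eq hxi (h j m (sub_eq_zero.1 hg))
    rcases lt_or_gt_of_ne (hreg _ (aff_mem i k)) with h1 | h1
    · refine Or.inr ⟨neg_mem_affRoots (aff_mem i k), by simpa using h1, x, hx, by simpa using h0,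
        fun g hg hga hgx => ?_⟩
      rcases key g hg hgx with rfl | rfl
      · linarith
      · rfl
    · refine Or.inl ⟨aff_mem i k, h1, x, hx, h0, fun g hg hga hgx => ?_⟩
      rcases key g hg hgx with rfl | rfl
      · rfl
      · simp only [Pi.neg_apply] at hga; linarith
  · have key (f : V → ℝ) (hf : f = aff P i k ∨ f = -aff P i k) (h : IsWallRoot P a f) :
        ∃ x ∈ closedCell P a, x ∈ hyperplane P i k ∧
        ∀ j m, x ∈ hyperplane P j m → hyperplane P j m = hyperplane P i k := by
      obtain ⟨hfΦ, hfa, x, hx, hfx, h⟩ := h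
      have hyp (j : ι) (m : ℤ) : hyperplane P j m = {y | aff P j m y = 0} := by
        ext y
        exact sub_eq_zero.symm
      have hyp' : hyperplane P i k = {y | f y = 0} := by
        rw [hyp]
        rcases hf with rfl | rfl
        · rfl
        · simp
      refine ⟨x, hx, by rw [hyp']; exact hfx, fun j m hj => ?_⟩
      rw [hyp, Set.mem_ofPred_eq] at hj
      rw [hyp']
      rcases lt_or_gt_of_ne (hreg _ (aff_mem j m)) with h1 | h1
      · rw [← h _ (neg_mem_affRoots (aff_mem j m)) (by simpa using h1) (by simpa using hj), hyp]
        simp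
      · rw [← h _ (aff_mem j m) h1 hj, hyp]
    rintro (h | h)
    · exact key _ (Or.inl rfl) h
    · exact key _ (Or.inr rfl) h

/-- The simple reflections are the reflections in the walls of the fundamental alcove. -/
lemma mem_simpleRefl_iff [P.IsCrystallographic] [P.IsReduced] {b : P.Base} {a : V}
    (ha : a ∈ fundAlcove b) {s : affineWeyl P} :
    s ∈ simpleRefl b ↔ ∃ i k, IsWallRoot P a (aff P i k) ∧ s = affRefl P i k := by
  constructor
  · rintro ⟨i, k, hw, hs⟩
    rw [← eq_affRefl_iff] at hs
    rcases (isWall_iff ha).1 hw with h | h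
    · exact ⟨i, k, h, hs⟩
    · refine ⟨P.reflectionPerm i i, -k, ?_, ?_⟩
      · rwa [aff_neg]
      · rw [affRefl_neg, hs]
  · rintro ⟨i, k, hw, hs⟩
    exact ⟨i, k, (isWall_iff ha).2 (Or.inl hw), eq_affRefl_iff.1 hs⟩

-- For small ε the coroots change by less than the distance to the next integer, so strict signs of
-- affine roots persist, and those vanishing at x become nonzero because q is off their kernel.
open Filter Topology in
lemma eventually_perturb (x q : V) (hx : ∀ i, P.coroot' i q ≠ 0 ∨ ∀ k : ℤ, P.coroot' i x ≠ k) :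
    ∀ᶠ ε : ℝ in 𝓝[>] 0, IsRegular P (x + ε • q) ∧
      ∀ f ∈ affRoots P, (0 < f x → 0 < f (x + ε • q)) := by
  have hc (i : ι) (k : ℤ) (ε : ℝ) : aff P i k (x + ε • q) = aff P i k x + ε * P.coroot' i q := by
    simp only [aff, map_add, map_smul, smul_eq_mul]
    ring
  have htend (i : ι) : Tendsto (fun ε : ℝ => ε * P.coroot' i q) (𝓝[>] 0) (𝓝 0) := by
    have : Tendsto (fun ε : ℝ => ε * P.coroot' i q) (𝓝 0) (𝓝 (0 * P.coroot' i q)) :=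
      (continuous_id.mul continuous_const).tendsto 0
    rw [zero_mul] at this
    exact this.mono_left nhdsWithin_le_nhds
  have h1 (i : ι) : ∀ᶠ ε : ℝ in 𝓝[>] 0,
      (⌈P.coroot' i x⌉ : ℝ) - 1 < P.coroot' i x + ε * P.coroot' i q ∧
      P.coroot' i x + ε * P.coroot' i q < ⌊P.coroot' i x⌋ + 1 := by
    have ha : (⌈P.coroot' i x⌉ : ℝ) - 1 - P.coroot' i x < 0 := by
      linarith [Int.ceil_lt_add_one (P.coroot' i x)]
    have hb : (0 : ℝ) < ⌊P.coroot' i x⌋ + 1 - P.coroot' i x := by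
      linarith [Int.lt_floor_add_one (P.coroot' i x)]
    filter_upwards [(htend i).eventually (lt_mem_nhds ha), (htend i).eventually (gt_mem_nhds hb)]
      with ε h1 h2
    exact ⟨by linarith, by linarith⟩
  have hpos : ∀ᶠ ε : ℝ in 𝓝[>] 0, 0 < ε := eventually_mem_nhdsWithin
  filter_upwards [eventually_all.2 h1, hpos] with ε hε hε0
  have hsgn : ∀ f ∈ affRoots P, 0 < f x → 0 < f (x + ε • q) := by
    rintro _ ⟨i, k, rfl⟩ h
    rw [hc]
    simp only [aff] at h ⊢
    have h2 : k < ⌈P.coroot' i x⌉ := Int.lt_ceil.2 (by linarith)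
    have h3 : (k : ℝ) ≤ ⌈P.coroot' i x⌉ - 1 := by exact_mod_cast (by omega)
    linarith [(hε i).1]
  refine ⟨?_, hsgn⟩
  intro f hf
  rcases lt_trichotomy (f x) 0 with h | h | h
  · have := hsgn (-f) (neg_mem_affRoots hf) (by simpa using h)
    simp only [Pi.neg_apply] at this
    linarith
  · obtain ⟨i, k, rfl⟩ := hf
    rw [hc, h, zero_add]
    rcases hx i with h' | h'
    · exact mul_ne_zero hε0.ne' h'
    · exact absurd (sub_eq_zero.1 h) (h' k)
  · exact (hsgn f hf h).ne'

/-- The segment from a to y meets the zero sets of two affine roots f and g at the same time when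
f(a) g(y) = g(a) f(y). The form here is the linear part in y of the difference of the two sides. -/
lemma lin_ne_zero [P.IsCrystallographic] [P.IsReduced] {a : V} {i j : ι} {k m : ℤ}
    (hi : 0 < aff P i k a) (hj : 0 < aff P j m a) (hne : aff P i k ≠ aff P j m) :
    ∃ q, (aff P i k a • P.coroot' j - aff P j m a • P.coroot' i) q ≠ 0 := by
  simp only [LinearMap.sub_apply, LinearMap.smul_apply, smul_eq_mul]
  by_cases h1 : j = i
  · subst h1
    refine ⟨P.root j, ?_⟩
    rw [coroot'_root_self]
    have h2 : aff P j k a - aff P j m a ≠ 0 := by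
      intro h
      simp only [aff, sub_sub_sub_cancel_left, sub_eq_zero] at h
      exact hne (by rw [Int.cast_inj.1 h])
    intro h
    exact h2 (by linarith)
  by_cases h2 : j = P.reflectionPerm i i
  · refine ⟨P.root i, ?_⟩
    nth_rw 1 [h2]
    rw [coroot'_neg, coroot'_root_self]
    linarith
  · obtain ⟨q, h3, h4⟩ := exists_coroot'_eq_zero_ne_zero h1 h2
    refine ⟨q, ?_⟩
    rw [h3, mul_zero, sub_zero]
    exact mul_ne_zero hi.ne' h4

open Filter Topology in
/-- A regular point outside a cell is separated from it by one of its walls. -/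
theorem exists_wall [P.IsCrystallographic] [P.IsReduced] {a b₀ : V} (hb : IsRegular P b₀)
    (hne : (sep P a b₀).Nonempty) : ∃ f, IsWallRoot P a f ∧ f b₀ < 0 := by
  classical
  have hfin := sep_finite (P := P) a b₀
  have hF (f : sep P a b₀) : ∃ i k, (f : V → ℝ) = aff P i k := f.2.1
  choose idx lev hidx using hF
  let I := {p : sep P a b₀ × sep P a b₀ // p.1 ≠ p.2}
  have : Finite (sep P a b₀) := hfin
  have : Finite I := inferInstance
  let φ : I → Module.Dual ℝ V := fun p =>
    (p.1.1 : V → ℝ) a • P.coroot' (idx p.1.2) - (p.1.2 : V → ℝ) a • P.coroot' (idx p.1.1)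
  -- Moving the endpoint in a generic direction makes the segment from a cross the separating
  -- hyperplanes at pairwise different times.
  obtain ⟨q, hq⟩ := Module.Dual.exists_forall_ne_zero_of_forall_exists φ fun p => by
    have h1 := p.1.1.2.2.1
    have h2 := p.1.2.2.2.1
    have h3 : (p.1.1 : V → ℝ) ≠ p.1.2 := fun h => p.2 (Subtype.ext h)
    simp only [φ]
    rw [hidx p.1.1, hidx p.1.2] at h3
    rw [hidx p.1.1] at h1
    rw [hidx p.1.2] at h2
    rw [hidx p.1.1, hidx p.1.2]
    exact lin_ne_zero h1 h2 h3
  have hval (f : sep P a b₀) (ε : ℝ) : (f : V → ℝ) (b₀ + ε • q) =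
      (f : V → ℝ) b₀ + ε * P.coroot' (idx f) q := by
    rw [hidx f]
    simp only [aff, map_add, map_smul, smul_eq_mul]
    ring
  have hI (p : I) : ∀ᶠ ε : ℝ in 𝓝[>] 0, (p.1.1 : V → ℝ) a * (p.1.2 : V → ℝ) (b₀ + ε • q) ≠
      (p.1.2 : V → ℝ) a * (p.1.1 : V → ℝ) (b₀ + ε • q) := by
    set c : ℝ := (p.1.1 : V → ℝ) a * (p.1.2 : V → ℝ) b₀ - (p.1.2 : V → ℝ) a * (p.1.1 : V → ℝ) b₀
      with hc
    have h1 : ∀ᶠ ε : ℝ in 𝓝[>] 0, ε ≠ -c / φ p q := by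
      by_cases h0 : -c / φ p q = 0
      · rw [h0]
        filter_upwards [self_mem_nhdsWithin] with ε hε
        exact ne_of_gt hε
      · exact (eventually_ne_nhds (Ne.symm h0)).filter_mono nhdsWithin_le_nhds
    filter_upwards [h1] with ε hε h
    refine hε ?_
    rw [eq_div_iff (hq p)]
    simp only [φ, LinearMap.sub_apply, LinearMap.smul_apply, smul_eq_mul]
    rw [hval, hval] at h
    rw [hc]
    linear_combination h
  obtain ⟨ε, ⟨hreg, hsgn⟩, hgen⟩ := ((eventually_perturb b₀ q fun i => Or.inr fun k h =>
    hb _ (aff_mem i k) (sub_eq_zero.2 h)).and (eventually_all.2 hI)).exists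
  set b₁ := b₀ + ε • q
  have hcell : b₁ ∈ cell P b₀ := hsgn
  have hsep {f : V → ℝ} (hf : f ∈ affRoots P) (hfa : 0 < f a) (hfb : f b₁ < 0) :
      f ∈ sep P a b₀ := by
    refine ⟨hf, hfa, ?_⟩
    by_contra h
    have := hcell f hf (lt_of_le_of_ne (not_lt.1 h) (hb f hf).symm)
    linarith
  have hsep' (f : sep P a b₀) : (f : V → ℝ) b₁ < 0 := neg_of_mem_cell hcell f.2.1 f.2.2.2
  -- The time at which the segment crosses the hyperplane of f. The hyperplane crossed first is a
  -- wall, with the crossing point as witness.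
  let τ : sep P a b₀ → ℝ := fun f => (f : V → ℝ) a / ((f : V → ℝ) a - (f : V → ℝ) b₁)
  have : Nonempty (sep P a b₀) := hne.to_subtype
  obtain ⟨f, hf⟩ := Finite.exists_min τ
  have hfa := f.2.2.1
  have hfb := hsep' f
  have hd : 0 < (f : V → ℝ) a - (f : V → ℝ) b₁ := by linarith
  have hτ0 : 0 < τ f := div_pos hfa hd
  have hτ1 : τ f < 1 := (div_lt_one hd).2 (by linarith)
  have hτf : τ f * ((f : V → ℝ) a - (f : V → ℝ) b₁) = (f : V → ℝ) a := div_mul_cancel₀ _ hd.ne'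
  have hpt (g : V → ℝ) (hg : g ∈ affRoots P) :
      g (AffineMap.lineMap a b₁ (τ f)) = g a - τ f * (g a - g b₁) := by
    rw [aff_lineMap hg]; ring
  have hle (g : sep P a b₀) : τ f * ((g : V → ℝ) a - (g : V → ℝ) b₁) ≤ (g : V → ℝ) a := by
    have h1 := hf g
    have h2 : 0 < (g : V → ℝ) a - (g : V → ℝ) b₁ := by linarith [g.2.2.1, hsep' g]
    have h3 : τ g * ((g : V → ℝ) a - (g : V → ℝ) b₁) = (g : V → ℝ) a := div_mul_cancel₀ _ h2.ne'
    exact (mul_le_mul_of_nonneg_right h1 h2.le).trans h3.le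
  have hout (g : V → ℝ) (hg : g ∈ affRoots P) (hga : 0 < g a) (hgb : 0 < g b₁) :
      0 < g (AffineMap.lineMap a b₁ (τ f)) := by
    rw [aff_lineMap hg]
    have := mul_pos (sub_pos.2 hτ1) hga
    have := mul_pos hτ0 hgb
    linarith
  refine ⟨f, ⟨f.2.1, hfa, AffineMap.lineMap a b₁ (τ f), fun g hg hga => ?_, ?_,
    fun g hg hga hgx => ?_⟩, f.2.2.2⟩
  · rcases lt_or_gt_of_ne (hreg g hg) with h | h
    · rw [hpt g hg]
      have := hle ⟨g, hsep hg hga h⟩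
      simp only at this
      linarith
    · exact (hout g hg hga h).le
  · rw [hpt f f.2.1, hτf, sub_self]
  · rcases lt_or_gt_of_ne (hreg g hg) with h | h
    · by_contra hgf
      let g' : sep P a b₀ := ⟨g, hsep hg hga h⟩
      refine hgen ⟨(f, g'), fun h => hgf (congrArg Subtype.val h).symm⟩ ?_
      rw [hpt g hg] at hgx
      change (f : V → ℝ) a * g b₁ = g a * (f : V → ℝ) b₁
      have h2 : (τ f - 1) ≠ 0 := by linarith
      have h3 : (1 - τ f) * ((f : V → ℝ) a * g b₁ - g a * (f : V → ℝ) b₁) = 0 := by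
        have e1 : g a = τ f * (g a - g b₁) := by linarith
        have e2 : (f : V → ℝ) a * (1 - τ f) = -τ f * (f : V → ℝ) b₁ := by linarith
        have e3 : g a * (1 - τ f) = -τ f * g b₁ := by linarith
        calc _ = ((f : V → ℝ) a * (1 - τ f)) * g b₁ - (g a * (1 - τ f)) * (f : V → ℝ) b₁ := by ring
          _ = 0 := by rw [e2, e3]; ring
      rcases mul_eq_zero.1 h3 with h4 | h4
      · exact absurd (by linarith) h2
      · linarith
    · have := hout g hg hga h
      linarith

end Walls

/-! ### The affine Weyl group as a Coxeter group -/

section Generation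

variable {ι V N : Type*} [Finite ι] [AddCommGroup V] [Module ℝ V] [AddCommGroup N] [Module ℝ N]
  {P : RootPairing ι ℝ V N} [P.IsCrystallographic]

omit [Finite ι] in
/-- A wall separates a cell from its mirror image, and nothing else does. -/
lemma sep_affRefl {a : V} {i : ι} {k : ℤ} (h : IsWallRoot P a (aff P i k)) :
    sep P a (act P (affRefl P i k) a) = {aff P i k} := by
  obtain ⟨hf, hfa, x, hx, hfx, hu⟩ := h
  ext g
  constructor
  · rintro ⟨hg, hga, hgs⟩
    refine hu g hg hga (le_antisymm ?_ (hx g hg hga))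
    have h1 := hx _ (neg_mem_affRoots (comp_act_mem (affRefl P i k) hg)) (by simpa using hgs)
    simp only [Pi.neg_apply, act_affRefl_eq_self hfx] at h1
    linarith
  · rintro rfl
    exact ⟨hf, hfa, by rw [aff_act_affRefl]; linarith⟩

/-- Go from a to its mirror image and on to that of y: the first piece crosses only the wall, and
the second does not cross it again. -/
lemma ncard_sep_affRefl_of_pos {a y : V} (ha : IsRegular P a) {i : ι} {k : ℤ}
    (h : IsWallRoot P a (aff P i k)) (hy : 0 < aff P i k y) :
    (sep P a (act P (affRefl P i k) y)).ncard = (sep P a y).ncard + 1 := by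
  rw [ncard_sep_add ha (ha.act (affRefl P i k)), ncard_sep_act, sep_affRefl h,
    Set.ncard_singleton, add_comm]
  intro g hg h1 h2
  have h3 : g ∈ sep P a (act P (affRefl P i k) a) := ⟨hg, h1, h2⟩
  rw [sep_affRefl h, Set.mem_singleton_iff] at h3
  rw [h3, aff_act_affRefl]
  linarith

omit [Finite ι] [P.IsCrystallographic] in
lemma act_affRefl_act_affRefl (i : ι) (k : ℤ) (x : V) :
    act P (affRefl P i k) (act P (affRefl P i k) x) = x := by
  rw [← act_mul, affRefl_mul_self, act_one]

lemma ncard_sep_affRefl_of_neg {a y : V} (ha : IsRegular P a) {i : ι} {k : ℤ}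
    (h : IsWallRoot P a (aff P i k)) (hy : aff P i k y < 0) :
    (sep P a y).ncard = (sep P a (act P (affRefl P i k) y)).ncard + 1 := by
  have := ncard_sep_affRefl_of_pos ha h (y := act P (affRefl P i k) y) (by
    rw [aff_act_affRefl]; linarith)
  rwa [act_affRefl_act_affRefl] at this

variable [P.IsReduced]

lemma exists_generic_mem_hyperplane (i : ι) (k : ℤ) : ∃ p, aff P i k p = 0 ∧
    ∀ j, j ≠ i → j ≠ P.reflectionPerm i i → ∀ m : ℤ, P.coroot' j p ≠ m := by
  obtain ⟨q, hq, hq'⟩ := Module.Dual.exists_forall_mem_ne_zero_of_forall_exists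
    (LinearMap.ker (P.coroot' i)) (ι := {j // j ≠ i ∧ j ≠ P.reflectionPerm i i})
    (fun j => P.coroot' j) (fun j => by
      obtain ⟨q, h1, h2⟩ := exists_coroot'_eq_zero_ne_zero j.2.1 j.2.2
      exact ⟨q, h1, h2⟩)
  rw [LinearMap.mem_ker] at hq
  let p₀ : V := ((k : ℝ) / 2) • P.root i
  -- The countably many parameters for which a hyperplane not parallel to the given one contains the
  -- point.
  let B : Set ℝ := ⋃ (j : ι) (m : ℤ), {((m : ℝ) - P.coroot' j p₀) / P.coroot' j q}
  have hB : B.Countable :=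
    Set.countable_iUnion fun _ => Set.countable_iUnion fun _ => Set.countable_singleton _
  obtain ⟨ε, hε⟩ : ∃ ε, ε ∉ B := by
    by_contra! h
    exact Set.not_countable_univ (hB.mono fun x _ => h x)
  refine ⟨p₀ + ε • q, ?_, fun j h1 h2 m hm => hε ?_⟩
  · simp only [aff, p₀, map_add, map_smul, hq, coroot'_root_self, smul_eq_mul]
    ring
  · refine Set.mem_iUnion₂.2 ⟨j, m, ?_⟩
    have h3 : P.coroot' j q ≠ 0 := hq' ⟨j, h1, h2⟩
    rw [Set.mem_singleton_iff, eq_div_iff h3, ← hm, map_add, add_sub_cancel_left,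
      map_smul, smul_eq_mul]

variable {b : P.Base} {a : V} (ha : a ∈ fundAlcove b)

include ha

/-- Reflecting y in a wall that separates it from a lowers the number of separating hyperplanes by
one. -/
lemma exists_mem_closure_act_mem_cell {y : V} (hy : IsRegular P y) :
    ∃ w ∈ Subgroup.closure (simpleRefl b), act P w y ∈ cell P a := by
  have hreg := isRegular_of_mem_fundAlcove ha
  induction hn : (sep P a y).ncard generalizing y with
  | zero =>
    rw [Set.ncard_eq_zero (sep_finite a y)] at hn
    exact ⟨1, one_mem _, mem_cell_of_sep_eq_empty hy hn⟩
  | succ n ih =>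
    obtain ⟨f, hf, hfy⟩ := exists_wall hy (Set.nonempty_of_ncard_ne_zero (by rw [hn]; simp))
    obtain ⟨i, k, rfl⟩ := hf.1
    have h1 := ncard_sep_affRefl_of_neg hreg hf hfy
    obtain ⟨w, hw, hwy⟩ := ih (hy.act (affRefl P i k)) (by omega)
    exact ⟨w * affRefl P i k, mul_mem hw (Subgroup.subset_closure
      ((mem_simpleRefl_iff ha).2 ⟨i, k, hf, rfl⟩)), hwy⟩

-- Take a generic point p of the hyperplane and a regular point y next to it. Products of simple
-- reflections move y into the fundamental alcove, and the same element moves p to a point on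
-- exactly one wall. So the reflection is conjugate to a simple one.
open Filter Topology in
lemma affRefl_mem_closure (i : ι) (k : ℤ) :
    affRefl P i k ∈ Subgroup.closure (simpleRefl b) := by
  have hreg := isRegular_of_mem_fundAlcove ha
  obtain ⟨p, hp, hgen⟩ := exists_generic_mem_hyperplane (P := P) i k
  obtain ⟨ε, ⟨hy, hsgn⟩, hε⟩ := ((eventually_perturb (P := P) p (P.root i) fun j => by
    by_cases h1 : j = i
    · left; rw [h1, coroot'_root_self]; norm_num
    by_cases h2 : j = P.reflectionPerm i i
    · left; rw [h2, coroot'_neg, coroot'_root_self]; norm_num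
    · exact Or.inr (hgen j h1 h2)).and (eventually_mem_nhdsWithin (s := Set.Ioi (0 : ℝ)))).exists
  set y := p + ε • P.root i with hydef
  have hfy : 0 < aff P i k y := by
    have : aff P i k y = aff P i k p + ε * 2 := by
      simp only [aff, hydef, map_add, map_smul, coroot'_root_self, smul_eq_mul]
      ring
    rw [this, hp]
    have : 0 < ε := hε
    linarith
  obtain ⟨w, hw, hwy⟩ := exists_mem_closure_act_mem_cell ha hy
  obtain ⟨j, m, hjm⟩ := comp_act_mem w⁻¹ (aff_mem (P := P) i k)
  have hcomp (x : V) : aff P j m (act P w x) = aff P i k x := by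
    rw [← hjm]
    simp only [act_inv_act]
  have hside {g : V → ℝ} (hg : g ∈ affRoots P) (h : 0 < g (act P w y)) : 0 < g a := by
    by_contra h'
    have := neg_of_mem_cell hwy hg (lt_of_le_of_ne (not_lt.1 h') (hreg g hg))
    linarith
  have hwall : IsWallRoot P a (aff P j m) := by
    refine ⟨aff_mem j m, hside (aff_mem j m) (by rwa [hcomp]), act P w p, fun g hg hga => ?_,
      by rw [hcomp, hp], fun g hg hga hgp => ?_⟩
    · by_contra h
      have h1 := hsgn _ (neg_mem_affRoots (comp_act_mem w hg)) (by simpa using h)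
      have h2 := hwy g hg hga
      simp only [Pi.neg_apply] at h1
      linarith
    · obtain ⟨j', m', hj'⟩ := comp_act_mem w hg
      have hgw (x : V) : g (act P w x) = aff P j' m' x := congrFun hj' x
      have h0 : P.coroot' j' p = m' := by
        rw [hgw] at hgp
        exact sub_eq_zero.1 hgp
      have hp' : P.coroot' i p = k := sub_eq_zero.1 hp
      by_cases h1 : j' = i
      · subst h1
        have : m' = k := by exact_mod_cast (h0.symm.trans hp')
        subst this
        funext x
        rw [← act_act_inv w x, hcomp, hgw]
      by_cases h2 : j' = P.reflectionPerm i i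
      · subst h2
        rw [coroot'_neg, hp'] at h0
        have : m' = -k := by exact_mod_cast h0.symm
        subst this
        have h3 := hwy g hg hga
        rw [hgw, aff_neg, Pi.neg_apply] at h3
        linarith
      · exact absurd h0 (hgen j' h1 h2 m')
  have h1 := affRefl_mul_of_comp_eq hcomp
  have h2 : affRefl P i k = w⁻¹ * (affRefl P j m * w) := by rw [h1, inv_mul_cancel_left]
  rw [h2]
  exact mul_mem (inv_mem hw) (mul_mem (Subgroup.subset_closure
    ((mem_simpleRefl_iff ha).2 ⟨j, m, hwall, rfl⟩)) hw)

lemma closure_simpleRefl : Subgroup.closure (simpleRefl b) = ⊤ := by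
  have key (g : V ≃ᵃ[ℝ] V) (hg : g ∈ affineWeyl P) :
      (⟨g, hg⟩ : affineWeyl P) ∈ Subgroup.closure (simpleRefl b) := by
    induction hg using Subgroup.closure_induction with
    | mem x hx =>
      rcases hx with ⟨i, rfl⟩ | ⟨i, rfl⟩
      · convert affRefl_mem_closure ha i 0
        refine act_injective fun x => ?_
        rw [act_affRefl, aff, Int.cast_zero, sub_zero]
        rfl
      · convert mul_mem (affRefl_mem_closure ha i 1) (affRefl_mem_closure ha i 0)
        refine act_injective fun x => ?_
        rw [act_mul, act_affRefl i 1, act_affRefl]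
        change P.root i + x = _
        simp only [aff, map_sub, map_smul, coroot'_root_self, Int.cast_zero, sub_zero,
          Int.cast_one, smul_eq_mul]
        module
    | one => exact one_mem _
    | mul x y hx hy h1 h2 => exact mul_mem h1 h2
    | inv x hx h => exact inv_mem h
  exact eq_top_iff.2 fun w _ => key w w.2

lemma mul_self_of_mem_simpleRefl {s : affineWeyl P} (hs : s ∈ simpleRefl b) : s * s = 1 := by
  obtain ⟨i, k, -, rfl⟩ := (mem_simpleRefl_iff ha).1 hs
  exact affRefl_mul_self i k

lemma exists_list_prod (w : affineWeyl P) : ∃ l : List (affineWeyl P),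
    (∀ s ∈ l, s ∈ simpleRefl b) ∧ l.prod = w := by
  have hw : w ∈ Subgroup.closure (simpleRefl b) := by
    rw [closure_simpleRefl ha]; trivial
  induction hw using Subgroup.closure_induction with
  | mem s hs => exact ⟨[s], by simpa using hs, by simp⟩
  | one => exact ⟨[], by simp, rfl⟩
  | mul x y _ _ hx hy =>
    obtain ⟨l, hl, rfl⟩ := hx
    obtain ⟨l', hl', rfl⟩ := hy
    refine ⟨l ++ l', fun s hs => ?_, List.prod_append⟩
    exact (List.mem_append.1 hs).elim (hl s) (hl' s)
  | inv x _ hx =>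
    obtain ⟨l, hl, rfl⟩ := hx
    refine ⟨(l.map fun s => s⁻¹).reverse, fun s hs => ?_, (List.prod_inv_reverse l).symm⟩
    rw [List.mem_reverse, List.mem_map] at hs
    obtain ⟨t, ht, rfl⟩ := hs
    rw [inv_eq_of_mul_eq_one_left (mul_self_of_mem_simpleRefl ha (hl t ht))]
    exact hl t ht

/-- A word in the simple reflections that crosses a hyperplane can be shortened. -/
lemma exists_shorter_list {i : ι} {k : ℤ} (l : List (affineWeyl P))
    (hl : ∀ s ∈ l, s ∈ simpleRefl b) (p : affineWeyl P) (h1 : 0 < aff P i k (act P p a))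
    (h2 : aff P i k (act P (p * l.prod) a) < 0) :
    ∃ l' : List (affineWeyl P), (∀ s ∈ l', s ∈ simpleRefl b) ∧ l'.length + 1 = l.length ∧
      affRefl P i k * p * l.prod = p * l'.prod := by
  have hreg := isRegular_of_mem_fundAlcove ha
  induction l generalizing p with
  | nil =>
    rw [List.prod_nil, mul_one] at h2
    linarith
  | cons s l ih =>
    have hs := hl s (by simp)
    have hl' : ∀ t ∈ l, t ∈ simpleRefl b := fun t ht => hl t (by simp [ht])
    rw [List.prod_cons, ← mul_assoc] at h2
    rcases lt_or_gt_of_ne (hreg.act (p * s) _ (aff_mem i k)) with h | h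
    · refine ⟨l, hl', by simp, ?_⟩
      obtain ⟨j, m, hw, rfl⟩ := (mem_simpleRefl_iff ha).1 hs
      have h3 : (fun x => aff P i k (act P p x)) ∈ sep P a (act P (affRefl P j m) a) :=
        ⟨comp_act_mem p (aff_mem i k), h1, h⟩
      rw [sep_affRefl hw, Set.mem_singleton_iff] at h3
      rw [affRefl_mul_of_comp_eq (congrFun h3), List.prod_cons, mul_assoc,
        ← mul_assoc _ _ l.prod, affRefl_mul_self, one_mul]
    · obtain ⟨l', h3, h4, h5⟩ := ih hl' (p * s) h h2
      refine ⟨s :: l', fun t ht => ?_, by simp [h4], ?_⟩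
      · rcases List.mem_cons.1 ht with rfl | ht
        · exact hs
        · exact h3 t ht
      · rw [List.prod_cons, List.prod_cons, ← mul_assoc p, ← h5]
        group

/-- The first letter of a word for w crosses a wall of the fundamental alcove, and the gallery has
to cross it back. Deleting both letters leaves a shorter word for the same element. -/
lemma eq_one_of_act_mem_cell {w : affineWeyl P} (hw : act P w a ∈ cell P a) : w = 1 := by
  obtain ⟨l, hl, rfl⟩ := exists_list_prod ha w
  induction hn : l.length using Nat.strong_induction_on generalizing l with
  | _ n ih =>
    cases l with
    | nil => rfl
    | cons s l =>
      have hs := hl s (by simp)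
      obtain ⟨i, k, hwall, rfl⟩ := (mem_simpleRefl_iff ha).1 hs
      obtain ⟨l', h1, h2, h3⟩ := exists_shorter_list ha (i := P.reflectionPerm i i) (k := -k) l
        (fun t ht => hl t (by simp [ht])) (affRefl P i k)
        (by rw [aff_neg, Pi.neg_apply, aff_act_affRefl]; simpa using hwall.2.1)
        (by
          rw [aff_neg, Pi.neg_apply, neg_lt_zero, ← List.prod_cons]
          exact hw _ hwall.1 hwall.2.1)
      rw [affRefl_neg, affRefl_mul_self, one_mul] at h3
      have h4 : (affRefl P i k :: l).prod = l'.prod := by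
        rw [List.prod_cons, h3, ← mul_assoc, affRefl_mul_self, one_mul]
      rw [h4] at hw ⊢
      rw [List.length_cons] at hn
      exact ih l'.length (by omega) l' h1 hw rfl

lemma exists_list_length_eq (w : affineWeyl P) : ∃ l : List (affineWeyl P),
    (∀ s ∈ l, s ∈ simpleRefl b) ∧ l.prod = w ∧ l.length = (sep P a (act P w a)).ncard := by
  have hreg := isRegular_of_mem_fundAlcove ha
  induction hn : (sep P a (act P w a)).ncard generalizing w with
  | zero =>
    rw [Set.ncard_eq_zero (sep_finite _ _)] at hn
    exact ⟨[], by simp, (eq_one_of_act_mem_cell ha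
      (mem_cell_of_sep_eq_empty (hreg.act w) hn)).symm, rfl⟩
  | succ n ih =>
    obtain ⟨f, hf, hfy⟩ := exists_wall (hreg.act w)
      (Set.nonempty_of_ncard_ne_zero (by rw [hn]; simp))
    obtain ⟨i, k, rfl⟩ := hf.1
    have h1 := ncard_sep_affRefl_of_neg hreg hf hfy
    obtain ⟨l, h2, h3, h4⟩ := ih (affRefl P i k * w) (by rw [act_mul]; omega)
    refine ⟨affRefl P i k :: l, fun t ht => ?_, ?_, by simp [h4]⟩
    · rcases List.mem_cons.1 ht with rfl | ht
      · exact (mem_simpleRefl_iff ha).2 ⟨i, k, hf, rfl⟩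
      · exact h2 t ht
    · rw [List.prod_cons, h3, ← mul_assoc, affRefl_mul_self, one_mul]

/-- The length of `w` is the number of hyperplanes that separate the fundamental alcove from its
image under `w`. -/
theorem length_eq_ncard_sep (w : affineWeyl P) :
    length (simpleRefl b) w = (sep P a (act P w a)).ncard := by
  have hreg := isRegular_of_mem_fundAlcove ha
  have hle (l : List (affineWeyl P)) (hl : ∀ s ∈ l, s ∈ simpleRefl b) :
      (sep P a (act P l.prod a)).ncard ≤ l.length := by
    induction l with
    | nil =>
      rw [List.prod_nil, act_one, sep_eq_empty_of_mem_cell (self_mem_cell a), Set.ncard_empty]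
      exact Nat.zero_le _
    | cons s l ih =>
      have h1 := ih fun t ht => hl t (by simp [ht])
      obtain ⟨i, k, hwall, rfl⟩ := (mem_simpleRefl_iff ha).1 (hl s (by simp))
      rw [List.prod_cons, act_mul, List.length_cons]
      rcases lt_or_gt_of_ne (hreg.act l.prod _ (aff_mem i k)) with h | h
      · have := ncard_sep_affRefl_of_neg hreg hwall h
        omega
      · have := ncard_sep_affRefl_of_pos hreg hwall h
        omega
  refine le_antisymm (Nat.sInf_le (exists_list_length_eq ha w)) ?_
  refine le_csInf ⟨_, exists_list_length_eq ha w⟩ ?_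
  rintro n ⟨l, hl, rfl, rfl⟩
  exact hle l hl

lemma length_affRefl_mul_of_pos {i : ι} {k : ℤ} (h : IsWallRoot P a (aff P i k))
    {w : affineWeyl P} (hw : 0 < aff P i k (act P w a)) :
    length (simpleRefl b) (affRefl P i k * w) = length (simpleRefl b) w + 1 := by
  rw [length_eq_ncard_sep ha, length_eq_ncard_sep ha, act_mul,
    ncard_sep_affRefl_of_pos (isRegular_of_mem_fundAlcove ha) h hw]

lemma length_affRefl_mul_of_neg {i : ι} {k : ℤ} (h : IsWallRoot P a (aff P i k))
    {w : affineWeyl P} (hw : aff P i k (act P w a) < 0) :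
    length (simpleRefl b) w = length (simpleRefl b) (affRefl P i k * w) + 1 := by
  rw [length_eq_ncard_sep ha, length_eq_ncard_sep ha, act_mul,
    ncard_sep_affRefl_of_neg (isRegular_of_mem_fundAlcove ha) h hw]

theorem isCoxeterLike_simpleRefl : IsCoxeterLike (simpleRefl b) := by
  have hreg := isRegular_of_mem_fundAlcove ha
  refine ⟨fun s hs => mul_self_of_mem_simpleRefl ha hs, fun w => ?_, fun s hs w => ?_,
    fun s hs t ht w h1 h2 => ?_, fun w hw => ?_⟩
  · rw [length_eq_ncard_sep ha, length_eq_ncard_sep ha, ← ncard_sep_act w, act_act_inv,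
      ncard_sep_comm]
  · obtain ⟨i, k, hwall, rfl⟩ := (mem_simpleRefl_iff ha).1 hs
    rcases lt_or_gt_of_ne (hreg.act w _ (aff_mem i k)) with h | h
    · exact Or.inr (length_affRefl_mul_of_neg ha hwall h)
    · exact Or.inl (length_affRefl_mul_of_pos ha hwall h)
  · obtain ⟨i, k, hwall, rfl⟩ := (mem_simpleRefl_iff ha).1 hs
    obtain ⟨j, m, hwall', rfl⟩ := (mem_simpleRefl_iff ha).1 ht
    have h3 : 0 < aff P i k (act P w a) := by
      by_contra h
      have := length_affRefl_mul_of_neg ha hwall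
        (lt_of_le_of_ne (not_lt.1 h) (hreg.act w _ (aff_mem i k)))
      omega
    have h4 : aff P i k (act P (w * affRefl P j m) a) < 0 := by
      by_contra h
      have := length_affRefl_mul_of_pos ha hwall
        (lt_of_le_of_ne (not_lt.1 h) (hreg.act (w * affRefl P j m) _ (aff_mem i k)).symm)
      rw [← mul_assoc] at this
      omega
    -- The lengths show that the wall of s separates the adjacent alcoves of w and wt, so it is
    -- their common wall.
    have h5 : (fun x => aff P i k (act P w x)) ∈ sep P a (act P (affRefl P j m) a) :=
      ⟨comp_act_mem w (aff_mem i k), h3, h4⟩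
    rw [sep_affRefl hwall', Set.mem_singleton_iff] at h5
    exact affRefl_mul_of_comp_eq (congrFun h5)
  · have hne : (sep P a (act P w a)).Nonempty := by
      rw [Set.nonempty_iff_ne_empty]
      exact fun h => hw (eq_one_of_act_mem_cell ha (mem_cell_of_sep_eq_empty (hreg.act w) h))
    obtain ⟨f, hf, hfy⟩ := exists_wall (hreg.act w) hne
    obtain ⟨i, k, rfl⟩ := hf.1
    exact ⟨_, (mem_simpleRefl_iff ha).2 ⟨i, k, hf, rfl⟩, length_affRefl_mul_of_neg ha hf hfy⟩

end Generation

/-! ### Positive coroots and `ρ` -/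

section Positive

variable {ι V N : Type*} [Finite ι] [AddCommGroup V] [Module ℝ V] [AddCommGroup N] [Module ℝ N]
  {P : RootPairing ι ℝ V N} [P.IsCrystallographic] [P.IsReduced] {b : P.Base}

omit [Finite ι] [P.IsCrystallographic] [P.IsReduced] in
lemma not_isPos_neg {i : ι} (hi : b.IsPos i) : ¬ b.IsPos (P.reflectionPerm i i) := by
  have := RootPairing.Base.IsPos.neg_iff_not b i
  exact fun h => this.1 h hi

/-- Positivity is defined through roots but is needed for coroots. The generation of positive roots
by simple reflections can be followed on both sides. -/
lemma isPos_flip {i : ι} (hi : b.IsPos i) : b.flip.IsPos i := by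
  refine hi.induction_on_reflect (p := fun i => b.IsPos i → b.flip.IsPos i)
    (fun i hi _ => b.flip.isPos_of_mem_support hi) (fun i j ih hj h => ?_) hi
  by_cases hij : i = j
  · subst hij
    exact absurd h (not_isPos_neg (b.isPos_of_mem_support hj))
  by_cases hij' : P.reflectionPerm j i = j
  · rw [hij']
    exact b.flip.isPos_of_mem_support hj
  · have h1 := h.reflectionPerm hj hij'
    rw [P.reflectionPerm_self] at h1
    exact (ih h1).reflectionPerm (b := b.flip) hj hij

lemma isPos_coroot_induction {i : ι} (hi : b.IsPos i) {p : ι → Prop} (h₁ : ∀ i ∈ b.support, p i)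
    (h₂ : ∀ i j k, (∀ x, P.coroot' k x = P.coroot' i x + P.coroot' j x) → p i →
      j ∈ b.support → p k) : p i := by
  refine (isPos_flip hi).induction_on_add h₁ fun i j k h => h₂ i j k fun x => ?_
  have h' : P.coroot k = P.coroot i + P.coroot j := h
  simp only [RootPairing.coroot', LinearMap.flip_apply, h', map_add, LinearMap.add_apply]

lemma coroot'_pos_of_support {x : V} (hx : ∀ j ∈ b.support, 0 < P.coroot' j x) {i : ι}
    (hi : b.IsPos i) : 0 < P.coroot' i x :=
  isPos_coroot_induction hi hx fun i j k h hi hj => by rw [h]; exact add_pos hi (hx j hj)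

lemma coroot'_le_of_support {x y : V} (hx : ∀ j ∈ b.support, P.coroot' j x ≤ P.coroot' j y) {i : ι}
    (hi : b.IsPos i) : P.coroot' i x ≤ P.coroot' i y :=
  isPos_coroot_induction hi hx fun i j k h hi hj => by
    rw [h, h]; exact add_le_add hi (hx j hj)

/-- A point with integral coordinates. -/
def IsInt (P : RootPairing ι ℝ V N) (x : V) : Prop := ∀ i, ∃ k : ℤ, P.coroot' i x = k

lemma isInt_of_support {x : V} (hx : ∀ j ∈ b.support, ∃ k : ℤ, P.coroot' j x = k) : IsInt P x := by
  have key {i : ι} (hi : b.IsPos i) : ∃ k : ℤ, P.coroot' i x = k :=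
    isPos_coroot_induction hi hx fun i j l h hi hj => by
      obtain ⟨k, hk⟩ := hi
      obtain ⟨m, hm⟩ := hx j hj
      exact ⟨k + m, by rw [h, hk, hm, Int.cast_add]⟩
  intro i
  rcases isPos_or_neg b i with h | h
  · exact key h
  · obtain ⟨k, hk⟩ := key h
    rw [coroot'_neg] at hk
    exact ⟨-k, by rw [Int.cast_neg, ← hk, neg_neg]⟩

omit [Finite ι] [P.IsReduced] in
lemma isInt_act {x : V} (hx : IsInt P x) (w : affineWeyl P) : IsInt P (act P w x) := by
  intro i
  obtain ⟨j, m, h⟩ := comp_act_mem w (aff_mem (P := P) i 0)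
  obtain ⟨k, hk⟩ := hx j
  have h1 : aff P i 0 (act P w x) = aff P j m x := congrFun h x
  simp only [aff, hk, Int.cast_zero, sub_zero] at h1
  exact ⟨k - m, by rw [h1]; push_cast; rfl⟩

/-- The simple reflection permutes the positive roots other than its own and negates the pairing
with `P.coroot j`, so these roots contribute zero to the sum and only `P.root j` itself counts. -/
lemma coroot'_rho {j : ι} (hj : j ∈ b.support) : P.coroot' j (rho b) = 1 := by
  classical
  have := Fintype.ofFinite ι
  have hjpos := b.isPos_of_mem_support hj
  have h1 : rho b = (1 / 2 : ℝ) • ∑ i with b.IsPos i, P.root i := by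
    rw [rho, finsum_cond_eq_sum_of_cond_iff]
    intro i _
    simp
  have h2 : ∑ i ∈ Finset.univ.filter b.IsPos, P.coroot' j (P.root i) =
      2 + ∑ i ∈ (Finset.univ.filter b.IsPos).erase j, P.coroot' j (P.root i) := by
    rw [← Finset.add_sum_erase _ _ (by simpa using hjpos : j ∈ Finset.univ.filter b.IsPos),
      coroot'_root_self]
  have hmem (i : ι) (hi : i ∈ (Finset.univ.filter b.IsPos).erase j) :
      P.reflectionPerm j i ∈ (Finset.univ.filter b.IsPos).erase j := by
    simp only [Finset.mem_erase, Finset.mem_filter, Finset.mem_univ, true_and] at hi ⊢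
    refine ⟨fun h => ?_, hi.2.reflectionPerm hj hi.1⟩
    have h3 : i = P.reflectionPerm j j :=
      (P.reflectionPerm_self j i).symm.trans (congrArg _ h)
    rw [h3] at hi
    exact not_isPos_neg hjpos hi.2
  have h3 : ∑ i ∈ (Finset.univ.filter b.IsPos).erase j, P.coroot' j (P.root i) =
      ∑ i ∈ (Finset.univ.filter b.IsPos).erase j, -P.coroot' j (P.root i) := by
    refine Finset.sum_bij (fun i _ => P.reflectionPerm j i) hmem
      (fun i _ k _ h => (P.reflectionPerm j).injective h)
      (fun i hi => ⟨_, hmem i hi, P.reflectionPerm_self j i⟩) fun i _ => ?_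
    rw [P.root_reflectionPerm, P.coroot'_reflection, coroot'_neg, neg_neg]
  rw [Finset.sum_neg_distrib] at h3
  rw [h1, map_smul, map_sum, h2, smul_eq_mul]
  linarith

lemma isInt_rho : IsInt P (rho b) :=
  isInt_of_support fun j hj => ⟨1, by rw [coroot'_rho hj, Int.cast_one]⟩

lemma one_le_coroot'_rho {i : ι} (hi : b.IsPos i) : 1 ≤ P.coroot' i (rho b) := by
  have h1 : 0 < P.coroot' i (rho b) :=
    coroot'_pos_of_support (fun j hj => by rw [coroot'_rho hj]; norm_num) hi
  obtain ⟨k, hk⟩ := isInt_rho (b := b) i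
  rw [hk] at h1 ⊢
  exact_mod_cast h1

/-- A sufficiently small positive multiple of ρ lies in the alcove. -/
lemma fundAlcove_nonempty : (fundAlcove b).Nonempty := by
  obtain ⟨M, hM⟩ := (Set.finite_range fun i => P.coroot' i (rho b)).bddAbove
  have hM' (i : ι) : P.coroot' i (rho b) ≤ M := hM ⟨i, rfl⟩
  refine ⟨(|M| + 1)⁻¹ • rho b, fun i hi => ?_⟩
  have h0 : 0 < |M| + 1 := by positivity
  have h1 := one_le_coroot'_rho hi
  have h2 := hM' i
  rw [map_smul, smul_eq_mul]
  refine ⟨mul_pos (inv_pos.2 h0) (by linarith), ?_⟩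
  rw [inv_mul_lt_iff₀ h0]
  linarith [le_abs_self M]

/-- The simple roots define walls of the fundamental alcove. -/
lemma isWallRoot_of_mem_support {a : V} (ha : a ∈ fundAlcove b) {i : ι} (hi : i ∈ b.support) :
    IsWallRoot P a (aff P i 0) := by
  have hipos := b.isPos_of_mem_support hi
  -- The midpoint of a and its mirror image. On x, any other positive coroot is the average of the
  -- values at a of two positive coroots, hence strictly between 0 and 1.
  set x : V := a - (P.coroot' i a / 2) • P.root i with hx
  have hxi : P.coroot' i x = 0 := by
    rw [hx, map_sub, map_smul, coroot'_root_self, smul_eq_mul]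
    ring
  have hxj {j : ι} (hj : b.IsPos j) (hij : j ≠ i) : 0 < P.coroot' j x ∧ P.coroot' j x < 1 := by
    have h1 := ha j hj
    have h2 := ha _ (hj.reflectionPerm hi hij)
    have h3 : P.coroot' (P.reflectionPerm i j) a = P.coroot' j a
        - P.coroot' i a * P.coroot' j (P.root i) := by
      rw [← P.coroot'_reflection, P.reflection_apply, map_sub, map_smul, smul_eq_mul]
    have h4 : P.coroot' j x = (P.coroot' j a + P.coroot' (P.reflectionPerm i j) a) / 2 := by
      rw [h3, hx, map_sub, map_smul, smul_eq_mul]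
      ring
    rw [h4]
    constructor <;> linarith
  refine ⟨aff_mem i 0, ?_, x, ?_, ?_, fun g hg => ?_⟩
  · rw [aff, Int.cast_zero, sub_zero]
    exact (ha i hipos).1
  · rw [← fundAlcoveClosure_eq_closedCell ha]
    intro j hj
    by_cases hij : j = i
    · rw [hij, hxi]; norm_num
    · exact ⟨(hxj hj hij).1.le, (hxj hj hij).2.le⟩
  · rw [aff, hxi, Int.cast_zero, sub_zero]
  · have key (j : ι) (m : ℤ) (hj : b.IsPos j) (h : aff P j m x = 0) : j = i ∧ m = 0 := by
      rw [aff, sub_eq_zero] at h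
      by_cases hij : j = i
      · subst hij
        rw [hxi] at h
        exact ⟨rfl, by exact_mod_cast h.symm⟩
      · have h1 := hxj hj hij
        rw [h] at h1
        have h2 : 0 < m := by exact_mod_cast h1.1
        have h3 : m < 1 := by exact_mod_cast h1.2
        omega
    refine affRoots_cases b (p := fun g => 0 < g a → g x = 0 → g = aff P i 0)
      (fun j m hj _ h => ?_) (fun j m hj h1 h2 => ?_) hg
    · obtain ⟨rfl, rfl⟩ := key j m hj h
      rfl
    · obtain ⟨rfl, rfl⟩ := key j m hj (by simpa using h2)
      have h3 := (ha j hj).1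
      simp only [aff, Int.cast_zero, sub_zero, Pi.neg_apply] at h1
      linarith

omit [Finite ι] [P.IsCrystallographic] [P.IsReduced] in
lemma mem_simpleReflFin_iff {s : affineWeyl P} :
    s ∈ simpleReflFin b ↔ ∃ i ∈ b.support, s = affRefl P i 0 := by
  refine exists_congr fun i => and_congr_right fun _ => ?_
  rw [eq_affRefl_iff]
  simp only [Int.cast_zero, sub_zero, P.reflection_apply]

lemma simpleReflFin_subset : simpleReflFin b ⊆ simpleRefl b := by
  obtain ⟨a, ha⟩ := fundAlcove_nonempty (b := b)
  intro s hs
  obtain ⟨i, hi, rfl⟩ := mem_simpleReflFin_iff.1 hs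
  exact (mem_simpleRefl_iff ha).2 ⟨i, 0, isWallRoot_of_mem_support ha hi, rfl⟩

end Positive

/-! ### Alcoves and elements of the affine Weyl group -/

section AlcoveElements

variable {ι V N : Type*} [Finite ι] [AddCommGroup V] [Module ℝ V] [AddCommGroup N] [Module ℝ N]
  {P : RootPairing ι ℝ V N} [P.IsCrystallographic] [P.IsReduced] {b : P.Base}
  {a : V} (ha : a ∈ fundAlcove b)

omit [Finite ι] [P.IsReduced] in
lemma actSet_fundAlcove (ha : a ∈ fundAlcove b) (w : affineWeyl P) :
    actSet P w (fundAlcove b) = cell P (act P w a) := by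
  rw [fundAlcove_eq_cell ha, actSet_cell]

include ha

lemma eq_of_act_mem_cell {w w' : affineWeyl P} (h : act P w a ∈ cell P (act P w' a)) : w = w' := by
  rw [← actSet_cell] at h
  obtain ⟨y, hy, hyw⟩ := h
  have h1 : act P (w'⁻¹ * w) a = y := by rw [act_mul, ← hyw, act_inv_act]
  rw [← h1] at hy
  have := eq_one_of_act_mem_cell ha hy
  exact (inv_mul_eq_one.1 this).symm

lemma bijOn_actSet : Set.BijOn (fun w => actSet P w (fundAlcove b)) Set.univ (alcoves b) := by
  have hreg := isRegular_of_mem_fundAlcove ha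
  refine ⟨fun w _ => ?_, fun w _ w' _ h => ?_, fun A hA => ?_⟩
  · dsimp only
    rw [actSet_fundAlcove ha]
    exact cell_mem_alcoves (hreg.act w)
  · dsimp only at h
    rw [actSet_fundAlcove ha, actSet_fundAlcove ha] at h
    exact eq_of_act_mem_cell ha (by rw [← h]; exact self_mem_cell _)
  · obtain ⟨⟨c, hc⟩, n, rfl⟩ := mem_alcoves_iff.1 hA
    have hcreg := isRegular_of_mem_box hc
    obtain ⟨w, -, hw⟩ := exists_mem_closure_act_mem_cell ha hcreg
    refine ⟨w⁻¹, trivial, ?_⟩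
    dsimp only
    rw [fundAlcove_eq_cell ha, ← cell_eq_of_mem hreg hw, actSet_cell, act_inv_act, box_eq_cell hc]

lemma actSet_alcoveElt {A : Set V} (hA : A ∈ alcoves b) :
    actSet P (alcoveElt b A) (fundAlcove b) = A := by
  obtain ⟨w, -, hw⟩ := (bijOn_actSet ha).surjOn hA
  exact Classical.epsilon_spec (p := fun w => actSet P w (fundAlcove b) = A) ⟨w, hw⟩

lemma act_alcoveElt_mem {A : Set V} (hA : A ∈ alcoves b) : act P (alcoveElt b A) a ∈ A := by
  rw [← actSet_alcoveElt ha hA]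
  nth_rw 2 [actSet_alcoveElt ha hA]
  exact ⟨a, ha, rfl⟩

/-- A point in the closure of the fundamental alcove is fixed by every element that maps it to such
a point. -/
lemma act_eq_of_mem_closedCell {θ : V} (hθ : θ ∈ closedCell P a) {w : affineWeyl P}
    (hw : act P w θ ∈ closedCell P a) : act P w θ = θ := by
  have hS := isCoxeterLike_simpleRefl ha
  have hreg := isRegular_of_mem_fundAlcove ha
  induction hn : length (simpleRefl b) w using Nat.strong_induction_on generalizing w with
  | _ n ih =>
    by_cases h1 : w = 1
    · rw [h1, act_one]
    obtain ⟨s, hs, hlt⟩ := hS.exists_descent w h1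
    obtain ⟨i, k, hwall, rfl⟩ := (mem_simpleRefl_iff ha).1 hs
    have h2 : aff P i k (act P w a) < 0 := by
      by_contra h
      have := length_affRefl_mul_of_pos ha hwall
        (lt_of_le_of_ne (not_lt.1 h) (hreg.act w _ (aff_mem i k)).symm)
      omega
    -- The wall of a left descent separates a from w a, while w θ is in the closed cells of both. So
    -- w θ lies on the wall and the descent can be removed.
    have h3 : aff P i k (act P w θ) = 0 :=
      le_antisymm (nonpos_of_mem_closedCell (act_mem_closedCell w hθ) (aff_mem i k) h2)
        (hw _ hwall.1 hwall.2.1)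
    have h4 : act P (affRefl P i k * w) θ = act P w θ := by
      rw [act_mul, act_affRefl_eq_self h3]
    rw [← h4]
    exact ih _ (by omega) (by rwa [h4]) rfl

lemma length_affRefl_mul_lt {i : ι} {k : ℤ} {w : affineWeyl P} (h1 : 0 < aff P i k a)
    (h2 : aff P i k (act P w a) < 0) :
    length (simpleRefl b) (affRefl P i k * w) < length (simpleRefl b) w := by
  obtain ⟨l, hl, rfl, hlen⟩ := exists_list_length_eq ha w
  obtain ⟨l', hl', hlen', h3⟩ := exists_shorter_list ha l hl 1 h1 (by rwa [one_mul])
  rw [mul_one, one_mul] at h3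
  rw [h3, length_eq_ncard_sep ha l.prod, ← hlen, ← hlen']
  exact Nat.lt_succ_of_le (Nat.sInf_le ⟨l', hl', rfl, rfl⟩)

lemma length_mul_of_sep {w w' : affineWeyl P}
    (h : ∀ f ∈ affRoots P, 0 < f a → f (act P w a) < 0 → f (act P (w * w') a) < 0) :
    length (simpleRefl b) (w * w') = length (simpleRefl b) w + length (simpleRefl b) w' := by
  have hreg := isRegular_of_mem_fundAlcove ha
  rw [length_eq_ncard_sep ha, length_eq_ncard_sep ha, length_eq_ncard_sep ha,
    ncard_sep_add hreg (hreg.act w) h, act_mul, ncard_sep_act]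

lemma eq_of_sep_subset {w w' : affineWeyl P}
    (h : sep P a (act P w a) = sep P a (act P w' a)) : w = w' := by
  have hreg := isRegular_of_mem_fundAlcove ha
  refine eq_of_act_mem_cell ha (mem_cell_of_sep_eq_empty (hreg.act w) ?_)
  refine Set.eq_empty_of_forall_notMem fun f hf => ?_
  rcases lt_or_gt_of_ne (hreg f hf.1) with h1 | h1
  · have : -f ∈ sep P a (act P w' a) :=
      ⟨neg_mem_affRoots hf.1, by simpa using h1, by simpa using hf.2.1⟩
    rw [← h] at this
    have := this.2.2
    simp only [Pi.neg_apply] at this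
    linarith [hf.2.2]
  · have : f ∈ sep P a (act P w a) := ⟨hf.1, h1, hf.2.2⟩
    rw [h] at this
    linarith [hf.2.1, this.2.2]

end AlcoveElements

/-! ### Isotropy groups -/

section Isotropy

variable {ι V N : Type*} [Finite ι] [AddCommGroup V] [Module ℝ V] [AddCommGroup N] [Module ℝ N]
  {P : RootPairing ι ℝ V N} [P.IsCrystallographic] [P.IsReduced] {b : P.Base}
  {a : V} (ha : a ∈ fundAlcove b)

/-- The isotropy group of a point. -/
def stab (P : RootPairing ι ℝ V N) (θ : V) : Subgroup (affineWeyl P) where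
  carrier := {w | act P w θ = θ}
  mul_mem' {w w'} (h : act P w θ = θ) (h' : act P w' θ = θ) := by
    change act P (w * w') θ = θ
    rw [act_mul, h', h]
  one_mem' := act_one θ
  inv_mem' {w} (h : act P w θ = θ) := by
    change act P w⁻¹ θ = θ
    nth_rw 1 [← h]
    exact act_inv_act w θ

omit [Finite ι] [P.IsCrystallographic] [P.IsReduced] in
lemma mem_stab_iff {θ : V} {w : affineWeyl P} : w ∈ stab P θ ↔ act P w θ = θ := Iff.rfl

/-- `z` lies on the same side as the fundamental alcove of all hyperplanes through `θ`. -/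
def IsNear (P : RootPairing ι ℝ V N) (a θ : V) (z : affineWeyl P) : Prop :=
  ∀ f ∈ affRoots P, f θ = 0 → 0 < f a → 0 < f (act P z a)

omit [Finite ι] [P.IsReduced] in
lemma eq_zero_of_mem_sep {θ : V} (hθ : θ ∈ closedCell P a) {t : affineWeyl P}
    (ht : t ∈ stab P θ) {f : V → ℝ} (hf : f ∈ sep P a (act P t a)) : f θ = 0 := by
  refine le_antisymm ?_ (hθ f hf.1 hf.2.1)
  have := nonpos_of_mem_closedCell (act_mem_closedCell t hθ) hf.1 hf.2.2
  rwa [mem_stab_iff.1 ht] at this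

include ha

/-- All hyperplanes that separate a from t a pass through θ. As z a is on the same side as a of the
hyperplanes through θ, none of them is crossed back between t a and tz a. -/
lemma IsNear.isMinCoset {θ : V} (hθ : θ ∈ closedCell P a) {z : affineWeyl P}
    (hz : IsNear P a θ z) : IsMinCoset (simpleRefl b) (stab P θ) z := by
  intro t ht
  refine length_mul_of_sep ha fun f hf h1 h2 => ?_
  have h3 := eq_zero_of_mem_sep hθ ht ⟨hf, h1, h2⟩
  have h4 := hz _ (neg_mem_affRoots (comp_act_mem t hf))
    (by simp only [Pi.neg_apply, mem_stab_iff.1 ht, h3, neg_zero]) (by simpa using h2)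
  exact neg_pos.1 h4

lemma exists_isNear {θ : V} (y : affineWeyl P) : ∃ t ∈ stab P θ, IsNear P a θ (t * y) := by
  have hreg := isRegular_of_mem_fundAlcove ha
  induction hn : length (simpleRefl b) y using Nat.strong_induction_on generalizing y with
  | _ n ih =>
    by_cases h : IsNear P a θ y
    · exact ⟨1, one_mem _, by rwa [one_mul]⟩
    simp only [IsNear, not_forall, not_lt] at h
    obtain ⟨_, ⟨i, k, rfl⟩, h1, h2, h3⟩ := h
    have h4 := length_affRefl_mul_lt ha h2
      (lt_of_le_of_ne h3 (hreg.act y _ (aff_mem i k)))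
    obtain ⟨t, ht, hty⟩ := ih _ (by omega) (affRefl P i k * y) rfl
    rw [← mul_assoc] at hty
    exact ⟨_, mul_mem ht (mem_stab_iff.2 (act_affRefl_eq_self h1)), hty⟩

/-- An element t is determined by the hyperplanes separating a from t a. For t in the stabilizer
these pass through θ, so they are among those crossed by w₀; finiteness and maximality of w₀ follow.
-/
lemma isFiniteParabolic_stab {θ : V} (hθ : θ ∈ closedCell P a) {w₀ : affineWeyl P}
    (hw₀ : w₀ ∈ stab P θ)
    (hw₀' : ∀ f ∈ affRoots P, f θ = 0 → 0 < f a → f (act P w₀ a) < 0) :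
    IsFiniteParabolic (simpleRefl b) (stab P θ) w₀ := by
  have hreg := isRegular_of_mem_fundAlcove ha
  have hsub {t : affineWeyl P} (ht : t ∈ stab P θ) :
      sep P a (act P t a) ⊆ sep P a (act P w₀ a) := fun f hf =>
    ⟨hf.1, hf.2.1, hw₀' f hf.1 (eq_zero_of_mem_sep hθ ht hf) hf.2.1⟩
  refine ⟨?_, hw₀, fun t ht hne => ?_, fun t ht hne => ?_, fun y => ?_⟩
  · refine Set.Finite.of_finite_image (f := fun t => sep P a (act P t a))
      (((sep_finite (P := P) a (act P w₀ a)).finite_subsets).subset ?_) fun t _ t' _ h => eq_of_sep_subset ha h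
    rintro _ ⟨t, ht, rfl⟩
    exact hsub ht
  · rw [length_eq_ncard_sep ha, length_eq_ncard_sep ha]
    exact Set.ncard_lt_ncard (lt_of_le_of_ne (hsub ht) fun h => hne (eq_of_sep_subset ha h))
      (sep_finite _ _)
  · obtain ⟨s, hs, hlt⟩ := (isCoxeterLike_simpleRefl ha).exists_descent t hne
    obtain ⟨i, k, hwall, rfl⟩ := (mem_simpleRefl_iff ha).1 hs
    refine ⟨_, ⟨hs, mem_stab_iff.2 (act_affRefl_eq_self (eq_zero_of_mem_sep hθ ht
      ⟨hwall.1, hwall.2.1, ?_⟩))⟩, hlt⟩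
    by_contra h
    have := length_affRefl_mul_of_pos ha hwall
      (lt_of_le_of_ne (not_lt.1 h) (hreg.act t _ (aff_mem i k)).symm)
    omega
  · obtain ⟨t, ht, h⟩ := exists_isNear ha (θ := θ) y
    exact ⟨t, ht, h.isMinCoset ha hθ⟩

end Isotropy

/-! ### The alcoves `ρ ± A_fund` -/

section RhoAlcove

variable {ι V N : Type*} [AddCommGroup V] [Module ℝ V] [AddCommGroup N] [Module ℝ N]
  {P : RootPairing ι ℝ V N} {b : P.Base} {a : V}

lemma aff_int_add {p : V} {i : ι} {m : ℤ} (hm : P.coroot' i p = m) (k : ℤ) (y : V) :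
    aff P i k (p + y) = aff P i (k - m) y := by
  simp only [aff, map_add, hm]
  push_cast
  ring

lemma aff_int {p : V} {i : ι} {m : ℤ} (hm : P.coroot' i p = m) (k : ℤ) :
    aff P i k p = (m - k : ℤ) := by
  rw [aff, hm, Int.cast_sub]

lemma vadd_cell {p : V} (hp : IsInt P p) (c : V) : p +ᵥ cell P c = cell P (p + c) := by
  ext x
  rw [Set.mem_vadd_set_iff_neg_vadd_mem, vadd_eq_add]
  constructor
  · rintro h _ ⟨i, k, rfl⟩ hf
    obtain ⟨m, hm⟩ := hp i
    rw [aff_int_add hm] at hf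
    have := h _ (aff_mem _ _) hf
    rwa [← aff_int_add hm, add_neg_cancel_left] at this
  · rintro h _ ⟨i, k, rfl⟩ hf
    obtain ⟨m, hm⟩ := hp i
    have h1 := aff_int_add hm (k + m)
    simp only [add_sub_cancel_right] at h1
    rw [← h1] at hf ⊢
    rw [add_neg_cancel_left]
    exact h _ (aff_mem _ _) hf

lemma isRegular_int_add {p c : V} (hp : IsInt P p) (hc : IsRegular P c) : IsRegular P (p + c) := by
  rintro _ ⟨i, k, rfl⟩
  obtain ⟨m, hm⟩ := hp i
  rw [aff_int_add hm]
  exact hc _ (aff_mem _ _)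

lemma isRegular_neg {c : V} (hc : IsRegular P c) : IsRegular P (-c) := by
  rintro _ ⟨i, k, rfl⟩ h
  refine hc _ (aff_mem (P.reflectionPerm i i) k) ?_
  rw [aff, coroot'_neg, ← map_neg]
  exact h

lemma isPos_of_coroot'_pos (ha : a ∈ fundAlcove b) {i : ι} (h : 0 < P.coroot' i a) :
    b.IsPos i := by
  rcases isPos_or_neg b i with hi | hi
  · exact hi
  · have := (ha _ hi).1
    rw [coroot'_neg] at this
    linarith

lemma abs_coroot'_lt_one (ha : a ∈ fundAlcove b) (i : ι) : |P.coroot' i a| < 1 := by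
  rw [abs_lt]
  rcases isPos_or_neg b i with hi | hi
  · have := ha _ hi
    exact ⟨by linarith, this.2⟩
  · have := ha _ hi
    rw [coroot'_neg] at this
    exact ⟨by linarith, by linarith⟩

/-- Affine roots are integers at p, and positivity at p + c forces a value greater than -1 at p. -/
lemma int_mem_closedCell {p c : V} (hp : IsInt P p) (hc : ∀ i, |P.coroot' i c| < 1) :
    p ∈ closedCell P (p + c) := by
  rintro _ ⟨i, k, rfl⟩ hf
  obtain ⟨m, hm⟩ := hp i
  rw [aff_int_add hm, aff] at hf
  rw [aff_int hm]
  have h1 := (abs_lt.1 (hc i)).2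
  have h2 : ((k - m : ℤ) : ℝ) < 1 := by linarith
  have h3 : k - m < 1 := by exact_mod_cast h2
  exact_mod_cast (by omega : 0 ≤ m - k)

lemma closedCell_eq_of_mem {a x : V} (ha : IsRegular P a) (hx : x ∈ cell P a) :
    closedCell P x = closedCell P a := by
  ext y
  refine ⟨fun hy f hf h => hy f hf (hx f hf h), fun hy f hf h => hy f hf ?_⟩
  by_contra h'
  have := neg_of_mem_cell hx hf (lt_of_le_of_ne (not_lt.1 h') (ha f hf))
  linarith

lemma pos_of_mem_cell {a x : V} (ha : IsRegular P a) (hx : x ∈ cell P a) {f : V → ℝ}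
    (hf : f ∈ affRoots P) (h : 0 < f x) : 0 < f a := by
  by_contra h'
  have := neg_of_mem_cell hx hf (lt_of_le_of_ne (not_lt.1 h') (ha f hf))
  linarith

lemma mem_cell_of_mem_cell {a x : V} (ha : IsRegular P a) (hx : x ∈ cell P a) : a ∈ cell P x :=
  fun _ hf h => pos_of_mem_cell ha hx hf h

lemma aff_sub_eq_neg {f : V → ℝ} (hf : f ∈ affRoots P) {p : V} (hp : f p = 0) (c : V) :
    f (p - c) = -f (p + c) := by
  obtain ⟨i, k, rfl⟩ := hf
  simp only [aff, map_sub, map_add] at hp ⊢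
  linarith

variable [Finite ι] [P.IsCrystallographic] [P.IsReduced] (ha : a ∈ fundAlcove b)

include ha

lemma rhoAlcove_eq_cell : rhoAlcove b = cell P (rho b + a) := by
  rw [rhoAlcove, fundAlcove_eq_cell ha, vadd_cell isInt_rho]

lemma isRegular_rho_add : IsRegular P (rho b + a) :=
  isRegular_int_add isInt_rho (isRegular_of_mem_fundAlcove ha)

lemma isRegular_rho_sub : IsRegular P (rho b - a) := by
  rw [sub_eq_add_neg]
  exact isRegular_int_add isInt_rho (isRegular_neg (isRegular_of_mem_fundAlcove ha))

lemma rho_mem_closedCell_add : rho b ∈ closedCell P (rho b + a) :=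
  int_mem_closedCell isInt_rho (abs_coroot'_lt_one ha)

lemma rho_mem_closedCell_sub : rho b ∈ closedCell P (rho b - a) := by
  rw [sub_eq_add_neg]
  refine int_mem_closedCell isInt_rho fun i => ?_
  rw [map_neg, abs_neg]
  exact abs_coroot'_lt_one ha i

lemma rhoAlcove_mem_alcoves : rhoAlcove b ∈ alcoves b := by
  rw [rhoAlcove_eq_cell ha]
  exact cell_mem_alcoves (isRegular_rho_add ha)

/-- The element `x` with `x(A_fund) = ρ + A_fund`. -/
lemma act_alcoveElt_rho : act P (alcoveElt b (rhoAlcove b)) a ∈ cell P (rho b + a) := by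
  rw [← rhoAlcove_eq_cell ha]
  exact act_alcoveElt_mem ha (rhoAlcove_mem_alcoves ha)

lemma exists_act_mem_cell {c : V} (hc : IsRegular P c) : ∃ u : affineWeyl P,
    act P u a ∈ cell P c := by
  obtain ⟨w, -, hw⟩ := exists_mem_closure_act_mem_cell ha hc
  refine ⟨w⁻¹, ?_⟩
  have h1 := mem_cell_of_mem_cell (isRegular_of_mem_fundAlcove ha) hw
  have : act P w⁻¹ a ∈ actSet P w⁻¹ (cell P (act P w c)) := ⟨a, h1, rfl⟩
  rwa [actSet_cell, act_inv_act] at this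

omit [Finite ι] [P.IsReduced] ha in
lemma inv_act_rho_mem {w : affineWeyl P} (hw : rho b ∈ closedCell P (act P w a)) :
    act P w⁻¹ (rho b) ∈ closedCell P a := by
  have := act_mem_closedCell w⁻¹ hw
  rwa [act_inv_act] at this

lemma existsUnique_isFundRep : ∃! μ : V, IsFundRep b (rho b) μ := by
  have h1 : rho b ∈ closedCell P (act P (alcoveElt b (rhoAlcove b)) a) := by
    rw [closedCell_eq_of_mem (isRegular_rho_add ha) (act_alcoveElt_rho ha)]
    exact rho_mem_closedCell_add ha
  refine existsUnique_of_exists_of_unique ?_ ?_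
  · refine ⟨act P (alcoveElt b (rhoAlcove b))⁻¹ (rho b), ?_, _, rfl⟩
    rw [fundAlcoveClosure_eq_closedCell ha]
    exact inv_act_rho_mem h1
  · rintro μ μ' ⟨h2, w, rfl⟩ ⟨h3, w', rfl⟩
    rw [fundAlcoveClosure_eq_closedCell ha] at h2 h3
    have h4 := act_eq_of_mem_closedCell ha h2 (w := w' * w⁻¹)
    rw [act_mul, act_inv_act] at h4
    exact (h4 h3).symm

lemma isFundRep_rhoBar : IsFundRep b (rho b) (rhoBar b) :=
  Classical.epsilon_spec (existsUnique_isFundRep ha).exists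

lemma rhoBar_mem : rhoBar b ∈ closedCell P a := by
  rw [← fundAlcoveClosure_eq_closedCell ha]
  exact (isFundRep_rhoBar ha).1

lemma isInt_rhoBar : IsInt P (rhoBar b) := by
  obtain ⟨w, hw⟩ := (isFundRep_rhoBar ha).2
  rw [← hw]
  exact isInt_act isInt_rho w

lemma act_rhoBar {w : affineWeyl P} (hw : rho b ∈ closedCell P (act P w a)) :
    act P w (rhoBar b) = rho b := by
  have h1 : IsFundRep b (rho b) (act P w⁻¹ (rho b)) :=
    ⟨by rw [fundAlcoveClosure_eq_closedCell ha]; exact inv_act_rho_mem hw, _, rfl⟩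
  rw [(existsUnique_isFundRep ha).unique (isFundRep_rhoBar ha) h1, act_act_inv]

variable {x u : affineWeyl P} (hx : act P x a ∈ cell P (rho b + a))
  (hu : act P u a ∈ cell P (rho b - a))

include hx in
lemma act_rhoBar_of_mem_add : act P x (rhoBar b) = rho b := act_rhoBar ha (by
  rw [closedCell_eq_of_mem (isRegular_rho_add ha) hx]
  exact rho_mem_closedCell_add ha)

include hu in
lemma act_rhoBar_of_mem_sub : act P u (rhoBar b) = rho b := act_rhoBar ha (by
  rw [closedCell_eq_of_mem (isRegular_rho_sub ha) hu]
  exact rho_mem_closedCell_sub ha)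

omit [Finite ι] [P.IsCrystallographic] [P.IsReduced] in
/-- An affine root that vanishes at `ρ` and is positive on `ρ + A_fund` has positive gradient. -/
lemma isPos_of_aff_rho {i : ι} {k : ℤ} (h0 : aff P i k (rho b) = 0)
    (h : 0 < aff P i k (rho b + a)) : b.IsPos i := by
  refine isPos_of_coroot'_pos ha ?_
  simp only [aff, map_add] at h0 h
  linarith

include hx hu

/-- An affine root vanishing at ρ has opposite signs at ρ + a and ρ - a, so u⁻¹x crosses every
hyperplane through ρbar. -/
lemma isFiniteParabolic_isotropy :
    IsFiniteParabolic (simpleRefl b) (stab P (rhoBar b)) (u⁻¹ * x) := by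
  have h1 := act_rhoBar_of_mem_add ha hx
  have h2 := act_rhoBar_of_mem_sub ha hu
  refine isFiniteParabolic_stab ha (rhoBar_mem ha) ?_ fun f hf hfθ hfa => ?_
  · rw [mem_stab_iff, act_mul, h1, ← h2, act_inv_act]
  · have hg := comp_act_mem u⁻¹ hf
    have h3 : f (act P u⁻¹ (rho b)) = 0 := by rw [← h2, act_inv_act, hfθ]
    have h4 : 0 < f (act P u⁻¹ (rho b - a)) :=
      pos_of_mem_cell (isRegular_rho_sub ha) hu hg (by simpa only [act_inv_act] using hfa)
    have h5 := aff_sub_eq_neg hg h3 a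
    rw [act_mul]
    exact neg_of_mem_cell hx hg (by linarith)

-- Let f be positive at a and negative at u a. If f(ρ) < 0, the alcove of ut is on the same side
-- because ρ is in its closure. If f(ρ) = 0, then f has positive gradient and level at least 1,
-- hence is negative at a, a contradiction.
omit hx in
lemma length_mul_of_mem_stab {t : affineWeyl P} (ht : t ∈ stab P (rhoBar b)) :
    length (simpleRefl b) (u * t) = length (simpleRefl b) u + length (simpleRefl b) t := by
  have h2 := act_rhoBar_of_mem_sub ha hu
  refine length_mul_of_sep ha fun f hf h3 h4 => ?_
  have h6 : rho b ∈ closedCell P (act P (u * t) a) := by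
    rw [← h2]
    nth_rw 1 [← mem_stab_iff.1 ht]
    rw [← act_mul]
    exact act_mem_closedCell _ (rhoBar_mem ha)
  have h7 : f (rho b - a) < 0 := neg_of_mem_cell
    (mem_cell_of_mem_cell (isRegular_rho_sub ha) hu) hf h4
  have h5 : f (rho b) ≤ 0 := nonpos_of_mem_closedCell (rho_mem_closedCell_sub ha) hf h7
  rcases h5.lt_or_eq with h5 | h5
  · by_contra h8
    have := h6 f hf (lt_of_le_of_ne (not_lt.1 h8)
      ((isRegular_of_mem_fundAlcove ha).act (u * t) f hf).symm)
    linarith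
  · exfalso
    have h8 := aff_sub_eq_neg hf h5 a
    obtain ⟨i, k, rfl⟩ := hf
    have hi := isPos_of_aff_rho ha h5 (by linarith)
    have h9 := one_le_coroot'_rho hi
    have h10 := (ha i hi).2
    simp only [aff] at h5 h3
    linarith

end RhoAlcove

/-! ### Vanishing in the antispherical module -/

section Vanishing

variable {ι V N : Type*} [Finite ι] [AddCommGroup V] [Module ℝ V] [AddCommGroup N] [Module ℝ N]
  {P : RootPairing ι ℝ V N} [P.IsCrystallographic] [P.IsReduced] {b : P.Base} {a : V}
  (ha : a ∈ fundAlcove b)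

lemma v_add_vinv_ne_zero : v + vinv ≠ 0 := by
  intro h
  have := congrArg (LaurentPolynomial.eval₂ (RingHom.id ℤ) 1) h
  simp [v, vinv] at this

include ha

/-- If y⁻¹ had to be moved by some t ≠ 1 to become minimal in its coset, a left descent of t⁻¹ would
be a right descent of y in the stabilizer. -/
lemma isNear_inv_of_forall_length {θ : V} (hθ : θ ∈ closedCell P a) {w₀ : affineWeyl P}
    (hK : IsFiniteParabolic (simpleRefl b) (stab P θ) w₀) {y : affineWeyl P}
    (hy : ∀ t ∈ simpleRefl b ∩ stab P θ, ¬ length (simpleRefl b) (y * t) < length (simpleRefl b) y) :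
    IsNear P a θ y⁻¹ := by
  have hS := isCoxeterLike_simpleRefl ha
  obtain ⟨t, ht, h⟩ := exists_isNear ha (θ := θ) y⁻¹
  by_cases h1 : t = 1
  · rwa [h1, one_mul] at h
  exfalso
  obtain ⟨s, hs, h2⟩ := hK.exists_descent t⁻¹ (inv_mem ht) (by simpa using h1)
  have h3 := h.isMinCoset ha hθ
  have h4 := h3 t⁻¹ (inv_mem ht)
  have h5 := h3 (s * t⁻¹) (mul_mem hs.2 (inv_mem ht))
  rw [inv_mul_cancel_left] at h4
  rw [mul_assoc, inv_mul_cancel_left] at h5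
  refine hy s hs ?_
  rw [← hS.length_inv, mul_inv_rev, hS.inv_eq hs.1, ← hS.length_inv y]
  omega

lemma eq_simple_of_length_eq_one {t : affineWeyl P} (ht : length (simpleRefl b) t = 1) :
    t ∈ simpleRefl b := by
  have hS := isCoxeterLike_simpleRefl ha
  obtain ⟨s, hs, h⟩ := hS.exists_descent t (fun h => by rw [h, length_one] at ht; omega)
  by_cases h1 : s * t = 1
  · have := eq_inv_of_mul_eq_one_right h1
    rw [hS.inv_eq hs] at this
    rwa [this]
  · obtain ⟨s', -, h'⟩ := hS.exists_descent _ h1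
    omega

/-- An element that is minimal in its left `W_f`-coset maps the fundamental alcove into the dominant
chamber. -/
lemma coroot'_act_pos {y : affineWeyl P}
    (hy : ∀ s ∈ simpleReflFin b, ¬ length (simpleRefl b) (s * y) < length (simpleRefl b) y) {i : ι}
    (hi : b.IsPos i) : 0 < P.coroot' i (act P y a) := by
  refine coroot'_pos_of_support (fun j hj => ?_) hi
  by_contra h
  have h1 : aff P j 0 (act P y a) ≠ 0 := (isRegular_of_mem_fundAlcove ha).act y _ (aff_mem j 0)
  have h2 : aff P j 0 (act P y a) < 0 := lt_of_le_of_ne (by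
    rw [aff, Int.cast_zero, sub_zero]; exact not_lt.1 h) h1
  refine hy _ (mem_simpleReflFin_iff.2 ⟨j, hj, rfl⟩) ?_
  rw [length_affRefl_mul_of_neg ha (isWallRoot_of_mem_support ha hj) h2]
  omega

variable {u : affineWeyl P} (hu : act P u a ∈ cell P (rho b - a))

include hu

/-- The alcove `ρ - A_fund` is closest to the fundamental alcove among the alcoves that have a
strictly dominant point of the orbit of `ρ` in their closure. -/
lemma length_le_of_forall_one_le {y : affineWeyl P}
    (hy : ∀ j ∈ b.support, 1 ≤ P.coroot' j (act P y (rhoBar b))) :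
    length (simpleRefl b) u ≤ length (simpleRefl b) y := by
  have hreg := isRegular_of_mem_fundAlcove ha
  rw [length_eq_ncard_sep ha, length_eq_ncard_sep ha]
  refine Set.ncard_le_ncard ?_ (sep_finite _ _)
  rintro f ⟨hf, hfa, hfu⟩
  refine ⟨hf, hfa, ?_⟩
  have hfr := neg_of_mem_cell (mem_cell_of_mem_cell (isRegular_rho_sub ha) hu) hf hfu
  have hp {i : ι} (hi : b.IsPos i) : P.coroot' i (rho b) ≤ P.coroot' i (act P y (rhoBar b)) :=
    coroot'_le_of_support (fun j hj => by rw [coroot'_rho hj]; exact hy j hj) hi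
  refine affRoots_cases b (p := fun f => 0 < f a → f (rho b - a) < 0 → f (act P y a) < 0)
    (fun i k hi h1 h2 => ?_) (fun i k hi h1 h2 => ?_) hf hfa hfr
  -- A positive gradient together with positivity at a forces k ≤ 0, so f would be positive at ρ -
  -- a.
  · exfalso
    have h3 := (ha i hi).2
    have h4 := one_le_coroot'_rho hi
    simp only [aff, map_sub] at h1 h2
    have h5 : (k : ℝ) < 1 := by linarith
    have h6 : k ≤ 0 := by
      have : k < 1 := by exact_mod_cast h5
      omega
    have h7 : (k : ℝ) ≤ 0 := by exact_mod_cast h6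
    linarith
  · have h3 := (ha i hi).1
    simp only [aff, map_sub, Pi.neg_apply] at h1 h2
    have h4 : 0 < aff P i k (act P y (rhoBar b)) := by
      rw [aff]
      linarith [hp hi]
    simp only [Pi.neg_apply, neg_lt_zero]
    by_contra h5
    have := nonpos_of_mem_closedCell (act_mem_closedCell y (rhoBar_mem ha)) (aff_mem i k)
      (lt_of_le_of_ne (not_lt.1 h5) (hreg.act y _ (aff_mem i k)))
    linarith

/-- Induction on ℓ(y). Right descents in the stabilizer and left descents in S_f are absorbed as
scalars; what remains is the position of y(ρbar) relative to the simple walls. -/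
theorem oneTmul_H_mul_parabolicSum_eq_zero {w₀ : affineWeyl P}
    (hK : IsFiniteParabolic (simpleRefl b) (stab P (rhoBar b)) w₀) (y : affineWeyl P)
    (hy : length (simpleRefl b) y < length (simpleRefl b) u) :
    oneTmul (simpleRefl b) (simpleReflFin b) (-v)
      (H (simpleRefl b) y * parabolicSum (simpleRefl b) (stab P (rhoBar b)) w₀) = 0 := by
  have hS := isCoxeterLike_simpleRefl ha
  have hreg := isRegular_of_mem_fundAlcove ha
  induction hn : length (simpleRefl b) y using Nat.strong_induction_on generalizing y with
  | _ n ih =>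
  by_cases h1 : ∃ t ∈ simpleRefl b ∩ stab P (rhoBar b),
      length (simpleRefl b) (y * t) < length (simpleRefl b) y
  · obtain ⟨t, ht, h1⟩ := h1
    have h2 := H_mul_simple_of_lt hS ht.1 (w := y * t) (by rwa [hS.mul_cancel_right ht.1])
    rw [hS.mul_cancel_right ht.1] at h2
    rw [← h2, mul_assoc, hK.simple_mul_parabolicSum hS ht, mul_smul_comm, oneTmul_smul,
      ih _ (by omega) (y * t) (by omega) rfl, smul_zero]
  by_cases h2 : ∃ s ∈ simpleReflFin b, length (simpleRefl b) (s * y) < length (simpleRefl b) y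
  · obtain ⟨s, hs, h2⟩ := h2
    have hsS := simpleReflFin_subset hs
    have h3 := H_simple_mul_of_lt hS hsS (w := s * y) (by rwa [hS.mul_cancel hsS])
    rw [hS.mul_cancel hsS] at h3
    rw [← h3, mul_assoc, oneTmul_H_mul hs, ih _ (by omega) (s * y) (by omega) rfl, smul_zero]
  push Not at h1 h2
  have hnear := isNear_inv_of_forall_length ha (rhoBar_mem ha) hK
    (fun t ht => not_lt.2 (h1 t ht))
  have hdom {i : ι} (hi : b.IsPos i) : 0 < P.coroot' i (act P y a) :=
    coroot'_act_pos ha (fun s hs => not_lt.2 (h2 s hs)) hi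
  by_cases h3 : ∃ j ∈ b.support, P.coroot' j (act P y (rhoBar b)) = 0
  · obtain ⟨j, hj, h3⟩ := h3
    have hpos : 0 < aff P j 0 (act P y a) := by
      rw [aff, Int.cast_zero, sub_zero]
      exact hdom (b.isPos_of_mem_support hj)
    obtain ⟨i, k, hik⟩ := comp_act_mem y (aff_mem (P := P) j 0)
    have hcomp : affRefl P j 0 * y = y * affRefl P i k :=
      affRefl_mul_of_comp_eq (congrFun hik)
    have ht : affRefl P i k ∈ stab P (rhoBar b) := by
      refine mem_stab_iff.2 (act_affRefl_eq_self ?_)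
      rw [← congrFun hik, aff, h3, Int.cast_zero, sub_zero]
    -- Lengths add in y t, and s_j y = y t has length ℓ(y) + 1, so t is simple.
    have hlen := hnear.isMinCoset ha (rhoBar_mem ha) _ (inv_mem ht)
    rw [← mul_inv_rev, hS.length_inv, hS.length_inv, hS.length_inv] at hlen
    have hlen' := length_affRefl_mul_of_pos ha (isWallRoot_of_mem_support ha hj) hpos
    rw [hcomp] at hlen'
    have htS := eq_simple_of_length_eq_one ha (t := affRefl P i k) (by omega)
    have hs : affRefl P j 0 ∈ simpleReflFin b := mem_simpleReflFin_iff.2 ⟨j, hj, rfl⟩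
    have h4 : H (simpleRefl b) (affRefl P j 0) * H (simpleRefl b) y =
        H (simpleRefl b) y * H (simpleRefl b) (affRefl P i k) := by
      rw [H_simple_mul_of_lt hS (simpleReflFin_subset hs) (by rw [hcomp]; omega), hcomp,
        H_mul_simple_of_lt hS htS (by omega)]
    -- H_{s_j} acts on the antispherical side by -v, H_t on the parabolic sum by v⁻¹, so v + v⁻¹
    -- annihilates the vector.
    have h5 := oneTmul_H_mul (c := -v) hs
      (H (simpleRefl b) y * parabolicSum (simpleRefl b) (stab P (rhoBar b)) w₀)
    rw [← mul_assoc, h4, mul_assoc, hK.simple_mul_parabolicSum hS ⟨htS, ht⟩, mul_smul_comm,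
      oneTmul_smul, neg_smul, ← sub_eq_zero, sub_neg_eq_add, ← add_smul] at h5
    have := (inducedBasis hS simpleReflFin_subset isCharValue_neg_v).isTorsionFree
    refine (smul_eq_zero.1 h5).resolve_left fun h => v_add_vinv_ne_zero ?_
    rw [add_comm, h]
  · exfalso
    -- By integrality, a dominant orbit point on no simple wall is at least 1 on every simple
    -- coroot.
    refine absurd (length_le_of_forall_one_le ha hu (y := y) fun j hj => ?_) (by omega)
    have h4 : 0 ≤ aff P j 0 (act P y (rhoBar b)) := by
      refine act_mem_closedCell y (rhoBar_mem ha) _ (aff_mem j 0) ?_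
      rw [aff, Int.cast_zero, sub_zero]
      exact hdom (b.isPos_of_mem_support hj)
    rw [aff, Int.cast_zero, sub_zero] at h4
    obtain ⟨m, hm⟩ := isInt_act (isInt_rhoBar ha) y j
    have h5 : m ≠ 0 := fun h => h3 ⟨j, hj, by rw [hm, h, Int.cast_zero]⟩
    rw [hm] at h4 ⊢
    have h6 : 0 ≤ m := by exact_mod_cast h4
    exact_mod_cast (by omega : 1 ≤ m)

end Vanishing

/-! ### Folding galleries -/

section Folding

variable {ι V N : Type*} [Finite ι] [AddCommGroup V] [Module ℝ V] [AddCommGroup N] [Module ℝ N]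
  {P : RootPairing ι ℝ V N} {b : P.Base}

/-- The positive roots in whose strip the point `c` does not lie and that are negative on `q`. -/
def foldSet (b : P.Base) (c q : V) : Set ι :=
  {i | b.IsPos i ∧ 1 < P.coroot' i c ∧ P.coroot' i q < 0}

omit [Finite ι] in
lemma coroot'_reflectionPerm_apply (i j : ι) (x : V) : P.coroot' (P.reflectionPerm i j) x =
    P.coroot' j x - P.coroot' i x * P.coroot' j (P.root i) := by
  rw [← P.coroot'_reflection, P.reflection_apply, map_sub, map_smul, smul_eq_mul]

/-- An injection: keep j if its coroot is negative on q, and otherwise replace j by its reflection.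
In the second case the pairing of `P.root i` with the coroot of j is negative, so reflecting only
increases the value on c. The index i itself is not hit. -/
lemma ncard_foldSet_reflection_le {c q : V} (hc : ∀ i, b.IsPos i → 0 < P.coroot' i c) {i : ι}
    (hi : b.IsPos i) (hq : P.coroot' i q < 0) :
    (foldSet b c (P.reflection i q)).ncard ≤ (foldSet b c q \ {i}).ncard := by
  classical
  have hpos {j : ι} (h : 0 < P.coroot' j c) : b.IsPos j := by
    rcases isPos_or_neg b j with h' | h'
    · exact h'
    · have := hc _ h'
      rw [coroot'_neg] at this
      linarith
  refine Set.ncard_le_ncard_of_injOn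
    (fun j => if P.coroot' j q < 0 then j else P.reflectionPerm i j) ?_ ?_ (Set.toFinite _)
  · rintro j ⟨hj, hj1, hj2⟩
    have hj2' := hj2
    rw [P.coroot'_reflection, coroot'_reflectionPerm_apply] at hj2'
    split_ifs with h
    · refine ⟨⟨hj, hj1, h⟩, ?_⟩
      rintro rfl
      rw [P.coroot'_reflection, coroot'_neg] at hj2
      linarith
    · have h1 : P.coroot' j (P.root i) < 0 := by
        by_contra h1
        nlinarith
      have h2 : 1 < P.coroot' (P.reflectionPerm i j) c := by
        rw [coroot'_reflectionPerm_apply]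
        nlinarith [hc i hi]
      refine ⟨⟨hpos (by linarith), h2, by rwa [← P.coroot'_reflection]⟩, ?_⟩
      intro h3
      have h4 : j = P.reflectionPerm i i :=
        (P.reflectionPerm_self i j).symm.trans (congrArg _ h3)
      rw [h4] at hj
      exact not_isPos_neg hi hj
  · rintro j ⟨-, -, hj⟩ j' ⟨-, -, hj'⟩ h
    dsimp only at h
    rw [P.coroot'_reflection] at hj hj'
    split_ifs at h with h1 h2 h2
    · exact h
    · rw [h, P.reflectionPerm_self] at hj
      exact absurd hj h2
    · rw [← h, P.reflectionPerm_self] at hj'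
      exact absurd hj' h1
    · exact (P.reflectionPerm i).injective h

variable [P.IsCrystallographic] [P.IsReduced] {a : V} (ha : a ∈ fundAlcove b)

omit [Finite ι] [P.IsReduced] in
lemma sep_act_simple {s : affineWeyl P} {j : ι} {m : ℤ} (hw : sep P a (act P s a) = {aff P j m})
    (y : affineWeyl P) {f : V → ℝ} (hf : f ∈ sep P (act P y a) (act P (y * s) a)) :
    (fun x => f (act P y x)) = aff P j m := by
  have : (fun x => f (act P y x)) ∈ sep P a (act P s a) :=
    ⟨comp_act_mem y hf.1, hf.2.1, hf.2.2⟩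
  rwa [hw, Set.mem_singleton_iff] at this

include ha

/-- Induction along a gallery of type z that starts at the dominant alcove of y and crosses every
hyperplane towards the side on which q is positive. A fold reflects the rest of the gallery, and q
with it. The factor v⁻¹ arises only at hyperplanes of level at least 1 crossed against a positive
root, and such a fold takes that root out of the fold set without enlarging its size otherwise. So
the size of the fold set bounds the power of v needed. -/
theorem pow_smul_oneTmul_mem_lat {z : affineWeyl P} : ∀ {y : affineWeyl P} {q : V} {n : ℕ},
    (∀ i, b.IsPos i → 0 < P.coroot' i (act P y a)) →
    (∀ i k, aff P i k (act P y a) < 0 → 0 < aff P i k (act P (y * z) a) → 0 < P.coroot' i q) →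
    (foldSet b (act P y a) q).ncard ≤ n →
    v ^ n • oneTmul (simpleRefl b) (simpleReflFin b) (-v)
        (H (simpleRefl b) y * H (simpleRefl b) z) ∈
      lat (fun w => oneTmul (simpleRefl b) (simpleReflFin b) (-v) (H (simpleRefl b) w)) 0 := by
  have hS := isCoxeterLike_simpleRefl ha
  have hreg := isRegular_of_mem_fundAlcove ha
  induction hn : length (simpleRefl b) z using Nat.strong_induction_on generalizing z with
  | _ l ih =>
  intro y q n hdom hcross hcard
  by_cases hz : z = 1
  · rw [hz, H_one, mul_one]
    exact smul_mem_lat _ (Nat.zero_le n) y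
  obtain ⟨s, hs, hlt⟩ := hS.exists_descent z hz
  have hHz : H (simpleRefl b) z = H (simpleRefl b) s * H (simpleRefl b) (s * z) := by
    rw [H_simple_mul_of_lt hS hs (by rw [hS.mul_cancel hs]; omega), hS.mul_cancel hs]
  have hyz : y * z = y * s * (s * z) := by rw [mul_assoc, hS.mul_cancel hs]
  obtain ⟨j, m, hwall, rfl⟩ := (mem_simpleRefl_iff ha).1 hs
  have hsep := sep_affRefl hwall
  set s := affRefl P j m with hsdef
  have hzneg : aff P j m (act P z a) < 0 := by
    by_contra h
    have := length_affRefl_mul_of_pos ha hwall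
      (lt_of_le_of_ne (not_lt.1 h) (hreg.act z _ (aff_mem j m)).symm)
    rw [← hsdef] at this
    omega
  -- the wall between `y(A_fund)` and `ys(A_fund)`
  obtain ⟨i, k, hi, hF⟩ : ∃ i k, b.IsPos i ∧ ((∀ x, aff P i k (act P y x) = aff P j m x) ∨
      ∀ x, aff P i k (act P y x) = -aff P j m x) := by
    have hG := comp_act_mem y⁻¹ (aff_mem (P := P) j m)
    refine affRoots_cases b (p := fun f => (f = fun x => aff P j m (act P y⁻¹ x)) → _)
      (fun i k hi h => ⟨i, k, hi, Or.inl fun x => ?_⟩)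
      (fun i k hi h => ⟨i, k, hi, Or.inr fun x => ?_⟩) hG rfl
    · rw [h]
      simp only [act_inv_act]
    · have := congrFun h (act P y x)
      simp only [act_inv_act, Pi.neg_apply] at this
      rw [← this, neg_neg]
  have hr : affRefl P i k * y = y * s := by
    rcases hF with h | h
    · exact affRefl_mul_of_comp_eq h
    · rw [hsdef, ← affRefl_neg]
      refine affRefl_mul_of_comp_eq fun x => ?_
      rw [aff_neg, Pi.neg_apply, h, neg_neg]
  have hrs : affRefl P i k * (y * s) = y := by rw [← hr, ← mul_assoc, affRefl_mul_self, one_mul]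
  have hrys (x : V) : aff P i k (act P (y * s) x) = -aff P i k (act P y x) := by
    rw [← hr, act_mul, aff_act_affRefl]
  have hFa : aff P j m a > 0 := hwall.2.1
  -- only one hyperplane is crossed
  have hone {i' : ι} {k' : ℤ} (h1 : 0 < aff P i' k' (act P y a))
      (h2 : aff P i' k' (act P (y * s) a) < 0) :
      ∀ x, aff P i' k' (act P y x) = aff P j m x :=
    congrFun (sep_act_simple hsep y ⟨aff_mem i' k', h1, h2⟩)
  have hcan {f g : V → ℝ} (h : ∀ x, f (act P y x) = g (act P y x)) : f = g := by
    funext x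
    rw [← act_act_inv y x, h]
  have hone' {i' : ι} {k' : ℤ} (h1 : aff P i' k' (act P y a) < 0)
      (h2 : 0 < aff P i' k' (act P (y * s) a)) :
      ∀ x, aff P i' k' (act P y x) = -aff P j m x := fun x => by
    have := congrFun (sep_act_simple hsep y (f := -aff P i' k')
      ⟨neg_mem_affRoots (aff_mem i' k'), by simpa using h1, by simpa using h2⟩) x
    rw [← this, Pi.neg_apply, neg_neg]
  have hcross1 : ∀ i' k', aff P i' k' (act P (y * s) a) < 0 →
      0 < aff P i' k' (act P (y * s * (s * z)) a) → 0 < P.coroot' i' q := by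
    intro i' k' h1 h2
    rw [← hyz] at h2
    refine hcross i' k' ?_ h2
    by_contra h3
    have h4 := hone (lt_of_le_of_ne (not_lt.1 h3) ((hreg.act y) _ (aff_mem i' k')).symm) h1
    rw [act_mul, h4] at h2
    linarith
  -- The folded gallery is the mirror image of the remaining one, so its crossing directions are
  -- governed by the reflected q.
  have hcross2 : ∀ i' k', aff P i' k' (act P y a) < 0 →
      0 < aff P i' k' (act P (y * (s * z)) a) → 0 < P.coroot' i' (P.reflection i q) := by
    intro i' k' h1 h2
    obtain ⟨i'', k'', h3⟩ := comp_act_mem (affRefl P i k) (aff_mem (P := P) i' k')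
    have h4 := hcross1 i'' k'' (by
      rw [← congrFun h3, ← act_mul, hrs]; exact h1) (by
      rw [← congrFun h3, ← act_mul, ← mul_assoc, hrs]; exact h2)
    have h5 : P.coroot' i' (P.reflection i q) = P.coroot' i'' q := by
      have e1 := congrFun h3 q
      have e2 := congrFun h3 0
      simp only [act_affRefl, aff, map_sub, map_smul, map_zero, smul_eq_mul] at e1 e2
      rw [P.reflection_apply, map_sub, map_smul, smul_eq_mul]
      linarith
    rwa [h5]
  have hlt' : length (simpleRefl b) (s * z) < l := by omega
  have hia := ha i hi
  have hdom_i : 0 < aff P i 0 (act P y a) := by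
    rw [aff, Int.cast_zero, sub_zero]
    exact hdom i hi
  -- dominance is kept if the crossed hyperplane does not pass through the origin
  have hdom' (hk : k ≠ 0) : ∀ i', b.IsPos i' → 0 < P.coroot' i' (act P (y * s) a) := by
    intro i' hi'
    have h1 : 0 < aff P i' 0 (act P y a) := by
      rw [aff, Int.cast_zero, sub_zero]
      exact hdom i' hi'
    have h2 : aff P i' 0 (act P (y * s) a) = P.coroot' i' (act P (y * s) a) := by
      rw [aff, Int.cast_zero, sub_zero]
    rw [← h2]
    by_contra h3
    have h4 := hone h1 (lt_of_le_of_ne (not_lt.1 h3) ((hreg.act (y * s)) _ (aff_mem i' 0)))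
    rcases hF with h | h
    · have := hcan (f := aff P i' 0) (g := aff P i k) fun x => by rw [h4, h]
      exact hk (aff_injective this).2.symm
    · have := hcan (f := aff P i' 0) (g := -aff P i k) fun x => by rw [h4, Pi.neg_apply, h, neg_neg]
      rw [← aff_neg] at this
      have h6 := (aff_injective this).1
      rw [h6] at hi'
      exact not_isPos_neg hi hi'
  rw [hHz, ← mul_assoc]
  rcases hF with hF | hF
  · -- the wall is crossed in the negative direction
    have hpos : 0 < aff P i k (act P y a) := by rw [hF]; exact hFa
    have hneg : aff P i k (act P (y * s) a) < 0 := by rw [hrys]; linarith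
    have hqneg : P.coroot' i q < 0 := by
      have h1 := hcross (P.reflectionPerm i i) (-k) (by rw [aff_neg, Pi.neg_apply]; linarith)
        (by rw [aff_neg, Pi.neg_apply, act_mul, hF]; linarith)
      rw [coroot'_neg] at h1
      linarith
    have hg2 := ncard_foldSet_reflection_le hdom hi hqneg
    by_cases hk : k ≤ 0
    · -- the crossed hyperplane is a wall of the dominant chamber
      have hk0 : k = 0 := by
        have h1 : aff P i 0 (act P (y * s) a) < 0 := by
          have h2 : (k : ℝ) ≤ 0 := by exact_mod_cast hk
          simp only [aff, Int.cast_zero] at hneg ⊢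
          linarith
        have h2 := hone hdom_i h1
        exact (aff_injective (hcan (f := aff P i k) (g := aff P i 0)
          fun x => by rw [h2, hF])).2
      subst hk0
      obtain ⟨i', hi', h1⟩ : ∃ i' ∈ b.support, aff P i' 0 (act P (y * s) a) < 0 := by
        by_contra! h
        have h1 : P.coroot' i 0 ≤ P.coroot' i (act P (y * s) a) :=
          coroot'_le_of_support (fun j hj => by
            have := h j hj
            rw [aff, Int.cast_zero, sub_zero] at this
            rwa [map_zero]) hi
        rw [aff, Int.cast_zero, sub_zero] at hneg
        rw [map_zero] at h1
        linarith
      have h2 := hone (by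
        rw [aff, Int.cast_zero, sub_zero]; exact hdom i' (b.isPos_of_mem_support hi')) h1
      obtain ⟨rfl, -⟩ := aff_injective (hcan (f := aff P i' 0) (g := aff P i 0)
        fun x => by rw [h2, hF])
      have hlen := length_affRefl_mul_of_pos ha (isWallRoot_of_mem_support ha hi') hpos
      have hmem : affRefl P i' 0 ∈ simpleReflFin b := mem_simpleReflFin_iff.2 ⟨i', hi', rfl⟩
      -- The neighbour is the mirror image of y under a reflection in S_f, so its term is -v times
      -- the folded one.
      rw [H_mul_simple_of_lt hS hs (by rw [← hr]; omega), ← hr,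
        ← H_simple_mul_of_lt hS (simpleReflFin_subset hmem) (by omega), mul_assoc,
        oneTmul_H_mul hmem, smul_smul, mul_neg, ← pow_succ, neg_smul]
      refine neg_mem (ih _ hlt' rfl hdom hcross2 ?_)
      have := Set.ncard_sdiff_singleton_le (foldSet b (act P y a) q) i'
      omega
    · have hk1 : 1 ≤ k := by omega
      have hk1' : (1 : ℝ) ≤ k := by exact_mod_cast hk1
      have hlen : length (simpleRefl b) (y * s) < length (simpleRefl b) y := by
        rw [← hr, ← affRefl_neg]
        refine length_affRefl_mul_lt ha ?_ ?_
        · rw [aff_neg, Pi.neg_apply, aff]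
          linarith [hia.2]
        · rw [aff_neg, Pi.neg_apply]
          linarith
      have hmem : i ∈ foldSet b (act P y a) q := by
        refine ⟨hi, ?_, hqneg⟩
        rw [aff] at hpos
        linarith
      have h1 := Set.ncard_sdiff_singleton_add_one hmem (Set.toFinite _)
      obtain ⟨n, rfl⟩ : ∃ n', n = n' + 1 := ⟨n - 1, by omega⟩
      rw [H_mul_simple_of_gt hS hs hlen, add_mul, oneTmul_add, smul_add, smul_mul_assoc,
        oneTmul_smul, smul_smul]
      refine add_mem (ih _ hlt' rfl (hdom' (by omega)) hcross1 (le_trans ?_ hcard)) ?_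
      -- The step goes in the negative direction, so no positive root can pass level 1 upwards and
      -- enter the fold set.
      · refine Set.ncard_le_ncard ?_ (Set.toFinite _)
        rintro d ⟨hd, hd1, hd2⟩
        refine ⟨hd, ?_, hd2⟩
        by_contra h2
        have h3 := hone' (i' := d) (k' := 1) (lt_of_le_of_ne (by
          rw [aff, Int.cast_one]; linarith) (hreg.act y _ (aff_mem d 1)))
          (by rw [aff, Int.cast_one]; linarith)
        have h4 := hcan (f := aff P d 1) (g := -aff P i k) fun x => by
          rw [h3, Pi.neg_apply, hF]
        rw [← aff_neg] at h4
        have h6 := (aff_injective h4).1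
        rw [h6] at hd
        exact not_isPos_neg hi hd
      -- The lost power of v is paid for by the removal of i from the fold set.
      · have h2 : v ^ (n + 1) * (vinv - v) = v ^ n - v ^ (n + 2) := by
          rw [mul_sub, pow_succ, mul_assoc, v_mul_vinv]
          ring
        rw [h2, sub_smul]
        exact sub_mem (ih _ hlt' rfl hdom hcross2 (by omega))
          (ih _ hlt' rfl hdom hcross2 (by omega))
  · -- the wall is crossed in the positive direction
    have hneg : aff P i k (act P y a) < 0 := by rw [hF]; linarith
    have hpos : 0 < aff P i k (act P (y * s) a) := by rw [hrys]; linarith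
    have hqpos : 0 < P.coroot' i q :=
      hcross i k hneg (by rw [act_mul, hF]; linarith)
    have hk1 : 1 ≤ k := by
      have h1 : (0 : ℝ) < k := by
        simp only [aff, Int.cast_zero] at hneg hdom_i
        linarith
      have h2 : 0 < k := by exact_mod_cast h1
      omega
    have hk1' : (1 : ℝ) ≤ k := by exact_mod_cast hk1
    have hlen : length (simpleRefl b) y < length (simpleRefl b) (y * s) := by
      nth_rw 1 [← hrs]
      rw [← affRefl_neg]
      refine length_affRefl_mul_lt ha ?_ ?_
      · rw [aff_neg, Pi.neg_apply, aff]
        linarith [hia.2]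
      · rw [aff_neg, Pi.neg_apply]
        linarith
    rw [H_mul_simple_of_lt hS hs hlen]
    refine ih _ hlt' rfl (hdom' (by omega)) hcross1 (le_trans ?_ hcard)
    -- A root that passes level 1 upwards at this step is the crossed root, and q is positive on it,
    -- so it does not enter the fold set.
    refine Set.ncard_le_ncard ?_ (Set.toFinite _)
    rintro d ⟨hd, hd1, hd2⟩
    refine ⟨hd, ?_, hd2⟩
    by_contra h2
    have h3 := hone' (i' := d) (k' := 1) (lt_of_le_of_ne (by
      rw [aff, Int.cast_one]; linarith) (hreg.act y _ (aff_mem d 1)))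
      (by rw [aff, Int.cast_one]; linarith)
    have h4 := hcan (f := aff P d 1) (g := aff P i k) fun x => by rw [h3, hF]
    rw [(aff_injective h4).1] at hd2
    linarith

end Folding

/-! ### The element `u` with `u(A_fund) = ρ - A_fund` -/

section Steinberg

variable {ι V N : Type*} [Finite ι] [AddCommGroup V] [Module ℝ V] [AddCommGroup N] [Module ℝ N]
  {P : RootPairing ι ℝ V N} [P.IsCrystallographic] [P.IsReduced] {b : P.Base} {a : V}
  (ha : a ∈ fundAlcove b) {x u : affineWeyl P} (hx : act P x a ∈ cell P (rho b + a))
  (hu : act P u a ∈ cell P (rho b - a))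

include ha

lemma isNear_of_isMinCoset {θ : V} (hθ : θ ∈ closedCell P a) {z : affineWeyl P}
    (hz : IsMinCoset (simpleRefl b) (stab P θ) z) : IsNear P a θ z := by
  obtain ⟨t, ht, h⟩ := exists_isNear ha (θ := θ) z
  have h1 := h.isMinCoset ha hθ t⁻¹ (inv_mem ht)
  have h2 := hz t ht
  rw [inv_mul_cancel_left] at h1
  have h3 : length (simpleRefl b) t = 0 := by omega
  by_cases h4 : t = 1
  · rwa [h4, one_mul] at h
  · obtain ⟨s, -, h5⟩ := (isCoxeterLike_simpleRefl ha).exists_descent t h4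
    omega

include hx in
lemma coroot'_rho_lt {z : affineWeyl P} (hz : IsNear P a (rhoBar b) z) {i : ι} (hi : b.IsPos i) :
    P.coroot' i (rho b) < P.coroot' i (act P (x * z) a) := by
  obtain ⟨m, hm⟩ := isInt_rho (b := b) i
  have h1 : aff P i m (rho b) = 0 := by rw [aff, hm, sub_self]
  have h2 := hz _ (comp_act_mem x (aff_mem i m))
    (by rw [act_rhoBar_of_mem_add ha hx, h1])
    (hx _ (aff_mem i m) (by rw [aff_int_add hm, sub_self, aff, Int.cast_zero, sub_zero]
                            exact (ha i hi).1))
  have h3 : 0 < aff P i m (act P (x * z) a) := h2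
  rw [aff] at h3
  rw [hm]
  linarith

include hx in
/-- Galleries from `ρ + A_fund` to alcoves in `ρ + 𝒞⁺` move in the dominant direction. -/
lemma coroot'_rho_lt_of_cross {z : affineWeyl P} (hz : IsNear P a (rhoBar b) z) {i : ι} {k : ℤ}
    (h1 : aff P i k (act P x a) < 0) (h2 : 0 < aff P i k (act P (x * z) a)) : b.IsPos i := by
  have h3 : aff P i k (rho b) ≤ 0 := by
    have := nonpos_of_mem_closedCell (act_mem_closedCell x (rhoBar_mem ha)) (aff_mem i k) h1
    rwa [act_rhoBar_of_mem_add ha hx] at this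
  rcases isPos_or_neg b i with hi | hi
  · exact hi
  · have h4 := coroot'_rho_lt ha hx hz hi
    rw [coroot'_neg, coroot'_neg] at h4
    simp only [aff] at h2 h3
    linarith

-- A hyperplane that separates a from x a and is crossed back later would be crossed in the
-- direction of a positive root. But on positive coroots x a exceeds ρ, hence 1, hence a, so x a
-- cannot be on the negative side while a is on the positive one.
include hx in
lemma length_mul_of_isNear {z : affineWeyl P} (hz : IsNear P a (rhoBar b) z) :
    length (simpleRefl b) (x * z) = length (simpleRefl b) x + length (simpleRefl b) z := by
  refine length_mul_of_sep ha fun f hf h1 h2 => ?_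
  by_contra h3
  have h4 := lt_of_le_of_ne (not_lt.1 h3)
    ((isRegular_of_mem_fundAlcove ha).act (x * z) f hf).symm
  obtain ⟨i, k, rfl⟩ := hf
  have hi := coroot'_rho_lt_of_cross ha hx hz h2 h4
  have h5 := coroot'_rho_lt ha hx (z := 1) (fun f _ _ h => h) hi
  have h6 := one_le_coroot'_rho hi
  have h7 := (ha i hi).2
  rw [mul_one] at h5
  simp only [aff] at h1 h2
  linarith

include hx hu

/-- The positive roots on which ut(a) is below ρ give hyperplanes through ρbar that the longest
element crosses and t does not, so there are at most ℓ(u⁻¹x) - ℓ(t) of them. They contain the fold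
set. For t other than the longest element one of them is simple, and a simple root is not in the
fold set because ρ pairs to 1 with its coroot; this makes the inequality strict. -/
lemma ncard_foldSet_lt {t : affineWeyl P} (ht : t ∈ stab P (rhoBar b)) (hne : t ≠ u⁻¹ * x) :
    (foldSet b (act P (u * t) a) (act P (u * t) a - rho b)).ncard + length (simpleRefl b) t <
      length (simpleRefl b) (u⁻¹ * x) := by
  have hreg := isRegular_of_mem_fundAlcove ha
  have hK := isFiniteParabolic_isotropy ha hx hu
  have hθ := rhoBar_mem ha
  have huθ := act_rhoBar_of_mem_sub ha hu
  have hutθ : act P (u * t) (rhoBar b) = rho b := by rw [act_mul, mem_stab_iff.1 ht, huθ]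
  choose lev hlev using isInt_rho (b := b)
  set B : Set ι := {i | b.IsPos i ∧ P.coroot' i (act P (u * t) a) < P.coroot' i (rho b)} with hB
  let F : ι → V → ℝ := fun i y => (-aff P i (lev i)) (act P u y)
  have hFmem (i : ι) : F i ∈ affRoots P := comp_act_mem u (neg_mem_affRoots (aff_mem _ _))
  have hFθ (i : ι) : F i (rhoBar b) = 0 := by
    simp only [F]
    rw [huθ, Pi.neg_apply, aff, hlev, sub_self, neg_zero]
  have hFa {i : ι} (hi : b.IsPos i) : 0 < F i a := by
    refine hu _ (neg_mem_affRoots (aff_mem _ _)) ?_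
    have := (ha i hi).1
    rw [Pi.neg_apply, aff, map_sub, hlev]
    linarith
  have hFinj : Function.Injective F := fun i j h => by
    have h1 : aff P i (lev i) = aff P j (lev j) := by
      funext y
      have := congrFun h (act P u⁻¹ y)
      simp only [F, act_act_inv, Pi.neg_apply, neg_inj] at this
      exact this
    exact (aff_injective h1).1
  -- the hyperplanes through `ρ̄` that `t` does not cross
  have hw₀ : ∀ i, b.IsPos i → F i ∈ sep P a (act P (u⁻¹ * x) a) := by
    intro i hi
    refine ⟨hFmem i, hFa hi, ?_⟩
    simp only [F]
    rw [act_mul, act_act_inv, Pi.neg_apply, neg_lt_zero, aff, ← hlev, sub_pos]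
    have := coroot'_rho_lt ha hx (z := 1) (fun f _ _ h => h) hi
    rwa [mul_one] at this
  have hB1 : B.ncard + length (simpleRefl b) t ≤ length (simpleRefl b) (u⁻¹ * x) := by
    rw [length_eq_ncard_sep ha, length_eq_ncard_sep ha, ← Set.ncard_image_of_injective B hFinj,
      ← Set.ncard_union_eq ?_ (Set.toFinite _) (sep_finite _ _)]
    · refine Set.ncard_le_ncard (Set.union_subset ?_ ?_) (sep_finite _ _)
      · rintro _ ⟨i, hi, rfl⟩
        exact hw₀ i hi.1
      · intro f hf
        refine ⟨hf.1, hf.2.1, ?_⟩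
        have hf0 := eq_zero_of_mem_sep hθ ht hf
        have hg := comp_act_mem u⁻¹ hf.1
        have h3 : f (act P u⁻¹ (rho b)) = 0 := by rw [← huθ, act_inv_act, hf0]
        have h4 : 0 < f (act P u⁻¹ (rho b - a)) :=
          pos_of_mem_cell (isRegular_rho_sub ha) hu hg (by simpa only [act_inv_act] using hf.2.1)
        have h5 := aff_sub_eq_neg hg h3 a
        rw [act_mul]
        exact neg_of_mem_cell hx hg (by linarith)
    · rw [Set.disjoint_left]
      rintro _ ⟨i, hi, rfl⟩ hf
      have h1 := hf.2.2
      simp only [F] at h1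
      rw [← act_mul, Pi.neg_apply, aff, ← hlev] at h1
      linarith [hi.2]
  obtain ⟨i, hi, hiB⟩ : ∃ i ∈ b.support, i ∈ B := by
    by_contra! h
    have hle {i : ι} (hi : b.IsPos i) :
        P.coroot' i (rho b) ≤ P.coroot' i (act P (u * t) a) :=
      coroot'_le_of_support (fun j hj => by
        by_contra h'
        exact h j hj ⟨b.isPos_of_mem_support hj, not_le.1 h'⟩) hi
    have hBe : B = ∅ := Set.eq_empty_of_forall_notMem fun i hi => by
      linarith [hle hi.1, hi.2]
    -- If ut(a) is at least ρ on all positive coroots, t crosses the same hyperplanes as the longest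
    -- element.
    refine hne (eq_of_sep_subset ha (Set.Subset.antisymm (fun f hf => ?_) fun f hf => ?_))
    · exact ⟨hf.1, hf.2.1, by
        have hf0 := eq_zero_of_mem_sep hθ ht hf
        have hg := comp_act_mem u⁻¹ hf.1
        have h3 : f (act P u⁻¹ (rho b)) = 0 := by rw [← huθ, act_inv_act, hf0]
        have h4 : 0 < f (act P u⁻¹ (rho b - a)) :=
          pos_of_mem_cell (isRegular_rho_sub ha) hu hg (by simpa only [act_inv_act] using hf.2.1)
        have h5 := aff_sub_eq_neg hg h3 a
        rw [act_mul]
        exact neg_of_mem_cell hx hg (by linarith)⟩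
    · refine ⟨hf.1, hf.2.1, ?_⟩
      have hf0 := eq_zero_of_mem_sep hθ hK.longest_mem hf
      have hg := comp_act_mem u⁻¹ hf.1
      have h3 : f (act P u⁻¹ (rho b)) = 0 := by rw [← huθ, act_inv_act, hf0]
      have h4 : 0 < f (act P u⁻¹ (rho b - a)) :=
        pos_of_mem_cell (isRegular_rho_sub ha) hu hg (by simpa only [act_inv_act] using hf.2.1)
      by_contra h6
      have h7 := lt_of_le_of_ne (not_lt.1 h6) (hreg.act t f hf.1).symm
      have h8 : f (act P u⁻¹ (act P (u * t) a)) = f (act P t a) := by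
        rw [act_mul, act_inv_act]
      obtain ⟨i, k, hik⟩ := hg
      have e1 := congrFun hik (rho b)
      have e2 := congrFun hik (rho b - a)
      have e3 := congrFun hik (act P (u * t) a)
      simp only [aff, map_sub] at e1 e2 e3
      have hi : b.IsPos (P.reflectionPerm i i) := by
        refine isPos_of_coroot'_pos ha ?_
        rw [coroot'_neg]
        linarith
      have := hle hi
      rw [coroot'_neg, coroot'_neg] at this
      linarith
  have hA : foldSet b (act P (u * t) a) (act P (u * t) a - rho b) ⊆ B \ {i} := by
    rintro j ⟨hj, hj1, hj2⟩
    rw [map_sub, sub_neg] at hj2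
    refine ⟨⟨hj, hj2⟩, ?_⟩
    rintro rfl
    rw [coroot'_rho hi] at hj2
    linarith
  have h1 := Set.ncard_le_ncard hA (Set.toFinite _)
  have h2 := Set.ncard_sdiff_singleton_add_one hiB (Set.toFinite _)
  omega

/-- After expanding the parabolic sum, the term of the longest element is the leading term, and each
other term is estimated by folding with q = ut(a) - ρ. -/
theorem isSteinbergElement : IsSteinbergElement (simpleRefl b) (simpleReflFin b)
    (stab P (rhoBar b)) (u⁻¹ * x) u := by
  have hS := isCoxeterLike_simpleRefl ha
  have hreg := isRegular_of_mem_fundAlcove ha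
  have hK := isFiniteParabolic_isotropy ha hx hu
  have huθ := act_rhoBar_of_mem_sub ha hu
  have hxθ := act_rhoBar_of_mem_add ha hx
  refine ⟨oneTmul_H_mul_parabolicSum_eq_zero ha hu hK, fun z hz => ?_⟩
  have hnear := isNear_of_isMinCoset ha (rhoBar_mem ha) hz
  have hut {t : affineWeyl P} (ht : t ∈ stab P (rhoBar b)) :
      act P (u * t) (rhoBar b) = rho b := by rw [act_mul, mem_stab_iff.1 ht, huθ]
  have hterm (t : affineWeyl P) (ht : t ∈ stab P (rhoBar b)) : H (simpleRefl b) u *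
      H (simpleRefl b) t = H (simpleRefl b) (u * t) := H_mul (length_mul_of_mem_stab ha hu ht)
  have hw₀ : u * (u⁻¹ * x) = x := mul_inv_cancel_left u x
  classical
  have hsum : oneTmul (simpleRefl b) (simpleReflFin b) (-v) (H (simpleRefl b) u *
      parabolicSum (simpleRefl b) (stab P (rhoBar b)) (u⁻¹ * x) * H (simpleRefl b) z) =
      ∑ t ∈ hK.finite.toFinset,
        v ^ (length (simpleRefl b) (u⁻¹ * x) - length (simpleRefl b) t) •
          oneTmul (simpleRefl b) (simpleReflFin b) (-v)
            (H (simpleRefl b) (u * t) * H (simpleRefl b) z) := by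
    rw [hK.parabolicSum_eq, Finset.mul_sum, Finset.sum_mul, ← oneTmulₗ_apply, map_sum]
    refine Finset.sum_congr rfl fun t ht => ?_
    rw [mul_smul_comm, smul_mul_assoc, map_smul, hterm t (hK.mem_toFinset.1 ht), oneTmulₗ_apply]
  rw [hsum, ← Finset.add_sum_erase _ _ (hK.mem_toFinset.2 hK.longest_mem), Nat.sub_self, pow_zero,
    one_smul, hw₀, H_mul (length_mul_of_isNear ha hx hnear), add_sub_cancel_left]
  refine sum_mem fun t ht => ?_
  obtain ⟨hne, ht⟩ := Finset.mem_erase.1 ht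
  rw [hK.mem_toFinset] at ht
  have hcard := ncard_foldSet_lt ha hx hu ht hne
  obtain ⟨n, hn⟩ : ∃ n, length (simpleRefl b) (u⁻¹ * x) - length (simpleRefl b) t = n + 1 :=
    ⟨_, (Nat.succ_pred_eq_of_pos (by omega)).symm⟩
  -- The fold set has at most n elements, so n powers of v pay for the folds and the remaining one
  -- puts the term in v times the lattice.
  rw [hn, pow_succ', mul_smul]
  have := pow_smul_mem_lat 1 (pow_smul_oneTmul_mem_lat ha (z := z) (y := u * t)
    (q := act P (u * t) a - rho b) (n := n) (fun i hi => ?_) (fun i k h1 h2 => ?_) (by omega))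
  · rwa [pow_one, zero_add] at this
  · by_contra h
    have h1 : aff P i 0 (act P (u * t) a) < 0 :=
      lt_of_le_of_ne (by rw [aff, Int.cast_zero, sub_zero]; exact not_lt.1 h)
        (hreg.act (u * t) _ (aff_mem i 0))
    have h2 := nonpos_of_mem_closedCell (act_mem_closedCell (u * t) (rhoBar_mem ha)) (aff_mem i 0) h1
    rw [hut ht, aff, Int.cast_zero, sub_zero] at h2
    linarith [one_le_coroot'_rho hi]
  -- The element u t x⁻¹ fixes ρ and carries the gallery from the alcove of x to that of xz, which
  -- moves in dominant directions, to the present one. The linear part maps x(a) - ρ to ut(a) - ρ,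
  -- so the crossed roots are positive on the latter.
  · obtain ⟨i', k', h3⟩ := comp_act_mem (u * t * x⁻¹) (aff_mem (P := P) i k)
    have e1 : aff P i k (act P (u * t) a) = aff P i' k' (act P x a) := by
      rw [← congrFun h3, ← act_mul, inv_mul_cancel_right]
    have e2 : aff P i k (act P (u * t * z) a) = aff P i' k' (act P (x * z) a) := by
      rw [← congrFun h3, ← act_mul, ← mul_assoc, inv_mul_cancel_right]
    have e3 : aff P i k (rho b) = aff P i' k' (rho b) := by
      rw [← congrFun h3, ← hxθ, ← act_mul, inv_mul_cancel_right, hut ht, hxθ]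
    rw [e1] at h1
    rw [e2] at h2
    have hi := coroot'_rho_lt_of_cross ha hx hnear h1 h2
    have h5 := coroot'_rho_lt ha hx (z := 1) (fun f _ _ h => h) hi
    rw [mul_one] at h5
    simp only [aff] at e1 e3
    rw [map_sub]
    linarith

end Steinberg

/-- The comparison of the spherical and the antispherical module, and their Kazhdan–Lusztig
elements. -/
theorem IsSteinbergElement.exists_zeta_phi {G : Type*} [Group G] {S J J' : Set G} {K : Subgroup G}
    {w₀ u : G} (hS : IsCoxeterLike S) (hJ : J ⊆ S) (hK : IsFiniteParabolic S K w₀)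
    (hu : IsSteinbergElement S J K w₀ u) (hJ' : J' = S ∩ K) :
    ∃ (ζ : Induced S J' vinv →ₗ[(Hecke S)ᵐᵒᵖ] Hecke S)
      (φ : Induced S J' vinv →ₗ[(Hecke S)ᵐᵒᵖ] Induced S J (-v)),
      Function.Injective ζ ∧ (∀ h, ζ (oneTmul S J' vinv h) = KL S w₀ * h) ∧
      (∀ h, φ (oneTmul S J' vinv h) = oneTmul S J (-v) (KL S (u * w₀)) <• h) ∧
      ∀ w, IsMinCoset S K w → (∃ h, KL S w₀ * h = KL S (w₀ * w)) ∧
        ∀ h, KL S w₀ * h = KL S (w₀ * w) →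
          φ (oneTmul S J' vinv h) = oneTmul S J (-v) (KL S (u * w₀ * w)) := by
  subst hJ'
  have hKL := hK.KL_longest hS
  refine ⟨hK.zeta hS, hu.phi hS hJ hK, hK.zeta_injective hS, fun h => ?_,
    hu.phi_oneTmul hS hJ hK, fun w hw => ?_⟩
  · rw [hKL, hK.zeta_oneTmul hS]
  · obtain ⟨h', h1, h2, h3⟩ := hK.exists_KL_eq_parabolicSum_mul hS hw
    rw [hKL]
    refine ⟨⟨h', h3.symm⟩, fun h h4 => ?_⟩
    rw [hK.oneTmul_eq_of_parabolicSum_mul_eq hS (h4.trans h3)]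
    exact hu.phi_eq_KL hS hJ hK hw h1 h2

/-! ### The alcoves in `ρ + 𝒞⁺` -/

section Final

variable {ι V N : Type*} [Finite ι] [AddCommGroup V] [Module ℝ V] [AddCommGroup N] [Module ℝ N]
  {P : RootPairing ι ℝ V N} [P.IsCrystallographic] [P.IsReduced] {b : P.Base}

lemma alcovesAt_rho_subset : alcovesAt b (rho b) ⊆ alcovesAt b 0 := by
  rintro A ⟨hA, hAρ⟩
  refine ⟨hA, fun y hy => ?_⟩
  have h := hAρ hy
  rw [Set.mem_vadd_set_iff_neg_vadd_mem, vadd_eq_add] at h ⊢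
  intro i hi
  have h1 := h i hi
  have h2 := one_le_coroot'_rho hi
  rw [map_add, map_neg] at h1 ⊢
  rw [map_zero]
  linarith

variable {a : V} (ha : a ∈ fundAlcove b)

include ha

omit [Finite ι] [P.IsCrystallographic] [P.IsReduced] ha in
lemma IsFiniteParabolic.isLongest_iff {w₀ : affineWeyl P}
    (hK : IsFiniteParabolic (simpleRefl b) (stab P (rhoBar b)) w₀) {w : affineWeyl P} :
    IsLongest b w ↔ w = w₀ := by
  constructor
  · rintro ⟨hw, h⟩
    by_contra hne
    have := h w₀ hK.longest_mem
    have := hK.length_lt w hw hne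
    omega
  · rintro rfl
    exact ⟨hK.longest_mem, fun y hy => hK.length_le hy⟩

/-- The element mapping A_fund to ρ + A_fund takes hyperplanes through ρbar to hyperplanes through
ρ, and ρ + 𝒞⁺ is on the side of ρ + A_fund of all of these. -/
lemma isNear_rhoElt {A : Set V} (hA : A ∈ alcovesAt b (rho b)) :
    IsNear P a (rhoBar b) (rhoElt b A) := by
  have hx := act_alcoveElt_rho ha
  have hxθ := act_rhoBar_of_mem_add ha hx
  intro f hf hfθ hfa
  have hg := comp_act_mem (alcoveElt b (rhoAlcove b))⁻¹ hf
  obtain ⟨i, k, hik⟩ := hg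
  have e0 : aff P i k (rho b) = 0 := by rw [← congrFun hik, ← hxθ, act_inv_act, hfθ]
  have e1 : 0 < aff P i k (rho b + a) :=
    pos_of_mem_cell (isRegular_rho_add ha) hx (aff_mem i k) (by
      rw [← congrFun hik, act_inv_act]; exact hfa)
  have hi := isPos_of_aff_rho ha e0 e1
  have h1 := hA.2 (act_alcoveElt_mem ha hA.1)
  rw [Set.mem_vadd_set_iff_neg_vadd_mem, vadd_eq_add] at h1
  have h2 := h1 i hi
  rw [rhoElt, act_mul]
  have e2 := congrFun hik (act P (alcoveElt b A) a)
  rw [e2]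
  rw [map_add, map_neg] at h2
  simp only [aff] at e0 ⊢
  linarith

end Final

end AlcoveKL

end

/-! ### The comparison theorem -/

theorem mainTheorem6 {ι V N : Type*} [Finite ι]
    [AddCommGroup V] [Module ℝ V] [AddCommGroup N] [Module ℝ N]
    (P : RootPairing ι ℝ V N) [P.IsRootSystem] [P.IsCrystallographic] [P.IsReduced]
    (b : P.Base) :
    -- the notions that enter the statement are well defined
    Set.BijOn (fun w => AlcoveKL.actSet P w (AlcoveKL.fundAlcove b)) Set.univ (AlcoveKL.alcoves b) ∧
    (∃! μ : V, AlcoveKL.IsFundRep b (AlcoveKL.rho b) μ) ∧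
    (∃! w : AlcoveKL.affineWeyl P, AlcoveKL.IsLongest b w) ∧
    (∀ w : AlcoveKL.affineWeyl P,
      ∃! h : AlcoveKL.AffHecke b, AlcoveKL.IsKLElement (AlcoveKL.simpleRefl b) w h) ∧
    AlcoveKL.rhoAlcove b ∈ AlcoveKL.alcoves b ∧
    AlcoveKL.alcovesAt b (AlcoveKL.rho b) ⊆ AlcoveKL.alcovesAt b 0 ∧
    ∃ (ζ : AlcoveKL.Sph b →ₗ[(AlcoveKL.AffHecke b)ᵐᵒᵖ] AlcoveKL.AffHecke b)
      (φ : AlcoveKL.Sph b →ₗ[(AlcoveKL.AffHecke b)ᵐᵒᵖ] AlcoveKL.Asph b),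
      Function.Injective ζ ∧
      (∀ h : AlcoveKL.AffHecke b, ζ (AlcoveKL.sphMk b h) =
        AlcoveKL.KL (AlcoveKL.simpleRefl b) (AlcoveKL.longest b) * h) ∧
      (∀ A ∈ AlcoveKL.alcovesAt b (AlcoveKL.rho b), ζ (AlcoveKL.sphKL b A) =
        AlcoveKL.KL (AlcoveKL.simpleRefl b) (AlcoveKL.longest b * AlcoveKL.rhoElt b A)) ∧
      (∀ h : AlcoveKL.AffHecke b, φ (AlcoveKL.sphMk b h) =
        AlcoveKL.asphKL b (AlcoveKL.rhoAlcove b) <• h) ∧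
      -- the Kazhdan–Lusztig elements correspond under the morphism
      ∀ A ∈ AlcoveKL.alcovesAt b (AlcoveKL.rho b),
        φ (AlcoveKL.sphKL b A) = AlcoveKL.asphKL b A := by
  obtain ⟨a, ha⟩ := AlcoveKL.fundAlcove_nonempty (b := b)
  have hS := AlcoveKL.isCoxeterLike_simpleRefl ha
  have hx := AlcoveKL.act_alcoveElt_rho ha
  obtain ⟨u, hu⟩ := AlcoveKL.exists_act_mem_cell ha (AlcoveKL.isRegular_rho_sub ha)
  have hK := AlcoveKL.isFiniteParabolic_isotropy ha hx hu
  have hst := AlcoveKL.isSteinbergElement ha hx hu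
  have hunique : ∃! w, AlcoveKL.IsLongest b w :=
    ⟨_, (AlcoveKL.IsFiniteParabolic.isLongest_iff hK).2 rfl,
      fun w => (AlcoveKL.IsFiniteParabolic.isLongest_iff hK).1⟩
  have hlong : AlcoveKL.longest b = u⁻¹ * AlcoveKL.alcoveElt b (AlcoveKL.rhoAlcove b) :=
    (AlcoveKL.IsFiniteParabolic.isLongest_iff hK).1
      (Classical.epsilon_spec (p := AlcoveKL.IsLongest b) hunique.exists)
  rw [← hlong] at hK hst
  have hul : u * AlcoveKL.longest b = AlcoveKL.alcoveElt b (AlcoveKL.rhoAlcove b) := by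
    rw [hlong, mul_inv_cancel_left]
  obtain ⟨ζ, φ, hinj, hζ, hφ, hmin⟩ := hst.exists_zeta_phi hS AlcoveKL.simpleReflFin_subset hK
    (J' := AlcoveKL.simpleRefl b ∩ AlcoveKL.isotropy b) rfl
  have hmin' (A : Set V) (hA : A ∈ AlcoveKL.alcovesAt b (AlcoveKL.rho b)) :=
    hmin (AlcoveKL.rhoElt b A)
      ((AlcoveKL.isNear_rhoElt ha hA).isMinCoset ha (AlcoveKL.rhoBar_mem ha))
  have hspec (A : Set V) (hA : A ∈ AlcoveKL.alcovesAt b (AlcoveKL.rho b)) :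
      ∃ h : AlcoveKL.AffHecke b, AlcoveKL.sphKL b A = AlcoveKL.sphMk b h ∧
        AlcoveKL.KL (AlcoveKL.simpleRefl b) (AlcoveKL.longest b) * h =
          AlcoveKL.KL (AlcoveKL.simpleRefl b) (AlcoveKL.longest b * AlcoveKL.rhoElt b A) := by
    obtain ⟨h, h1⟩ := (hmin' A hA).1
    exact Classical.epsilon_spec (p := fun m => ∃ h : AlcoveKL.AffHecke b, m = AlcoveKL.sphMk b h ∧
      AlcoveKL.KL (AlcoveKL.simpleRefl b) (AlcoveKL.longest b) * h =
        AlcoveKL.KL (AlcoveKL.simpleRefl b) (AlcoveKL.longest b * AlcoveKL.rhoElt b A))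
      ⟨_, h, rfl, h1⟩
  refine ⟨AlcoveKL.bijOn_actSet ha, AlcoveKL.existsUnique_isFundRep ha, hunique,
    AlcoveKL.existsUnique_isKLElement hS, AlcoveKL.rhoAlcove_mem_alcoves ha,
    AlcoveKL.alcovesAt_rho_subset, ζ, φ, hinj, hζ, fun A hA => ?_, fun h => ?_, fun A hA => ?_⟩
  · obtain ⟨h, h1, h2⟩ := hspec A hA
    rw [h1, ← h2]
    exact hζ h
  · rw [AlcoveKL.asphKL, ← hul]
    exact hφ h
  · obtain ⟨h, h1, h2⟩ := hspec A hA
    have h3 : u * AlcoveKL.longest b * AlcoveKL.rhoElt b A = AlcoveKL.alcoveElt b A := by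
      rw [hul, AlcoveKL.rhoElt, mul_inv_cancel_left]
    rw [h1, AlcoveKL.asphKL, ← h3]
    exact (hmin' A hA).2 h h2
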